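/- For every $s\ge 1$ put $n=12s+6$ and $\gamma=3s+5$, $\delta=2$, $\varepsilon=1$ in $\mathbb Z_n$. There is a family of current graphs (one for each $s\ge1$) with current group $\mathbb Z_n$ with the following properties. (1) The current graph has index 1 (its embedding has one face) and satisfies: every vertex has degree 1 or 3; the log of the face-boundary walk (the sequence of currents of the traversed arcs) consists of nonzero elements, each appearing exactly once, where the element of order 2, which lies on an edge with a free end of degree 1 and appears twice consecutively, is recorded once; unlabelled vertices of degree 3 satisfy Kirchhoff's current law; all other vertices except the free end are vortices of type (V1), (V2) or (V3), and their face corners carry distinct letters. Here the excess of a vertex is the sum of the entering currents; (V1), (V2) are vertices of degree 1 whose excess generates $\mathbb Z_n$, respectively its index-2 subgroup, and (V3) is a vertex of degree 3 whose excess generates the index-3 subgroup and whose incoming currents are all congruent modulo 3 to one $j\not\equiv0$. The vortices are $x$ of type (V1) with excess $\varepsilon$, $y$ of type (V2) with excess $\delta$, and two of type (V3) with corners $a,b,c$ and $u,v,w$; with the letters written at their corners the log has the cyclic form $$(\dots\ u\ \ \delta\ \ y\ \ {-\delta}\ \ v\ \ \gamma\ \ c\ \dots\ b\ \ \varepsilon\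 \ x\ \ {-\varepsilon}\ \ a\ \ {-\gamma}\ \ w\ \dots).$$ For $s=1$ the log is $(9\ 6\ 13\ u\ 2\ y\ 16\ v\ 8\ c\ 4\ 7\ 12\ 3\ 14\ b\ 1\ x\ 17\ a\ 10\ w\ 5\ 11\ 15)$. (2) In the derived embedding, the vertices are the numbers $i\in\mathbb Z_n$ and the letters $a,b,c,u,v,w,x,y_0,y_1$. Ignoring letters, the rotation at $i$ is the log with $i$ added to every element; this embeds the complete graph on $\mathbb Z_n$. The long faces coming from the vortices are subdivided by the lettered vertices so that the rotation at $0$ is the log (with $y_0$ for $y$), where $y_0$ and $y_1$ lie on the faces of the (V2) vortex $y$ incident with $0$ and with $1$. The derived embedding is triangular and contains the triangular face $[z,-\gamma,\delta]$, where $z=b$ for $s=1$ and $z=9s+10$ for $s\ge2$. (3) From the derived embedding one obtains an embedding of $K_{12s+14}$ by the following operations. (i) The edges $(0,\delta)$, $(0,\gamma)$, $(0,-\gamma)$, $(0,\varepsilon)$ are flipped to $(u,y_0)$, $(v,c)$, $(a,w)$, $(b,x)$. (ii) Four handles add all missing edges between $a,b,c,u,v,w,x,y_0$; the resulting embedding is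 triangular, and the rotations at the numbered vertices other than $0$ are those of the derived embedding, except possibly with $0$ missing. (iii) A fifth handle modifies the rotation at $z$ so that $0,\delta,\gamma,-\gamma$ are all on one face, and the edges $(0,\delta)$, $(0,\gamma)$, $(0,-\gamma)$ are drawn in that face. (iv) A final handle, near the edges $(0,y_0)$ and $(\varepsilon,y_1)$, adds the edges $(0,\varepsilon)$ and $(y_0,y_1)$. (v) The edge $(y_0,y_1)$ is contracted. (4) The resulting embedding of $K_{12s+14}$ has minimum genus. Its genus, and hence the orientable genus of $K_N$ for $N=12s+14$, is $\left\lceil (N-3)(N-4)/12\right\rceil$. -/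

import Mathlib

open Equiv

/-! ### Rotation systems (cellular embeddings in oriented surfaces) -/

/-- A rotation system on a simple graph with vertex set `V`: every vertex `v` carries a cyclic
permutation `rot v` of its neighbours (and `rot v` fixes every non-neighbour of `v`). -/
structure RotationSystem (V : Type*) where
  graph : SimpleGraph V
  rot : V → Perm V
  isCycleOn : ∀ v, (rot v).IsCycleOn (graph.neighborSet v)
  rot_of_not_adj : ∀ v w, ¬ graph.Adj v w → rot v w = w

namespace RotationSystem

variable {V : Type*} (M : RotationSystem V)

theorem adj_rot {v u : V} (h : M.graph.Adj v u) : M.graph.Adj v (M.rot v u) :=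
  (M.isCycleOn v).1.mapsTo h

theorem adj_rot_symm {v u : V} (h : M.graph.Adj v u) : M.graph.Adj v ((M.rot v).symm u) := by
  obtain ⟨w, hw, rfl⟩ := (M.isCycleOn v).1.surjOn h
  simpa using hw

/-- Face tracing: an arc `(u, v)` is followed by the arc `(v, rot v u)`. -/
def facePerm : Perm M.graph.Dart where
  toFun d := ⟨(d.snd, M.rot d.snd d.fst), M.adj_rot d.adj.symm⟩
  invFun d := ⟨((M.rot d.fst).symm d.snd, d.fst), (M.adj_rot_symm d.adj).symm⟩
  left_inv d := by ext <;> simp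
  right_inv d := by ext <;> simp

/-- The faces are the orbits of face tracing. -/
def Face : Type _ := Quotient (Perm.SameCycle.setoid M.facePerm)

/-- `M` is an embedding of a connected graph in the orientable surface of genus `g`,
by the Euler polyhedral equation `|V| - |E| + |F| = 2 - 2g`. -/
def HasGenus (g : ℕ) : Prop :=
  M.graph.Connected ∧
    (Nat.card V : ℤ) - (Nat.card M.graph.edgeSet : ℤ) + (Nat.card M.Face : ℤ) = 2 - 2 * (g : ℤ)

/-- No embedding of the same graph has smaller genus. -/
def IsMinimumGenus : Prop :=
  ∃ g, M.HasGenus g ∧ ∀ N : RotationSystem V, N.graph = M.graph → ∀ g', N.HasGenus g' → g ≤ g'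

/-- `[x, y, z]` is a (positively traversed) triangular face. -/
def IsTriangle (x y z : V) : Prop :=
  M.graph.Adj x y ∧ M.rot y x = z ∧ M.rot z y = x ∧ M.rot x z = y

/-- Every face is a triangle. -/
def IsTriangular : Prop :=
  ∀ u v, M.graph.Adj u v → M.IsTriangle u v (M.rot v u)

/-- The arcs `(p, u)` and `(q, w)` are on the same face. A corner of the embedding at `u` is named
by the arc `(p, u)` through which its face enters `u`; the corner lies between `p` and `rot u p`. -/
def SameFace (p u q w : V) : Prop :=
  ∃ (h : M.graph.Adj p u) (h' : M.graph.Adj q w),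
    M.facePerm.SameCycle ⟨(p, u), h⟩ ⟨(q, w), h'⟩

/-- All vertices of `S` occur on one common face. -/
def OnCommonFace (S : Set V) : Prop :=
  ∃ d : M.graph.Dart, ∀ z ∈ S, ∃ d' : M.graph.Dart, M.facePerm.SameCycle d d' ∧ d'.fst = z

variable [DecidableEq V] (N : RotationSystem V)

/-- `N` arises from `M` by flipping the edge `pq`: the edge is shared by the triangular faces
`[p, q, r]` and `[q, p, t]`, and is replaced by the other diagonal `rt` of the resulting
quadrangle, where `r` and `t` are distinct and not adjacent. At `p`, `r → q → t` becomes `r → t`;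
at `q`, `t → p → r` becomes `t → r`; at `r`, `q → p` becomes `q → t → p`; at `t`, `p → q` becomes
`p → r → q`. -/
def EdgeFlip (p q r t : V) : Prop :=
  M.IsTriangle p q r ∧ M.IsTriangle q p t ∧ r ≠ t ∧ ¬ M.graph.Adj r t ∧
  N.graph = M.graph.deleteEdges {s(p, q)} ⊔ SimpleGraph.edge r t ∧
  N.rot p = M.rot p * swap r q ∧
  N.rot q = M.rot q * swap t p ∧
  N.rot r = M.rot r * swap q t ∧
  N.rot t = M.rot t * swap p r ∧
  ∀ z, z ≠ p → z ≠ q → z ≠ r → z ≠ t → N.rot z = M.rot z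

/-- `N` arises from `M` by adding a new edge `uw`, whose end at `u` is inserted into the corner
`(p, u)` and whose end at `w` is inserted into the corner `(q, w)`: at `u`, `p → p'` becomes
`p → w → p'`, and at `w`, `q → q'` becomes `q → u → q'`. -/
def AddEdge (p u q w : V) : Prop :=
  u ≠ w ∧ ¬ M.graph.Adj u w ∧ M.graph.Adj p u ∧ M.graph.Adj q w ∧
  N.graph = M.graph ⊔ SimpleGraph.edge u w ∧
  N.rot u = M.rot u * swap p w ∧
  N.rot w = M.rot w * swap q u ∧
  ∀ z, z ≠ u → z ≠ w → N.rot z = M.rot z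

/-- A new edge `uw` is drawn inside a face. -/
def AddEdgeInFace (u w : V) : Prop :=
  ∃ p q, M.SameFace p u q w ∧ AddEdge M N p u q w

/-- A handle is attached between two different faces and a new edge `uw` is drawn along it. -/
def AddEdgeOnHandle (u w : V) : Prop :=
  ∃ p q, ¬ M.SameFace p u q w ∧ AddEdge M N p u q w

/-- One handle modifies the rotation at `v`, by interchanging two blocks of the rotation: either
`(A B C)` becomes `(A C B)`, where the three corners between the blocks lie in different faces,
which are merged into one; or `(A B C D)` becomes `(A D C B)`, where the four corners between the
blocks lie in different faces, which are merged into two. Here `p₁, p₂, …` are the last elements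
of `A, B, …`; their cyclic order is forced, since the new rotation is again cyclic. -/
def VertexHandle (v : V) : Prop :=
  N.graph = M.graph ∧ (∀ z, z ≠ v → N.rot z = M.rot z) ∧
  ((∃ p : Fin 3 → V, (∀ i, M.graph.Adj (p i) v) ∧ (∀ i j, i ≠ j → ¬ M.SameFace (p i) v (p j) v) ∧
      N.rot v = M.rot v * (swap (p 0) (p 1) * swap (p 1) (p 2))) ∨
   (∃ p : Fin 4 → V, (∀ i, M.graph.Adj (p i) v) ∧ (∀ i j, i ≠ j → ¬ M.SameFace (p i) v (p j) v) ∧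
      N.rot v = M.rot v * (swap (p 0) (p 2) * swap (p 1) (p 3))))

/-- `HandleSteps k M N`: the embedding `N` arises from `M` by attaching `k` handles and drawing
new edges. -/
inductive HandleSteps : ℕ → RotationSystem V → RotationSystem V → Prop
  | refl (M : RotationSystem V) : HandleSteps 0 M M
  | inFace {k : ℕ} {M N P : RotationSystem V} (u w : V) :
      HandleSteps k M N → AddEdgeInFace N P u w → HandleSteps k M P
  | onHandle {k : ℕ} {M N P : RotationSystem V} (u w : V) :
      HandleSteps k M N → AddEdgeOnHandle N P u w → HandleSteps (k + 1) M P
  | atVertex {k : ℕ} {M N P : RotationSystem V} (v : V) :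
      HandleSteps k M N → VertexHandle N P v → HandleSteps (k + 1) M P

open Classical in
/-- `N` arises from `M` by contracting the edge `pq`, where `p` and `q` have no common neighbour;
the contracted vertex keeps the name `p`. Its rotation runs through the neighbours of `p`
from the one after `q`, then through the neighbours of `q` from the one after `p`. -/
def IsContraction (p q : V) (N : RotationSystem {z : V // z ≠ q}) : Prop :=
  M.graph.Adj p q ∧ (∀ z, ¬ (M.graph.Adj p z ∧ M.graph.Adj q z)) ∧
  (∀ z z' : {z : V // z ≠ q}, N.graph.Adj z z' ↔
    z ≠ z' ∧ (M.graph.Adj z z' ∨ (z.1 = p ∧ M.graph.Adj q z') ∨ (z'.1 = p ∧ M.graph.Adj z q))) ∧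
  (∀ z z' : {z : V // z ≠ q}, N.graph.Adj z z' →
    (N.rot z z' : V) =
      if z.1 = p then
        if M.graph.Adj p z' then
          if M.rot p z' ≠ q then M.rot p z' else if M.rot q p ≠ p then M.rot q p else M.rot p q
        else
          if M.rot q z' ≠ p then M.rot q z' else if M.rot p q ≠ q then M.rot p q else M.rot q p
      else
        let z'' := if z'.1 = p ∧ M.graph.Adj z q then q else z'.1
        if M.rot z z'' = q then p else M.rot z z'')

end RotationSystem

/-! ### Current graphs -/

/-- A graph embedded in an oriented surface, given by its arcs: `rev` reverses an arc, and `rot`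
sends an arc to the next arc in the rotation at its tail. The arcs carry currents in `Γ`, and the
face corner at the head of an arc `a`, through which a face-boundary walk passes after traversing
`a`, may carry a label. -/
structure CurrentGraph (Γ : Type) [AddCommGroup Γ] (Λ : Type) where
  Arc : Type
  [fintypeArc : Fintype Arc]
  rev : Perm Arc
  rev_rev : ∀ a, rev (rev a) = a
  rev_ne : ∀ a, rev a ≠ a
  rot : Perm Arc
  current : Arc → Γ
  current_rev : ∀ a, current (rev a) = - current a
  label : Arc → Option Λ

attribute [instance] CurrentGraph.fintypeArc

namespace CurrentGraph

variable {Γ : Type} [AddCommGroup Γ] {Λ : Type} (G : CurrentGraph Γ Λ)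

/-- The successor of an arc in its face-boundary walk. -/
def facePerm : Perm G.Arc := G.rev.trans G.rot

/-- The embedding has exactly one face (in particular the graph is connected). -/
def HasIndexOne : Prop :=
  Nonempty G.Arc ∧ ∀ a b, G.facePerm.SameCycle a b

/-- The degree of the tail of the arc `a`. -/
noncomputable def degree (a : G.Arc) : ℕ := Function.minimalPeriod G.rot a

open Classical in
/-- The excess of the tail of the arc `a`: the sum of the currents entering that vertex. -/
noncomputable def excess (a : G.Arc) : Γ :=
  ∑ b with G.rot.SameCycle a b, G.current (G.rev b)

/-- The tail of `a` is the free end of the arc that carries the element of order 2. -/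
def IsFreeEnd (a : G.Arc) : Prop := G.degree a = 1 ∧ addOrderOf (G.current a) = 2

/-- The tail of `a` is a vortex. -/
def IsVortex (a : G.Arc) : Prop := G.excess a ≠ 0 ∧ ¬ G.IsFreeEnd a

/-- (V1): degree 1, and the excess generates the group. -/
def IsV1 (a : G.Arc) : Prop :=
  G.degree a = 1 ∧ AddSubgroup.zmultiples (G.excess a) = ⊤

/-- (V2): degree 1, and the excess generates the index 2 subgroup. -/
def IsV2 (a : G.Arc) : Prop :=
  G.degree a = 1 ∧ (AddSubgroup.zmultiples (G.excess a)).index = 2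

/-- (V3): degree 3, the excess generates the index 3 subgroup, and the incoming currents are all
congruent to one `j ≢ 0` modulo 3. -/
def IsV3 {n : ℕ} {Λ : Type} (G : CurrentGraph (ZMod n) Λ) (a : G.Arc) : Prop :=
  G.degree a = 3 ∧ (AddSubgroup.zmultiples (G.excess a)).index = 3 ∧
    ∃ j, (j = 1 ∨ j = 2) ∧ ∀ b, G.rot.SameCycle a b → (G.current (G.rev b)).val % 3 = j

/-- The standard properties of an index 1 current graph. -/
structure IsStandard {n : ℕ} {Λ : Type} (G : CurrentGraph (ZMod n) Λ) : Prop where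
  indexOne : G.HasIndexOne
  /-- Vertices are of degree 1 and 3. -/
  degree_eq : ∀ a, G.degree a = 1 ∨ G.degree a = 3
  /-- The log of the face-boundary walk consists of nonzero elements. -/
  current_ne_zero : ∀ a, G.current a ≠ 0
  /-- Each nonzero element appears exactly once in the log. -/
  current_unique : ∀ g : ZMod n, g ≠ 0 → addOrderOf g ≠ 2 → ∃! a, G.current a = g
  /-- The order 2 element is the current of exactly one edge (recorded once in the log). -/
  current_order_two : ∀ g : ZMod n, addOrderOf g = 2 →
    ∃ a, ∀ b, G.current b = g ↔ b = a ∨ b = G.rev a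
  /-- That edge is incident with a degree-1 vertex. -/
  order_two_end : ∀ a, addOrderOf (G.current a) = 2 → G.IsFreeEnd a ∨ G.IsFreeEnd (G.rev a)
  /-- Unlabelled vertices of degree 3 satisfy Kirchhoff's current law. -/
  kirchhoff : ∀ a, G.degree a = 3 → G.label (G.rev a) = none → G.excess a = 0
  /-- The corners of the vortices, and no others, are labelled. -/
  label_isSome_iff : ∀ a, (G.label (G.rev a)).isSome ↔ G.IsVortex a
  /-- The labels are distinct. -/
  label_injective : ∀ a b l, G.label a = some l → G.label b = some l → a = b
  vortex_type : ∀ a, G.IsVortex a → G.IsV1 a ∨ G.IsV2 a ∨ G.IsV3 a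

end CurrentGraph

/-- Labels of the face corners of the vortices. -/
inductive CornerLabel
  | a | b | c | u | v | w | x | y
  deriving DecidableEq

/-- Lettered vertices of the derived embedding. -/
inductive Letter
  | a | b | c | u | v | w | x | y₀ | y₁
  deriving DecidableEq

/-- The letter that the label of a (V1) or (V2) corner contributes at the numbered vertex `i`. A
(V2) corner labelled `y` gives `y₀` on the face incident with the even numbers and `y₁` on the
other one. -/
def CornerLabel.toLetter {n : ℕ} (i : ZMod n) : CornerLabel → Letter
  | .a => .a
  | .b => .b
  | .c => .c
  | .u => .u
  | .v => .v
  | .w => .w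
  | .x => .x
  | .y => if i.val % 2 = 0 then .y₀ else .y₁

/-- Vertices of the derived embedding: numbered and lettered ones. -/
abbrev DerivedVertex (n : ℕ) : Type := ZMod n ⊕ Letter

/-- The numbered vertex `i`. -/
abbrev num {n : ℕ} (i : ZMod n) : DerivedVertex n := Sum.inl i

/-- The lettered vertex `l`. -/
abbrev lett (n : ℕ) (l : Letter) : DerivedVertex n := Sum.inr l

namespace CurrentGraph

variable {n : ℕ} (G : CurrentGraph (ZMod n) CornerLabel)

/-- The arc entering the head of `a` that comes after `a` in the rotation there. -/
def nextIncoming : Perm G.Arc := G.facePerm.trans G.rev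

/-- The letter in the rotation at the numbered vertex `i` at the corner after the arc `a`, if any.
In the embedding of the complete graph on the numbers, where the successor of `i + current a` in
the rotation at `i` is `i + current (facePerm a)`, the face through the corner `a` at `i`
continues through the corner `a' = nextIncoming a` at `i - current a'`. So, when the currents
entering a vortex of type (V3) are all congruent to `j` modulo 3, the corner `a` at `i` is on
the same face as the `i * j`-th corner after `a` at `0`. At a vertex of degree 1,
`nextIncoming a = a`. -/
def letterAt (i : ZMod n) (a : G.Arc) : Option Letter :=
  (G.label ((G.nextIncoming ^ (i.val * (G.current a).val % 3)) a)).map (CornerLabel.toLetter i)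

/-- `D` is the derived embedding of `G`: the rotation at the numbered vertex `i` is the log with
`i` added to each element and with the letters in the corners, the order 2 element being recorded
once, and the lettered vertices subdivide the long faces into triangles. -/
structure IsDerived (D : RotationSystem (DerivedVertex n)) : Prop where
  adj_num : ∀ i j, D.graph.Adj (num i) (num j) ↔ i ≠ j
  adj_lett : ∀ i l, D.graph.Adj (num i) (lett n l) ↔ ∃ a, G.letterAt i a = some l
  not_adj : ∀ l l', ¬ D.graph.Adj (lett n l) (lett n l')
  rot_num : ∀ i a, G.letterAt i a = none → ¬ G.IsFreeEnd (G.rev a) →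
    D.rot (num i) (num (i + G.current a)) = num (i + G.current (G.facePerm a))
  rot_num_lett : ∀ i a l, G.letterAt i a = some l →
    D.rot (num i) (num (i + G.current a)) = lett n l ∧
    D.rot (num i) (lett n l) = num (i + G.current (G.facePerm a)) ∧
    D.rot (lett n l) (num i) = num (i + G.current a)

/-- The arrangement of the vortices: `x` is of type (V1) with excess `ε`, `y` is of type (V2) with
excess `δ`, the corners `a, b, c` and the corners `u, v, w` belong to two vortices of type (V3),
and the log, with the letters, is of the form
`(… u δ y -δ v γ c … b ε x -ε a -γ w …)`. -/
def HasVortices (γ δ ε : ZMod n) : Prop :=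
  ∃ aδ aγ aε : G.Arc, G.current aδ = δ ∧ G.current aγ = γ ∧ G.current aε = ε ∧
    G.IsV1 (G.rev aε) ∧ G.IsV2 (G.rev aδ) ∧ G.IsV3 aδ ∧ G.IsV3 aε ∧
    G.excess (G.rev aδ) = δ ∧ G.excess (G.rev aε) = ε ∧
    G.label (G.facePerm.symm aδ) = some .u ∧ G.label aδ = some .y ∧
    G.facePerm aδ = G.rev aδ ∧ G.label (G.rev aδ) = some .v ∧
    G.facePerm (G.rev aδ) = aγ ∧ G.label aγ = some .c ∧
    G.label (G.facePerm.symm aε) = some .b ∧ G.label aε = some .x ∧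
    G.facePerm aε = G.rev aε ∧ G.label (G.rev aε) = some .a ∧
    G.facePerm (G.rev aε) = G.rev aγ ∧ G.label (G.rev aγ) = some .w

/-- The log of the face-boundary walk from `a`, with the letters: the first `k` arcs, each with its
current and the label (if any) of the corner that follows it. -/
def log (a : G.Arc) (k : ℕ) : List (ZMod n × Option CornerLabel) :=
  (List.range k).map fun i => (G.current ((G.facePerm ^ i) a), G.label ((G.facePerm ^ i) a))

end CurrentGraph

/-! ### The additional adjacencies -/

/-- The complete graph on the eight lettered vertices other than `y₁`. -/
def lettersComplete (n : ℕ) : SimpleGraph (DerivedVertex n) where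
  Adj z z' := ∃ l l', z = lett n l ∧ z' = lett n l' ∧ l ≠ l' ∧ l ≠ .y₁ ∧ l' ≠ .y₁
  symm := ⟨by
    rintro _ _ ⟨l, l', rfl, rfl, h, h₁, h₂⟩
    exact ⟨l', l, rfl, rfl, h.symm, h₂, h₁⟩⟩
  loopless := ⟨by
    rintro _ ⟨l, l', rfl, h, h', -⟩
    exact h' (Sum.inr_injective h)⟩

section AdditionalAdjacency

variable {n : ℕ}

/-- The edges `(0, δ)`, `(0, γ)`, `(0, -γ)`, `(0, ε)` are flipped and replaced with the edges
`(u, y₀)`, `(v, c)`, `(a, w)`, `(b, x)`. -/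
def FourFlips (γ δ ε : ZMod n) (D M₁ : RotationSystem (DerivedVertex n)) : Prop :=
  ∃ F₁ F₂ F₃ : RotationSystem (DerivedVertex n),
    D.EdgeFlip F₁ (num 0) (num δ) (lett n .u) (lett n .y₀) ∧
    F₁.EdgeFlip F₂ (num 0) (num γ) (lett n .v) (lett n .c) ∧
    F₂.EdgeFlip F₃ (num 0) (num (-γ)) (lett n .a) (lett n .w) ∧
    F₃.EdgeFlip M₁ (num 0) (num ε) (lett n .b) (lett n .x)

/-- Four handles add all missing edges between `a, b, c, u, v, w, x, y₀`, and the embedding stays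
triangular. The rotations at the numbered vertices besides `0` are those of `D`, except possibly
with `0` missing. -/
def FourHandles (D M₁ M₂ : RotationSystem (DerivedVertex n)) : Prop :=
  RotationSystem.HandleSteps 4 M₁ M₂ ∧ M₂.IsTriangular ∧
  M₂.graph = M₁.graph ⊔ lettersComplete n ∧
  ∀ i : ZMod n, i ≠ 0 →
    M₂.rot (num i) = D.rot (num i) ∨
    M₂.rot (num i) = D.rot (num i) * swap ((D.rot (num i)).symm (num 0)) (num 0)

/-- One handle modifies the rotation at `z` so that `0, δ, γ, -γ` are all on one face, in which
the edges `(0, δ)`, `(0, γ)`, `(0, -γ)` are then drawn. -/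
def FifthHandle (γ δ : ZMod n) (z : DerivedVertex n)
    (M₂ M₃ : RotationSystem (DerivedVertex n)) : Prop :=
  ∃ H₁ H₂ H₃ : RotationSystem (DerivedVertex n),
    M₂.VertexHandle H₁ z ∧
    H₁.OnCommonFace {num 0, num δ, num γ, num (-γ)} ∧
    H₁.AddEdgeInFace H₂ (num 0) (num δ) ∧
    H₂.AddEdgeInFace H₃ (num 0) (num γ) ∧
    H₃.AddEdgeInFace M₃ (num 0) (num (-γ))

/-- One handle, near the edges `(0, y₀)` and `(ε, y₁)`, adds the edges `(0, ε)` and `(y₀, y₁)`. -/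
def FinalHandle (ε : ZMod n) (M₃ M₄ : RotationSystem (DerivedVertex n)) : Prop :=
  M₃.graph.Adj (num 0) (lett n .y₀) ∧ M₃.graph.Adj (num ε) (lett n .y₁) ∧
  ∃ H : RotationSystem (DerivedVertex n),
    M₃.AddEdgeOnHandle H (num 0) (num ε) ∧ H.AddEdgeInFace M₄ (lett n .y₀) (lett n .y₁)

end AdditionalAdjacency

/-!
The embedding of the complete graph on `12 * s + 14` vertices comes from a current graph over `ZMod
(12 * s + 6)` whose vertices have degree 1 or 3. Since every nonzero element is the current of one
arc, the group itself serves as the set of arcs (the arc `0` being the reverse of the arc of order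
2), and the current graph is a permutation `r` of the group with `r ^ 3 = 1`; see `orderThreeGraph`.
What the theorem asks of it is condensed in `IsAdmissible`: Kirchhoff's law `x + r x + r (r x) = 0`
away from the vortices, prescribed values at the vortices, and a single face. For `s = 1` such an
`r` is a table. For `s ≥ 2` it consists of four families of triples in arithmetic progressions and
some exceptional triples (`succArc`), and the face-boundary walk is followed along its regular runs
(`sameCycle_largeRot`).

In the derived embedding the rotation at `i` is the log translated by `i`, with letters inserted at
the corners of the vortices, and the steps of the rotation at a letter are the currents into its
vortex (`derived`). Kirchhoff's law makes the faces between numbers triangles, and the faces at a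
letter are triangles by construction (`derived_isTriangular`). The rotation at a letter is cyclic
because the excess of its vortex generates the subgroup of index 1, 2 or 3 (`sameCycle_letterPerm`).

Faces are counted through the permutation `arcPerm` of all ordered pairs of vertices. Drawing an
edge or attaching a handle multiplies `arcPerm` by transpositions, each of which merges two cycles
or splits one, so the effect on the number of faces is determined by whether arcs lie on a common
face.

The four edge flips take place at `0` and make four pairs of letters adjacent (`exists_fourFlips`).
The handles that complete the graph on the eight letters `a, b, c, u, v, w, x, y₀` involve only
eight triangles at `0`, the same for all `s`. Each of the four handles adds six edges: three times,
three triangles at a vertex are merged into a nonagon, in which the ears at that vertex are cut off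
and the remaining hexagon is triangulated anew; and one time two disjoint triangles are joined by a
tube that is triangulated. This is written as a list of elementary operations on a finite record of
corners, `Surgery.script`, which is checked by evaluation; a face that closes up among recorded
corners is a face of any embedding that agrees with the record, so the result carries over to the
derived embeddings for all `s` (`Surgery.Realizes.run`).

The fifth handle permutes blocks of the rotation at `z`, merging the triangle `[z, -γ, δ]` with two
triangles at `z` through `0` and `γ`, and the merged face has room for three edges at `0`
(`exists_handle_and_three_edges`). The last handle joins a face at the edge `(0, y₀)` to the
triangle `[y₁, ε, -ε]` (`exists_edge_on_handle_and_edge`). As `y₀` is adjacent to the even numbers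
and `y₁` to the odd ones, contracting `y₀y₁` yields the complete graph. In total `3 |F| = 2 |E| -
5`, and for a complete graph on `12 * s + 14` vertices no embedding has a larger number of faces,
since `3 |F| ≤ 2 |E|` and Euler's formula fixes the parity of `|F|` (`le_of_hasGenus`).
-/

/-! ### Cycles of a permutation multiplied by a transposition -/

namespace Equiv.Perm

/-- If each step of `f` stays inside a cycle of `g`, then the cycles of `f` do. -/
theorem SameCycle.of_apply {β : Type*} {f g : Perm β} {a b : β}
    (hstep : ∀ a, g.SameCycle a (f a)) (h : f.SameCycle a b) : g.SameCycle a b := by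
  obtain ⟨i, rfl⟩ := h
  induction i using Int.induction_on with
  | zero => simp [SameCycle.refl]
  | succ i ih => rw [add_comm, zpow_add, mul_apply, zpow_one]; exact ih.trans (hstep _)
  | pred i ih =>
    refine ih.trans ?_
    have := hstep ((f ^ (-(i : ℤ) - 1)) a)
    rwa [← mul_apply, mul_self_zpow, show -(i : ℤ) - 1 + 1 = -i by ring, sameCycle_comm] at this

variable {α : Type*} [DecidableEq α] {f : Perm α} {x y z a b : α}

/-- If `y` is the first element of `{x, y}` that the `f`-orbit of `x` returns to, then the cycle of
`f * swap x y` through `y` consists of the elements met on the way from `x` to `y`. -/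
theorem exists_pow_eq_of_sameCycle_mul_swap {k : ℕ} (hk : 0 < k) (h : (f ^ k) x = y)
    (hmin : ∀ j, 0 < j → j < k → (f ^ j) x ≠ x ∧ (f ^ j) x ≠ y)
    (hz : (f * swap x y).SameCycle y z) : ∃ j, 0 < j ∧ j ≤ k ∧ (f ^ j) x = z := by
  have key : ∀ j, j < k → ((f * swap x y) ^ (j + 1)) y = (f ^ (j + 1)) x := by
    intro j
    induction j with
    | zero => simp
    | succ j ih =>
      intro hj
      have := hmin (j + 1) (by omega) hj
      rw [pow_succ', mul_apply, ih (by omega), mul_apply, swap_apply_of_ne_of_ne this.1 this.2,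
        pow_succ' f (j + 1), mul_apply]
  obtain ⟨i, rfl⟩ := hz
  have hper : ((f * swap x y) ^ k) y = y := by
    obtain ⟨k, rfl⟩ : ∃ k', k = k' + 1 := ⟨k - 1, by omega⟩
    rw [key k (by omega), h]
  have hmod : ((f * swap x y) ^ i) y = ((f * swap x y) ^ (i % k)) y := by
    conv_lhs => rw [← Int.emod_add_mul_ediv i k, zpow_add, zpow_mul, mul_apply]
    congr 1
    exact zpow_apply_eq_self_of_apply_eq_self (by rw [zpow_natCast, hper]) _
  have h0 : 0 ≤ i % k := Int.emod_nonneg _ (by omega)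
  have h1 : i % k < k := Int.emod_lt_of_pos _ (by omega)
  obtain ⟨r, hr⟩ := Int.eq_ofNat_of_zero_le h0
  rw [hmod, hr, zpow_natCast]
  rcases r with - | r
  · exact ⟨k, hk, le_rfl, by simpa using h⟩
  · exact ⟨r + 1, by omega, by omega, (key r (by omega)).symm⟩

theorem not_sameCycle_mul_swap [Finite α] (h : f.SameCycle x y) (hxy : x ≠ y) :
    ¬ (f * swap x y).SameCycle x y := by
  classical
  obtain ⟨i, hi, -, hi'⟩ := h.exists_pow_eq''
  have hex : ∃ k, 0 < k ∧ (f ^ k) x = y := ⟨i, hi, hi'⟩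
  obtain ⟨hk, hk'⟩ := Nat.find_spec hex
  have hx : ∀ j, 0 < j → j < Nat.find hex → (f ^ j) x ≠ x := fun j hj hjk hx => by
    refine Nat.find_min hex (m := Nat.find hex - j) (by omega) ⟨by omega, ?_⟩
    have h := hk'
    rwa [show Nat.find hex = (Nat.find hex - j) + j by omega, pow_add, mul_apply, hx] at h
  intro hs
  obtain ⟨j, hj, hjk, hjx⟩ := exists_pow_eq_of_sameCycle_mul_swap hk hk'
    (fun j hj hjk => ⟨hx j hj hjk, fun hy => Nat.find_min hex hjk ⟨hj, hy⟩⟩) hs.symm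
  rcases hjk.lt_or_eq with hlt | rfl
  · exact hx j hj hlt hjx
  · exact hxy (hjx.symm.trans hk')

theorem sameCycle_mul_swap_self [Finite α] (h : ¬ f.SameCycle x y) :
    (f * swap x y).SameCycle x y := by
  classical
  obtain ⟨i, hi, -, hi'⟩ := (SameCycle.refl f y).exists_pow_eq''
  have hex : ∃ k, 0 < k ∧ (f ^ k) y = y := ⟨i, hi, hi'⟩
  obtain ⟨hk, hk'⟩ := Nat.find_spec hex
  -- After its first step `f * swap x y` follows the cycle of `f` from `y` until it is back at `y`.
  have key : ∀ j, j < Nat.find hex → ((f * swap x y) ^ (j + 1)) x = (f ^ (j + 1)) y := by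
    intro j
    induction j with
    | zero => simp
    | succ j ih =>
      intro hj
      have h1 : (f ^ (j + 1)) y ≠ x := fun hx =>
        h (hx ▸ sameCycle_pow_left.2 (SameCycle.refl f y))
      have h2 : (f ^ (j + 1)) y ≠ y := fun hy => Nat.find_min hex hj ⟨by omega, hy⟩
      rw [pow_succ', mul_apply, ih (by omega), mul_apply, swap_apply_of_ne_of_ne h1 h2,
        pow_succ' f (j + 1), mul_apply]
  refine ⟨(Nat.find hex : ℕ), ?_⟩
  have := key (Nat.find hex - 1) (by omega)
  rw [show Nat.find hex - 1 + 1 = Nat.find hex by omega] at this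
  rw [zpow_natCast, this, hk']

theorem SameCycle.mul_swap [Finite α] (h : ¬ f.SameCycle x y) (hab : f.SameCycle a b) :
    (f * swap x y).SameCycle a b := by
  refine hab.of_apply fun a => ?_
  have hxy := sameCycle_mul_swap_self h
  by_cases hax : a = x
  · subst hax
    refine hxy.trans ?_
    simpa using sameCycle_apply_right.2 (SameCycle.refl (f * swap a y) y)
  by_cases hay : a = y
  · subst hay
    refine hxy.symm.trans ?_
    simpa using sameCycle_apply_right.2 (SameCycle.refl (f * swap x a) x)
  simpa [swap_apply_of_ne_of_ne hax hay] using
    sameCycle_apply_right.2 (SameCycle.refl (f * swap x y) a)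

/-- A cycle of `f * swap x y` lies inside a cycle of `f`, or inside the union of the cycles of `f`
through `x` and through `y`. -/
theorem sameCycle_of_mul_swap (h : (f * swap x y).SameCycle a b) :
    f.SameCycle a b ∨
      ((f.SameCycle x a ∨ f.SameCycle y a) ∧ (f.SameCycle x b ∨ f.SameCycle y b)) := by
  obtain ⟨i, rfl⟩ := h
  have step : ∀ c, f.SameCycle c ((f * swap x y) c) ∨
      ((f.SameCycle x c ∨ f.SameCycle y c) ∧
        (f.SameCycle x ((f * swap x y) c) ∨ f.SameCycle y ((f * swap x y) c))) := by
    intro c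
    by_cases hcx : c = x
    · subst hcx
      exact .inr ⟨.inl (.refl _ _), .inr (by simp [SameCycle.refl])⟩
    by_cases hcy : c = y
    · subst hcy
      exact .inr ⟨.inr (.refl _ _), .inl (by simp [SameCycle.refl])⟩
    left
    simp [swap_apply_of_ne_of_ne hcx hcy, SameCycle.refl]
  have trans : ∀ {a b c : α}, (f.SameCycle a b ∨
      ((f.SameCycle x a ∨ f.SameCycle y a) ∧ (f.SameCycle x b ∨ f.SameCycle y b))) →
      (f.SameCycle b c ∨
      ((f.SameCycle x b ∨ f.SameCycle y b) ∧ (f.SameCycle x c ∨ f.SameCycle y c))) →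
      (f.SameCycle a c ∨
      ((f.SameCycle x a ∨ f.SameCycle y a) ∧ (f.SameCycle x c ∨ f.SameCycle y c))) := by
    rintro a b c (h | ⟨h, h'⟩) (k | ⟨k, k'⟩)
    · exact .inl (h.trans k)
    · exact .inr ⟨k.imp (·.trans h.symm) (·.trans h.symm), k'⟩
    · exact .inr ⟨h, h'.imp (·.trans k) (·.trans k)⟩
    · exact .inr ⟨h, k'⟩
  induction i using Int.induction_on with
  | zero => simp [SameCycle.refl]
  | succ i ih => rw [add_comm, zpow_add, mul_apply, zpow_one]; exact trans ih (step _)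
  | pred i ih =>
    refine trans ih ?_
    have := step (((f * swap x y) ^ (-(i : ℤ) - 1)) a)
    rw [← mul_apply (f * swap x y), mul_self_zpow, show -(i : ℤ) - 1 + 1 = -i by ring] at this
    rcases this with h | ⟨h, h'⟩
    · exact .inl h.symm
    · exact .inr ⟨h', h⟩

/-- The number of cycles of a permutation, fixed points included. -/
noncomputable def cycleCount (f : Perm α) : ℕ := Nat.card (Quotient (SameCycle.setoid f))

/-- Multiplication by a transposition of elements of different cycles merges these cycles. -/
theorem cycleCount_mul_swap_of_not_sameCycle [Finite α] (h : ¬ f.SameCycle x y) :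
    (f * swap x y).cycleCount + 1 = f.cycleCount := by
  classical
  let g := f * swap x y
  let Qf := Quotient (SameCycle.setoid f)
  let Qg := Quotient (SameCycle.setoid g)
  let φ : Qf → Qg := Quotient.map' id (fun _ _ hab => SameCycle.mul_swap h hab)
  let y' : Qf := Quotient.mk _ y
  -- The cycles other than that of `y` represent the cycles of the product.
  have hbij : Function.Bijective (fun q : {q : Qf // q ≠ y'} => φ q.1) := by
    constructor
    · rintro ⟨⟨p⟩, hp⟩ ⟨⟨q⟩, hq⟩ hpq
      have hpq' : g.SameCycle p q := Quotient.exact hpq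
      have hp' : ¬ f.SameCycle y p := fun hs => hp (Quotient.sound hs.symm)
      have hq' : ¬ f.SameCycle y q := fun hs => hq (Quotient.sound hs.symm)
      refine Subtype.ext (Quotient.sound ?_)
      rcases sameCycle_of_mul_swap hpq' with h1 | ⟨h1 | h1, h2 | h2⟩
      · exact h1
      · exact h1.symm.trans h2
      · exact absurd h2 hq'
      · exact absurd h1 hp'
      · exact absurd h1 hp'
    · rintro ⟨q⟩
      by_cases hq : f.SameCycle y q
      · refine ⟨⟨Quotient.mk _ x, fun hx => h (Quotient.exact hx)⟩, Quotient.sound ?_⟩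
        exact (sameCycle_mul_swap_self h).trans (SameCycle.mul_swap h hq)
      · exact ⟨⟨Quotient.mk _ q, fun hx => hq (Quotient.exact hx).symm⟩, rfl⟩
  have h1 : Nat.card {q : Qf // q ≠ y'} = Nat.card Qg := Nat.card_congr (Equiv.ofBijective _ hbij)
  have h2 : Nat.card Qf = Nat.card {q : Qf // q ≠ y'} + 1 := by
    rw [← Finite.card_option]
    exact Nat.card_congr (Equiv.optionSubtypeNe y').symm
  change Nat.card Qg + 1 = Nat.card Qf
  omega

/-- Multiplication by a transposition of elements of one cycle splits this cycle. -/
theorem cycleCount_mul_swap_of_sameCycle [Finite α] (h : f.SameCycle x y) (hxy : x ≠ y) :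
    (f * swap x y).cycleCount = f.cycleCount + 1 := by
  rw [← cycleCount_mul_swap_of_not_sameCycle (not_sameCycle_mul_swap h hxy), mul_assoc,
    swap_mul_self, mul_one]

/-- Inserting a fixed point `w` behind `p` into a cycle. -/
theorem IsCycleOn.mul_swap_insert [Finite α] {S : Set α} (hf : f.IsCycleOn S) {p w : α}
    (hp : p ∈ S) (hw : w ∉ S) (hfw : f w = w) : (f * swap p w).IsCycleOn (insert w S) := by
  have hns : ¬ f.SameCycle p w := fun h => by
    exact hw (h.symm.eq_of_left hfw ▸ hp)
  have hmem : ∀ a, f a ∈ S ↔ a ∈ S := fun a => hf.apply_mem_iff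
  refine ⟨Equiv.bijOn _ fun a => ?_, fun a ha b hb => ?_⟩
  · by_cases hap : a = p
    · subst hap; simp [hfw, hp]
    by_cases haw : a = w
    · subst haw; simp [hmem, hp]
    have : f a ≠ w := fun h => haw (f.injective (h.trans hfw.symm))
    simp [swap_apply_of_ne_of_ne hap haw, haw, hmem, this]
  · have key : ∀ c ∈ insert w S, (f * swap p w).SameCycle p c := by
      rintro c (rfl | hc)
      · exact sameCycle_mul_swap_self hns
      · exact SameCycle.mul_swap hns (hf.2 hp hc)
    exact (key a ha).symm.trans (key b hb)

/-- Removing the successor `w` of `p` from a cycle. -/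
theorem IsCycleOn.mul_swap_remove [Finite α] {S : Set α} (hf : f.IsCycleOn S) {p w : α}
    (hp : p ∈ S) (hpw : f p = w) (hne : p ≠ w) : (f * swap p w).IsCycleOn (S \ {w}) := by
  have hmem : ∀ a, f a ∈ S ↔ a ∈ S := fun a => hf.apply_mem_iff
  have hw : w ∈ S := hpw ▸ (hmem p).2 hp
  have hgw : (f * swap p w) w = w := by simp [hpw]
  refine ⟨Equiv.bijOn _ fun a => ?_, fun a ha b hb => ?_⟩
  · by_cases haw : a = w
    · subst haw; simp [hpw]
    have h2 : (f * swap p w) a ≠ w := fun h =>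
      haw ((f * swap p w).injective (h.trans hgw.symm))
    have h3 : swap p w a ∈ S ↔ a ∈ S := by
      by_cases hap : a = p
      · subst hap; simp [hw, hp]
      · rw [swap_apply_of_ne_of_ne hap haw]
    simp only [Set.mem_sdiff, Set.mem_singleton_iff, h2, haw, not_false_eq_true, and_true]
    rw [mul_apply, hmem, h3]
  · have h : ((f * swap p w) * swap p w).SameCycle a b := by
      rw [mul_assoc, swap_mul_self, mul_one]; exact hf.2 ha.1 hb.1
    have hwx : ∀ c, (f * swap p w).SameCycle w c → w = c := fun c hc => hc.eq_of_left hgw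
    rcases sameCycle_of_mul_swap h with h | ⟨h1 | h1, h2 | h2⟩
    · exact h
    · exact h1.symm.trans h2
    · exact absurd (hwx _ h2).symm hb.2
    · exact absurd (hwx _ h1).symm ha.2
    · exact absurd (hwx _ h1).symm ha.2

/-- Interchanging two consecutive blocks of a cycle, ending in `p₀` and in `p₁`, yields a cycle. The
hypothesis `hns` says that `p₀`, `p₁`, `p₂` occur in this cyclic order: when the cycle is split into
the block behind `p₀` up to `p₁` and the rest, `p₂` belongs to the rest. -/
theorem IsCycleOn.mul_swap_mul_swap [Finite α] {S : Set α} (hf : f.IsCycleOn S) {p₀ p₁ p₂ : α}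
    (h₀ : p₀ ∈ S) (h₁ : p₁ ∈ S) (h₂ : p₂ ∈ S)
    (hns : ¬ (f * swap p₀ p₁).SameCycle p₁ p₂) :
    (f * (swap p₀ p₁ * swap p₁ p₂)).IsCycleOn S := by
  have hmem : ∀ a, f a ∈ S ↔ a ∈ S := fun a => hf.apply_mem_iff
  have hsw : ∀ {p q : α}, p ∈ S → q ∈ S → ∀ a, swap p q a ∈ S ↔ a ∈ S := by
    intro p q hp hq a
    rw [swap_apply_def]
    split_ifs with h h' <;> simp_all
  refine ⟨Equiv.bijOn _ fun a => ?_, fun a ha b hb => ?_⟩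
  · rw [mul_apply, mul_apply, hmem, hsw h₀ h₁, hsw h₁ h₂]
  · have part : ∀ c ∈ S, (f * swap p₀ p₁).SameCycle p₀ c ∨ (f * swap p₀ p₁).SameCycle p₁ c := by
      intro c hc
      have h : ((f * swap p₀ p₁) * swap p₀ p₁).SameCycle p₀ c := by
        rw [mul_assoc, swap_mul_self, mul_one]; exact hf.2 h₀ hc
      rcases sameCycle_of_mul_swap h with h | ⟨-, h⟩
      · exact .inl h
      · exact h
    have h02 : (f * swap p₀ p₁).SameCycle p₀ p₂ := (part p₂ h₂).resolve_right hns
    have key : ∀ c ∈ S, (f * (swap p₀ p₁ * swap p₁ p₂)).SameCycle p₁ c := by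
      intro c hc
      rw [← mul_assoc]
      rcases part c hc with h | h
      · exact (sameCycle_mul_swap_self hns).trans (SameCycle.mul_swap hns (h02.symm.trans h))
      · exact SameCycle.mul_swap hns h
    exact (key a ha).symm.trans (key b hb)

/-- Three elements of a cycle occur in it in one of the two possible cyclic orders: whichever of
them follows `p₀` first, the other one is not in the block that ends there. -/
theorem IsCycleOn.not_sameCycle_or [Finite α] {S : Set α} (hf : f.IsCycleOn S) {p₀ p₁ p₂ : α}
    (h₀ : p₀ ∈ S) (h₁ : p₁ ∈ S) (h01 : p₀ ≠ p₁) (h12 : p₁ ≠ p₂) :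
    ¬ (f * swap p₀ p₁).SameCycle p₁ p₂ ∨ ¬ (f * swap p₀ p₂).SameCycle p₂ p₁ := by
  classical
  obtain ⟨i, hi, -, hi'⟩ := (hf.2 h₀ h₁).exists_pow_eq''
  have hex : ∃ k, 0 < k ∧ ((f ^ k) p₀ = p₀ ∨ (f ^ k) p₀ = p₁ ∨ (f ^ k) p₀ = p₂) :=
    ⟨i, hi, .inr (.inl hi')⟩
  obtain ⟨hk, hk'⟩ := Nat.find_spec hex
  have hmin := fun j (hj : 0 < j) (hjk : j < Nat.find hex) => Nat.find_min hex hjk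
  rcases hk' with hk' | hk' | hk'
  -- The walk from `p₀` cannot be back at `p₀` before it has met `p₁`.
  · exfalso
    have hper : ∀ m : ℕ, (f ^ (Nat.find hex * m)) p₀ = p₀ := fun m => by
      rw [pow_mul]
      exact pow_apply_eq_self_of_apply_eq_self hk' m
    have hmod : (f ^ (i % Nat.find hex)) p₀ = p₁ := by
      have h := hi'
      rwa [← Nat.mod_add_div i (Nat.find hex), pow_add, mul_apply, hper] at h
    rcases Nat.eq_zero_or_pos (i % Nat.find hex) with h0 | h0
    · rw [h0] at hmod; exact h01 (by simpa using hmod)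
    · exact hmin _ h0 (Nat.mod_lt _ hk) ⟨h0, .inr (.inl hmod)⟩
  · left
    intro hs
    obtain ⟨j, hj, hjk, hj'⟩ := exists_pow_eq_of_sameCycle_mul_swap hk hk'
      (fun j hj hjk => ⟨fun h => hmin j hj hjk ⟨hj, .inl h⟩,
        fun h => hmin j hj hjk ⟨hj, .inr (.inl h)⟩⟩) hs
    rcases hjk.lt_or_eq with hlt | rfl
    · exact hmin j hj hlt ⟨hj, .inr (.inr hj')⟩
    · exact h12 (hk'.symm.trans hj')
  · right
    intro hs
    obtain ⟨j, hj, hjk, hj'⟩ := exists_pow_eq_of_sameCycle_mul_swap hk hk'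
      (fun j hj hjk => ⟨fun h => hmin j hj hjk ⟨hj, .inl h⟩,
        fun h => hmin j hj hjk ⟨hj, .inr (.inr h)⟩⟩) hs
    rcases hjk.lt_or_eq with hlt | rfl
    · exact hmin j hj hlt ⟨hj, .inr (.inl hj')⟩
    · exact h12 (hj'.symm.trans hk')

end Equiv.Perm

/-! ### Arcs, faces and triangles of a rotation system -/

namespace RotationSystem

section Arcs

variable {V : Type*} (M : RotationSystem V)

/-- Face tracing on all ordered pairs of vertices. As `rot y` fixes the non-neighbours of `y`, the
pairs `(x, y)` and `(y, x)` of non-adjacent vertices form a cycle; the other cycles are the faces.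
-/
def arcPerm : Perm (V × V) where
  toFun d := (d.2, M.rot d.2 d.1)
  invFun d := ((M.rot d.1).symm d.2, d.1)
  left_inv d := by simp
  right_inv d := by simp

@[simp] theorem arcPerm_apply (x y : V) : M.arcPerm (x, y) = (y, M.rot y x) := rfl

theorem toProd_facePerm (d : M.graph.Dart) : (M.facePerm d).toProd = M.arcPerm d.toProd := rfl

theorem toProd_facePerm_zpow (d : M.graph.Dart) (i : ℤ) :
    ((M.facePerm ^ i) d).toProd = (M.arcPerm ^ i) d.toProd := by
  induction i using Int.induction_on with
  | zero => rfl
  | succ i ih =>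
    rw [add_comm, zpow_add, zpow_add, Perm.mul_apply, Perm.mul_apply, zpow_one, zpow_one,
      toProd_facePerm, ih]
  | pred i ih =>
    apply M.arcPerm.injective
    rw [← toProd_facePerm, ← Perm.mul_apply, ← Perm.mul_apply, mul_self_zpow, mul_self_zpow,
      show -(i : ℤ) - 1 + 1 = -i by ring, ih]

theorem sameCycle_facePerm_iff {d d' : M.graph.Dart} :
    M.facePerm.SameCycle d d' ↔ M.arcPerm.SameCycle d.toProd d'.toProd := by
  refine exists_congr fun i => ?_
  rw [← toProd_facePerm_zpow, SimpleGraph.Dart.toProd_injective.eq_iff]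

theorem adj_of_sameCycle {x y z w : V} (h : M.arcPerm.SameCycle (x, y) (z, w))
    (hxy : M.graph.Adj x y) : M.graph.Adj z w := by
  obtain ⟨i, hi⟩ := h
  have := M.toProd_facePerm_zpow ⟨(x, y), hxy⟩ i
  rw [hi] at this
  have h := ((M.facePerm ^ i) ⟨(x, y), hxy⟩).adj
  rwa [this] at h

theorem sameFace_iff {p u q w : V} : M.SameFace p u q w ↔
    M.graph.Adj p u ∧ M.graph.Adj q w ∧ M.arcPerm.SameCycle (p, u) (q, w) := by
  constructor
  · rintro ⟨h, h', hs⟩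
    exact ⟨h, h', M.sameCycle_facePerm_iff.1 hs⟩
  · rintro ⟨h, h', hs⟩
    exact ⟨h, h', M.sameCycle_facePerm_iff.2 hs⟩

variable {M}

theorem isTriangular_iff :
    M.IsTriangular ↔ ∀ u v, M.graph.Adj u v → M.rot (M.rot v u) v = u := by
  refine ⟨fun h u v huv => (h u v huv).2.2.1, fun h u v huv => ⟨huv, rfl, h u v huv, ?_⟩⟩
  have := h v (M.rot v u) (M.adj_rot huv.symm)
  rwa [h u v huv] at this

theorem IsTriangular.isTriangle (h : M.IsTriangular) {x y z : V} (hxy : M.graph.Adj x y)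
    (hz : M.rot y x = z) : M.IsTriangle x y z := hz ▸ h x y hxy

theorem IsTriangle.rotate {x y z : V} (h : M.IsTriangle x y z) : M.IsTriangle y z x :=
  ⟨h.2.1 ▸ M.adj_rot h.1.symm, h.2.2.1, h.2.2.2, h.2.1⟩

theorem IsTriangle.sameCycle {x y z a b : V} (h : M.IsTriangle x y z)
    (hs : M.arcPerm.SameCycle (x, y) (a, b)) :
    (a, b) = (x, y) ∨ (a, b) = (y, z) ∨ (a, b) = (z, x) := by
  obtain ⟨-, h1, h2, h3⟩ := h
  obtain ⟨i, hi⟩ := hs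
  rw [← hi]
  clear hi
  have hinv : ∀ {c d e : V}, M.rot d c = e → M.arcPerm.symm (d, e) = (c, d) := by
    rintro c d e rfl
    exact M.arcPerm.symm_apply_apply (c, d)
  induction i using Int.induction_on with
  | zero => exact .inl rfl
  | succ i ih =>
    rw [add_comm, zpow_add, Perm.mul_apply, zpow_one]
    rcases ih with ih | ih | ih <;> rw [ih, arcPerm_apply] <;> simp [h1, h2, h3]
  | pred i ih =>
    rw [sub_eq_neg_add, zpow_add, Perm.mul_apply, zpow_neg_one, Perm.inv_def]
    rcases ih with ih | ih | ih <;> rw [ih]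
    · exact .inr (.inr (hinv h3))
    · exact .inl (hinv h1)
    · exact .inr (.inl (hinv h2))

end Arcs

/-! ### Existence and effect of the elementary operations -/

section Operations

variable {V : Type*} [DecidableEq V] {M N : RotationSystem V} {p u q w : V}

/-- Two vertices that are not isolated can be joined by an edge in any corners; cyclic rotations
stay cyclic because an element is inserted. -/
theorem exists_addEdge [Finite V] (huw : u ≠ w) (hadj : ¬ M.graph.Adj u w)
    (hpu : M.graph.Adj p u) (hqw : M.graph.Adj q w) : ∃ N, M.AddEdge N p u q w := by
  have hadj' : ¬ M.graph.Adj w u := fun h => hadj h.symm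
  let ρ : V → Perm V := fun z =>
    if z = u then M.rot u * swap p w else if z = w then M.rot w * swap q u else M.rot z
  have hρu : ρ u = M.rot u * swap p w := if_pos rfl
  have hρw : ρ w = M.rot w * swap q u := by simp [ρ, huw.symm]
  have hρ : ∀ z, z ≠ u → z ≠ w → ρ z = M.rot z := fun z h h' => by simp [ρ, h, h']
  let G := M.graph ⊔ SimpleGraph.edge u w
  have hG : ∀ x y, G.Adj x y ↔ M.graph.Adj x y ∨ (x = u ∧ y = w ∨ x = w ∧ y = u) := by
    intro x y
    simp only [G, SimpleGraph.sup_adj, SimpleGraph.edge_adj]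
    constructor
    · rintro (h | ⟨h, -⟩)
      · exact .inl h
      · exact .inr h
    · rintro (h | h)
      · exact .inl h
      · refine .inr ⟨h, ?_⟩
        rcases h with ⟨rfl, rfl⟩ | ⟨rfl, rfl⟩
        · exact huw
        · exact huw.symm
  have hc : ∀ v, (ρ v).IsCycleOn (G.neighborSet v) := by
    intro v
    by_cases hvu : v = u
    · subst hvu
      rw [hρu, show G.neighborSet v = insert w (M.graph.neighborSet v) by
        ext z; simp only [SimpleGraph.mem_neighborSet, hG, Set.mem_insert_iff]; grind]
      exact (M.isCycleOn v).mul_swap_insert hpu.symm hadj (M.rot_of_not_adj _ _ hadj)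
    by_cases hvw : v = w
    · subst hvw
      rw [hρw, show G.neighborSet v = insert u (M.graph.neighborSet v) by
        ext z; simp only [SimpleGraph.mem_neighborSet, hG, Set.mem_insert_iff]; grind]
      exact (M.isCycleOn v).mul_swap_insert hqw.symm hadj' (M.rot_of_not_adj _ _ hadj')
    rw [hρ v hvu hvw, show G.neighborSet v = M.graph.neighborSet v by
        ext z; simp only [SimpleGraph.mem_neighborSet, hG]; grind]
    exact M.isCycleOn v
  have hf : ∀ v z, ¬ G.Adj v z → ρ v z = z := by
    intro v z hvz
    rw [hG] at hvz
    push Not at hvz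
    by_cases hvu : v = u
    · subst hvu
      rw [hρu, Perm.mul_apply, swap_apply_of_ne_of_ne, M.rot_of_not_adj _ _ hvz.1]
      · rintro rfl; exact hvz.1 hpu.symm
      · exact hvz.2.1 rfl
    by_cases hvw : v = w
    · subst hvw
      rw [hρw, Perm.mul_apply, swap_apply_of_ne_of_ne, M.rot_of_not_adj _ _ hvz.1]
      · rintro rfl; exact hvz.1 hqw.symm
      · exact hvz.2.2 rfl
    rw [hρ v hvu hvw, M.rot_of_not_adj _ _ hvz.1]
  exact ⟨⟨G, ρ, hc, hf⟩, huw, hadj, hpu, hqw, rfl, hρu, hρw, hρ⟩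

namespace AddEdge

theorem adj_iff (h : M.AddEdge N p u q w) {x y : V} :
    N.graph.Adj x y ↔ M.graph.Adj x y ∨ (x = u ∧ y = w ∨ x = w ∧ y = u) := by
  obtain ⟨huw, -, -, -, hG, -⟩ := h
  rw [hG, SimpleGraph.sup_adj, SimpleGraph.edge_adj]
  grind

/-- Only the successors of four arcs change: at `u`, those of `p` and `w`, and at `w`, those of `q`
and `u`. -/
theorem rot_eq (h : M.AddEdge N p u q w) (x y : V) :
    N.rot y x = if (x, y) = (p, u) then w else if (x, y) = (w, u) then M.rot u p else
      if (x, y) = (q, w) then u else if (x, y) = (u, w) then M.rot w q else M.rot y x := by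
  obtain ⟨huw, hn, hp, hq, -, h1, h2, h3⟩ := h
  have e1 : M.rot u w = w := M.rot_of_not_adj _ _ hn
  have e2 : M.rot w u = u := M.rot_of_not_adj _ _ fun h => hn h.symm
  by_cases hyu : y = u
  · subst hyu
    rw [h1, Perm.mul_apply, swap_apply_def]
    grind
  by_cases hyw : y = w
  · subst hyw
    rw [h2, Perm.mul_apply, swap_apply_def]
    grind
  rw [h3 y hyu hyw]
  grind

/-- Adding an edge multiplies face tracing by two transpositions, which move the 2-cycle of the
non-adjacent pair `u`, `w` into the faces of the corners `(p, u)` and `(q, w)`. This is what makes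
the changes of the number of faces computable. -/
theorem arcPerm_eq (h : M.AddEdge N p u q w) :
    N.arcPerm = M.arcPerm * swap (p, u) (w, u) * swap (q, w) (u, w) := by
  have hr := h.rot_eq
  obtain ⟨huw, hn, hp, hq, -⟩ := h
  have e1 : M.rot u w = w := M.rot_of_not_adj _ _ hn
  have e2 : M.rot w u = u := M.rot_of_not_adj _ _ fun h => hn h.symm
  ext1 ⟨x, y⟩
  rw [arcPerm_apply, hr, Perm.mul_apply, Perm.mul_apply, swap_apply_def (q, w)]
  have := huw.symm
  split_ifs <;> simp_all [swap_apply_def]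
  rw [if_neg (by tauto), if_neg (by tauto), arcPerm_apply]

theorem not_sameCycle (h : M.AddEdge N p u q w) {x y : V} (hxy : M.graph.Adj x y) :
    ¬ M.arcPerm.SameCycle (x, y) (w, u) ∧ ¬ M.arcPerm.SameCycle (x, y) (u, w) :=
  ⟨fun hs => h.2.1 (M.adj_of_sameCycle hs hxy).symm, fun hs => h.2.1 (M.adj_of_sameCycle hs hxy)⟩

variable [Finite V]

/-- The first transposition merges the 2-cycle of `u` and `w` with the face; the second one splits
the result. So the face is divided, and the 2-cycle is gone. -/
theorem cycleCount_of_sameFace (h : M.AddEdge N p u q w) (hs : M.SameFace p u q w) :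
    N.arcPerm.cycleCount = M.arcPerm.cycleCount := by
  have hns := (h.not_sameCycle h.2.2.1).1
  have e1 : M.rot u w = w := M.rot_of_not_adj _ _ h.2.1
  have hwu : M.arcPerm.SameCycle (w, u) (u, w) := by
    have := Perm.sameCycle_apply_right.2 (Perm.SameCycle.refl M.arcPerm (w, u))
    rwa [arcPerm_apply, e1] at this
  rw [h.arcPerm_eq, Perm.cycleCount_mul_swap_of_sameCycle,
    Perm.cycleCount_mul_swap_of_not_sameCycle hns]
  · exact (((M.sameFace_iff.1 hs).2.2.symm.mul_swap hns).trans
      (Perm.sameCycle_mul_swap_self hns)).trans (hwu.mul_swap hns)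
  · rintro ⟨⟩
    exact h.2.1 h.2.2.2.1

/-- Both transpositions merge cycles: the 2-cycle of `u` and `w` and the two faces become one face.
-/
theorem cycleCount_of_not_sameFace (h : M.AddEdge N p u q w) (hs : ¬ M.SameFace p u q w) :
    N.arcPerm.cycleCount + 2 = M.arcPerm.cycleCount := by
  have hns := (h.not_sameCycle h.2.2.1).1
  rw [M.sameFace_iff] at hs
  have hns' : ¬ (M.arcPerm * swap (p, u) (w, u)).SameCycle (q, w) (u, w) := by
    intro hs'
    rcases Perm.sameCycle_of_mul_swap hs' with h' | ⟨h' | h', -⟩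
    · exact (h.not_sameCycle h.2.2.2.1).2 h'
    · exact hs ⟨h.2.2.1, h.2.2.2.1, h'⟩
    · exact (h.not_sameCycle h.2.2.2.1).1 h'.symm
  have k1 := Perm.cycleCount_mul_swap_of_not_sameCycle hns
  have k2 := Perm.cycleCount_mul_swap_of_not_sameCycle hns'
  rw [h.arcPerm_eq]
  omega

end AddEdge

/-- Interchanging two blocks of the rotation at `v` that end in `p₀` and in `p₁`, where the third
block ends in `p₂`. -/
theorem exists_vertexHandle [Finite V] {v p₀ p₁ p₂ : V} (h₀ : M.graph.Adj p₀ v)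
    (h₁ : M.graph.Adj p₁ v) (h₂ : M.graph.Adj p₂ v)
    (hns : ¬ (M.rot v * swap p₀ p₁).SameCycle p₁ p₂) :
    ∃ N : RotationSystem V, N.graph = M.graph ∧ (∀ z, z ≠ v → N.rot z = M.rot z) ∧
      N.rot v = M.rot v * (swap p₀ p₁ * swap p₁ p₂) := by
  refine ⟨⟨M.graph, fun z => if z = v then M.rot v * (swap p₀ p₁ * swap p₁ p₂) else M.rot z,
    fun z => ?_, fun z y hzy => ?_⟩, rfl, fun z hz => if_neg hz, if_pos rfl⟩
  · by_cases hz : z = v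
    · subst hz
      simpa using (M.isCycleOn z).mul_swap_mul_swap h₀.symm h₁.symm h₂.symm hns
    · simpa [hz] using M.isCycleOn z
  · by_cases hz : z = v
    · subst hz
      have e : ∀ p, M.graph.Adj p z → y ≠ p := by rintro p hp rfl; exact hzy hp.symm
      simp [swap_apply_of_ne_of_ne (e _ h₁) (e _ h₂), swap_apply_of_ne_of_ne (e _ h₀) (e _ h₁),
        M.rot_of_not_adj _ _ hzy]
    · simpa [hz] using M.rot_of_not_adj _ _ hzy

/-- The three faces in whose corners the blocks end become one. -/
theorem cycleCount_of_vertexHandle [Finite V] {v p₀ p₁ p₂ : V}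
    (hN : ∀ z, z ≠ v → N.rot z = M.rot z)
    (hv : N.rot v = M.rot v * (swap p₀ p₁ * swap p₁ p₂))
    (h01 : ¬ M.arcPerm.SameCycle (p₀, v) (p₁, v)) (h02 : ¬ M.arcPerm.SameCycle (p₀, v) (p₂, v))
    (h12 : ¬ M.arcPerm.SameCycle (p₁, v) (p₂, v)) :
    N.arcPerm.cycleCount + 2 = M.arcPerm.cycleCount := by
  have e : N.arcPerm = M.arcPerm * swap (p₀, v) (p₁, v) * swap (p₁, v) (p₂, v) := by
    ext1 ⟨x, y⟩
    by_cases hy : y = v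
    · subst hy
      rw [arcPerm_apply, hv, Perm.mul_apply, Perm.mul_apply, Perm.mul_apply, Perm.mul_apply,
        swap_apply_def (p₁, y), swap_apply_def p₁]
      split_ifs <;> simp_all [swap_apply_def] <;> split_ifs <;> simp_all
    · have hxy : ∀ p q : V, swap (p, v) (q, v) (x, y) = (x, y) := fun p q =>
        swap_apply_of_ne_of_ne (by simp [hy]) (by simp [hy])
      rw [arcPerm_apply, hN y hy, Perm.mul_apply, Perm.mul_apply, hxy, hxy, arcPerm_apply]
  have h12' : ¬ (M.arcPerm * swap (p₀, v) (p₁, v)).SameCycle (p₁, v) (p₂, v) := by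
    intro hs
    rcases Perm.sameCycle_of_mul_swap hs with h | ⟨-, h | h⟩
    · exact h12 h
    · exact h02 h
    · exact h12 h
  have k1 := Perm.cycleCount_mul_swap_of_not_sameCycle h01
  have k2 := Perm.cycleCount_mul_swap_of_not_sameCycle h12'
  rw [e]
  omega

/-! ### Flipping an edge of a triangular embedding -/

theorem exists_edgeFlip [Finite V] {p q r t : V} (h₁ : M.IsTriangle p q r)
    (h₂ : M.IsTriangle q p t) (hrt : r ≠ t) (hadj : ¬ M.graph.Adj r t) :
    ∃ N, M.EdgeFlip N p q r t := by
  have hadj' : ¬ M.graph.Adj t r := fun h => hadj h.symm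
  have hpq := h₁.1
  have hqr := h₁.rotate.1
  have hrp := h₁.rotate.rotate.1
  have hpt := h₂.rotate.1
  have htq := h₂.rotate.rotate.1
  have n1 := hpq.ne
  have n2 := hqr.ne
  have n3 := hrp.ne
  have n4 := hpt.ne
  have n5 := htq.ne
  let ρ : V → Perm V := fun z =>
    if z = p then M.rot p * swap r q else if z = q then M.rot q * swap t p else
      if z = r then M.rot r * swap q t else if z = t then M.rot t * swap p r else M.rot z
  have hρp : ρ p = M.rot p * swap r q := if_pos rfl
  have hρq : ρ q = M.rot q * swap t p := by simp [ρ, n1.symm]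
  have hρr : ρ r = M.rot r * swap q t := by simp [ρ, n2.symm, n3]
  have hρt : ρ t = M.rot t * swap p r := by simp [ρ, n4.symm, n5, hrt.symm]
  have hρ : ∀ z, z ≠ p → z ≠ q → z ≠ r → z ≠ t → ρ z = M.rot z := fun z h h' h'' h''' => by
    simp [ρ, h, h', h'', h''']
  let G := M.graph.deleteEdges {s(p, q)} ⊔ SimpleGraph.edge r t
  have hG : ∀ x y, G.Adj x y ↔ (M.graph.Adj x y ∧ ¬ (x = p ∧ y = q) ∧ ¬ (x = q ∧ y = p)) ∨
      (x = r ∧ y = t ∨ x = t ∧ y = r) := by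
    intro x y
    simp only [G, SimpleGraph.sup_adj, SimpleGraph.edge_adj, SimpleGraph.deleteEdges_adj,
      Set.mem_singleton_iff, Sym2.eq_iff]
    grind
  have hc : ∀ v, (ρ v).IsCycleOn (G.neighborSet v) := by
    intro v
    by_cases hp : v = p
    · subst hp
      rw [hρp, show G.neighborSet v = M.graph.neighborSet v \ {q} by
        ext z; simp only [SimpleGraph.mem_neighborSet, hG, Set.mem_sdiff,
          Set.mem_singleton_iff]; grind]
      exact (M.isCycleOn v).mul_swap_remove hrp.symm h₁.2.2.2 n2.symm
    by_cases hq : v = q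
    · subst hq
      rw [hρq, show G.neighborSet v = M.graph.neighborSet v \ {p} by
        ext z; simp only [SimpleGraph.mem_neighborSet, hG, Set.mem_sdiff,
          Set.mem_singleton_iff]; grind]
      exact (M.isCycleOn v).mul_swap_remove htq.symm h₂.2.2.2 n4.symm
    by_cases hr : v = r
    · subst hr
      rw [hρr, show G.neighborSet v = insert t (M.graph.neighborSet v) by
        ext z; simp only [SimpleGraph.mem_neighborSet, hG, Set.mem_insert_iff]; grind]
      exact (M.isCycleOn v).mul_swap_insert hqr.symm hadj (M.rot_of_not_adj _ _ hadj)
    by_cases ht : v = t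
    · subst ht
      rw [hρt, show G.neighborSet v = insert r (M.graph.neighborSet v) by
        ext z; simp only [SimpleGraph.mem_neighborSet, hG, Set.mem_insert_iff]; grind]
      exact (M.isCycleOn v).mul_swap_insert hpt.symm hadj' (M.rot_of_not_adj _ _ hadj')
    rw [hρ v hp hq hr ht, show G.neighborSet v = M.graph.neighborSet v by
        ext z; simp only [SimpleGraph.mem_neighborSet, hG]; grind]
    exact M.isCycleOn v
  have hf : ∀ v z, ¬ G.Adj v z → ρ v z = z := by
    intro v z hvz
    rw [hG] at hvz
    have hn : ∀ z, ¬ M.graph.Adj v z → M.rot v z = z := fun z => M.rot_of_not_adj v z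
    have e1 := h₁.2.2.2
    have e2 := h₂.2.2.2
    by_cases hp : v = p
    · subst hp
      rw [hρp, Perm.mul_apply, swap_apply_def]
      have := hrp.symm
      grind
    by_cases hq : v = q
    · subst hq
      rw [hρq, Perm.mul_apply, swap_apply_def]
      have := htq.symm
      grind
    by_cases hr : v = r
    · subst hr
      rw [hρr, Perm.mul_apply, swap_apply_def]
      have := hqr.symm
      grind
    by_cases ht : v = t
    · subst ht
      rw [hρt, Perm.mul_apply, swap_apply_def]
      have := hpt.symm
      grind
    rw [hρ v hp hq hr ht]
    grind
  exact ⟨⟨G, ρ, hc, hf⟩, h₁, h₂, hrt, hadj, rfl, hρp, hρq, hρr, hρt, hρ⟩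

namespace EdgeFlip

variable {r t : V}

theorem adj_iff (h : M.EdgeFlip N p q r t) {x y : V} :
    N.graph.Adj x y ↔ (M.graph.Adj x y ∧ ¬ (x = p ∧ y = q) ∧ ¬ (x = q ∧ y = p)) ∨
      (x = r ∧ y = t ∨ x = t ∧ y = r) := by
  obtain ⟨-, -, hrt, -, hG, -⟩ := h
  rw [hG]
  simp only [SimpleGraph.sup_adj, SimpleGraph.edge_adj, SimpleGraph.deleteEdges_adj,
      Set.mem_singleton_iff, Sym2.eq_iff]
  grind

/-- Only the successors of eight arcs change. -/
theorem rot_eq (h : M.EdgeFlip N p q r t) {x y : V} (hp : ¬ (y = p ∧ (x = r ∨ x = q)))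
    (hq : ¬ (y = q ∧ (x = t ∨ x = p))) (hr : ¬ (y = r ∧ (x = q ∨ x = t)))
    (ht : ¬ (y = t ∧ (x = p ∨ x = r))) : N.rot y x = M.rot y x := by
  obtain ⟨-, -, -, -, -, h1, h2, h3, h4, h5⟩ := h
  by_cases yp : y = p
  · subst yp
    rw [h1, Perm.mul_apply, swap_apply_of_ne_of_ne] <;> grind
  by_cases yq : y = q
  · subst yq
    rw [h2, Perm.mul_apply, swap_apply_of_ne_of_ne] <;> grind
  by_cases yr : y = r
  · subst yr
    rw [h3, Perm.mul_apply, swap_apply_of_ne_of_ne] <;> grind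
  by_cases yt : y = t
  · subst yt
    rw [h4, Perm.mul_apply, swap_apply_of_ne_of_ne] <;> grind
  rw [h5 y yp yq yr yt]

theorem isTriangular (hM : M.IsTriangular) (h : M.EdgeFlip N p q r t) : N.IsTriangular := by
  rw [isTriangular_iff] at hM ⊢
  intro u v huv
  have hadj := h.adj_iff.1 huv
  have hrot := fun x y => h.rot_eq (x := x) (y := y)
  have hadjrot : M.graph.Adj u v → M.graph.Adj v (M.rot v u) := fun h => M.adj_rot h.symm
  have hM' := hM u v
  obtain ⟨⟨hpq, a1, a2, a3⟩, ⟨-, b1, b2, b3⟩, hrt, hn, -, h1, h2, h3, h4, -⟩ := h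
  have e1 : M.rot r t = t := M.rot_of_not_adj _ _ hn
  have e2 : M.rot t r = r := M.rot_of_not_adj _ _ fun h => hn h.symm
  have hn' : ¬ M.graph.Adj t r := fun h => hn h.symm
  -- The two triangles with the side `rt`; the other triangles are unchanged.
  have c1 : N.rot p r = t := by simp [h1, b1]
  have c2 : N.rot q t = r := by simp [h2, a1]
  have c3 : N.rot r q = t := by simp [h3, e1]
  have c4 : N.rot r t = p := by simp [h3, a2]
  have c5 : N.rot t p = r := by simp [h4, e2]
  have c6 : N.rot t r = q := by simp [h4, b2]
  by_cases k1 : u = r ∧ v = p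
  · grind
  by_cases k2 : u = t ∧ v = q
  · grind
  by_cases k3 : u = q ∧ v = r
  · grind
  by_cases k4 : u = t ∧ v = r
  · grind
  by_cases k5 : u = p ∧ v = t
  · grind
  by_cases k6 : u = r ∧ v = t
  · grind
  have hM1 : M.graph.Adj u v := by grind
  have hz := hM' hM1
  have hz' := hadjrot hM1
  have e : N.rot v u = M.rot v u := by apply hrot <;> grind
  rw [e]
  set z := M.rot v u
  have e' : N.rot z v = M.rot z v := by apply hrot <;> grind
  rw [e', hz]

end EdgeFlip

end Operations

end RotationSystem

/-! ### Counting faces -/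

namespace RotationSystem

variable {V : Type*} (M : RotationSystem V)

theorem eq_or_eq_of_not_adj {x y : V} (h : ¬ M.graph.Adj x y) {d : V × V}
    (hs : M.arcPerm.SameCycle (x, y) d) : d = (x, y) ∨ d = (y, x) := by
  have h1 : M.arcPerm (x, y) = (y, x) := by
    rw [arcPerm_apply, M.rot_of_not_adj _ _ fun h' => h h'.symm]
  have h2 : M.arcPerm (y, x) = (x, y) := by rw [arcPerm_apply, M.rot_of_not_adj _ _ h]
  obtain ⟨i, rfl⟩ := hs
  induction i using Int.induction_on with
  | zero => exact .inl rfl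
  | succ i ih =>
    rw [add_comm, zpow_add, Perm.mul_apply, zpow_one]
    rcases ih with ih | ih <;> rw [ih]
    · exact .inr h1
    · exact .inl h2
  | pred i ih =>
    rw [sub_eq_neg_add, zpow_add, Perm.mul_apply, zpow_neg_one]
    rcases ih with ih | ih <;> rw [ih, Perm.inv_eq_iff_eq, Perm.inv_eq_iff_eq, h1, h2] <;> simp

/-- A pair of non-adjacent vertices is a cycle of `arcPerm`, a loop at a vertex is another one, and
the remaining cycles are the faces. -/
theorem cycleCount_arcPerm [Finite V] :
    M.arcPerm.cycleCount + Nat.card M.graph.edgeSet = Nat.card M.Face + Nat.card (Sym2 V) := by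
  classical
  let Q := Quotient (Perm.SameCycle.setoid M.arcPerm)
  let E' := {e : Sym2 V // e ∉ M.graph.edgeSet}
  let F : M.Face ⊕ E' → Q := Sum.elim
    (Quotient.map' (fun d => d.toProd) fun _ _ h => M.sameCycle_facePerm_iff.1 h)
    (fun e => Quotient.mk _ (Quot.out e.1))
  have hout : ∀ e : Sym2 V, s((Quot.out e).1, (Quot.out e).2) = e := fun e => Quot.out_eq e
  have hout' : ∀ e : E', ¬ M.graph.Adj (Quot.out e.1).1 (Quot.out e.1).2 := fun e h =>
    e.2 (by rw [← hout e.1]; exact h)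
  have hF : Function.Bijective F := by
    constructor
    · have hex : ∀ {a b : V × V}, (Quotient.mk _ a : Q) = Quotient.mk _ b →
          M.arcPerm.SameCycle a b := fun h => Quotient.exact h
      rintro (d | e) (d' | e') h
      · induction d, d' using Quotient.inductionOn₂ with
        | _ d d' => exact congrArg Sum.inl (Quotient.sound (M.sameCycle_facePerm_iff.2 (hex h)))
      · induction d using Quotient.inductionOn with
        | _ d => exact absurd (M.adj_of_sameCycle (hex h) d.adj) (hout' e')
      · induction d' using Quotient.inductionOn with
        | _ d' => exact absurd (M.adj_of_sameCycle (hex h).symm d'.adj) (hout' e)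
      · refine congrArg Sum.inr (Subtype.ext ?_)
        have h := M.eq_or_eq_of_not_adj (hout' e) (hex h)
        rw [← hout e.1, ← hout e'.1]
        rcases h with h | h <;> simp [h]
    · rintro ⟨x, y⟩
      by_cases h : M.graph.Adj x y
      · exact ⟨.inl (Quotient.mk _ ⟨(x, y), h⟩), rfl⟩
      · refine ⟨.inr ⟨s(x, y), h⟩, ?_⟩
        have h1 := hout s(x, y)
        rw [Sym2.eq_iff] at h1
        refine Quotient.sound ?_
        rcases h1 with h1 | h1
        · rw [show Quot.out s(x, y) = (x, y) from Prod.ext h1.1 h1.2]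
        · rw [show Quot.out s(x, y) = (y, x) from Prod.ext h1.1 h1.2]
          have := Perm.sameCycle_apply_right.2 (Perm.SameCycle.refl M.arcPerm (y, x))
          rwa [arcPerm_apply, M.rot_of_not_adj _ _ h] at this
  have h1 : Nat.card Q = Nat.card M.Face + Nat.card E' := by
    rw [← Nat.card_congr (Equiv.ofBijective F hF)]
    have : Finite M.graph.Dart := Finite.of_injective _ SimpleGraph.Dart.toProd_injective
    have : Finite M.Face := Quotient.finite _
    exact Nat.card_sum
  have h2 : Nat.card (Sym2 V) = Nat.card M.graph.edgeSet + Nat.card E' := by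
    rw [← Nat.card_congr (Equiv.Set.sumCompl M.graph.edgeSet)]
    exact Nat.card_sum
  change Nat.card Q + _ = _
  omega

theorem card_dart [Finite V] : Nat.card M.graph.Dart = 2 * Nat.card M.graph.edgeSet := by
  classical
  have := Fintype.ofFinite V
  rw [Nat.card_eq_fintype_card, SimpleGraph.dart_card_eq_twice_card_edges,
    Nat.card_eq_fintype_card, SimpleGraph.edgeFinset_card]

/-- The number of arcs is the sum of the lengths of the faces. -/
theorem card_dart_eq_sum [Finite V] [Fintype M.Face] : Nat.card M.graph.Dart =
    ∑ f : M.Face, Nat.card {d : M.graph.Dart // Quotient.mk _ d = f} := by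
  have : Finite M.graph.Dart := Finite.of_injective _ SimpleGraph.Dart.toProd_injective
  rw [← Nat.card_sigma]
  exact Nat.card_congr
    (Equiv.sigmaFiberEquiv fun d : M.graph.Dart => (Quotient.mk _ d : M.Face)).symm

theorem IsTriangular.three_mul_card_face [Finite V] {M : RotationSystem V} (h : M.IsTriangular) :
    3 * Nat.card M.Face = 2 * Nat.card M.graph.edgeSet := by
  classical
  have : Finite M.graph.Dart := Finite.of_injective _ SimpleGraph.Dart.toProd_injective
  have : Finite M.Face := Quotient.finite _
  have := Fintype.ofFinite M.Face
  rw [← card_dart, card_dart_eq_sum, Finset.sum_const_nat (m := 3), Finset.card_univ,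
    Nat.card_eq_fintype_card, mul_comm]
  rintro ⟨⟨⟨x, y⟩, hxy⟩⟩ -
  have ht := h x y hxy
  set z := M.rot y x
  have hyz := ht.rotate.1
  have hzx := ht.rotate.rotate.1
  have hset : {d : M.graph.Dart | (Quotient.mk _ d : M.Face) = Quotient.mk _ ⟨(x, y), hxy⟩} =
      {⟨(x, y), hxy⟩, ⟨(y, z), hyz⟩, ⟨(z, x), hzx⟩} := by
    ext d
    simp only [Set.mem_ofPred_eq, Set.mem_insert_iff, Set.mem_singleton_iff,
      SimpleGraph.Dart.ext_iff]
    constructor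
    · intro hd
      exact ht.sameCycle (M.sameCycle_facePerm_iff.1 (Quotient.exact hd).symm)
    · intro hd
      refine Quotient.sound (Perm.SameCycle.symm (M.sameCycle_facePerm_iff.2 ?_))
      rcases hd with hd | hd | hd <;> rw [hd]
      · exact Perm.sameCycle_apply_left.1
          (show M.arcPerm.SameCycle (M.arcPerm (x, y)) (y, z) from .refl _ _)
      · refine Perm.sameCycle_apply_left.1 (Perm.sameCycle_apply_left.1 ?_)
        rw [arcPerm_apply, arcPerm_apply, show M.rot y x = z from rfl, ht.2.2.1]
  have : Nat.card {d : M.graph.Dart |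
      (Quotient.mk _ d : M.Face) = Quotient.mk _ ⟨(x, y), hxy⟩} = 3 := by
    rw [hset, Nat.card_coe_set_eq]
    have h1 := hxy.ne
    have h2 := hyz.ne
    have h3 := hzx.ne
    rw [Set.ncard_insert_of_notMem, Set.ncard_pair] <;>
      simp only [Set.mem_insert_iff, Set.mem_singleton_iff, ne_eq, SimpleGraph.Dart.ext_iff,
        Prod.mk.injEq] <;> grind
  exact this

/-- In an embedding of a complete graph with at least three vertices, no face has fewer than three
sides. -/
theorem three_mul_card_face_le [Finite V] (hV : 3 ≤ Nat.card V) (h : M.graph = ⊤) :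
    3 * Nat.card M.Face ≤ 2 * Nat.card M.graph.edgeSet := by
  classical
  have : Finite M.graph.Dart := Finite.of_injective _ SimpleGraph.Dart.toProd_injective
  have : Finite M.Face := Quotient.finite _
  have := Fintype.ofFinite M.Face
  have := Fintype.ofFinite V
  rw [← card_dart, card_dart_eq_sum, mul_comm, Nat.card_eq_fintype_card, ← smul_eq_mul,
    ← Finset.card_univ]
  refine Finset.card_nsmul_le_sum _ _ _ ?_
  rintro ⟨d⟩ -
  have hne : ∀ d, M.facePerm d ≠ d := fun d hd => by
    have := congrArg (fun d : M.graph.Dart => d.fst) hd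
    exact d.adj.ne this.symm
  -- A face of length 2 would leave a vertex with a single neighbour.
  have hne2 : M.facePerm (M.facePerm d) ≠ d := fun hd => by
    have h1 : M.rot d.snd d.fst = d.fst := congrArg (fun d : M.graph.Dart => d.fst) hd
    obtain ⟨t, ht⟩ : ∃ t, t ∉ ({d.fst, d.snd} : Finset V) := by
      by_contra hcon
      push Not at hcon
      have : (Finset.univ : Finset V).card ≤ 2 :=
        (Finset.card_le_card fun t _ => hcon t).trans Finset.card_le_two
      rw [Finset.card_univ, ← Nat.card_eq_fintype_card] at this
      omega
    simp only [Finset.mem_insert, Finset.mem_singleton, not_or] at ht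
    have h2 : M.graph.Adj d.snd t := by
      have hadj : ∀ a b, a ≠ b → M.graph.Adj a b := fun a b hab => by rw [h]; exact hab
      exact hadj _ _ fun h => ht.2 h.symm
    have h3 := (M.isCycleOn d.snd).2 (show d.fst ∈ _ from d.adj.symm) (show t ∈ _ from h2)
    exact ht.1 (h3.eq_of_left h1).symm
  have hsub : ({d, M.facePerm d, M.facePerm (M.facePerm d)} : Set M.graph.Dart) ⊆
      {d' | (Quotient.mk _ d' : M.Face) = Quotient.mk _ d} := by
    rintro d' (rfl | rfl | rfl)
    · rfl
    · exact Quotient.sound (Perm.sameCycle_apply_left.2 (Perm.SameCycle.refl _ _))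
    · exact Quotient.sound (Perm.sameCycle_apply_left.2
        (Perm.sameCycle_apply_left.2 (Perm.SameCycle.refl _ _)))
  have := Set.ncard_le_ncard hsub
  rw [Set.ncard_insert_of_notMem, Set.ncard_pair (hne _).symm] at this
  · exact this
  · simp only [Set.mem_insert_iff, Set.mem_singleton_iff, not_or]
    exact ⟨(hne _).symm, hne2.symm⟩

theorem card_edgeSet_top [Finite V] (h : M.graph = ⊤) :
    2 * Nat.card M.graph.edgeSet = Nat.card V * (Nat.card V - 1) := by
  classical
  have := Fintype.ofFinite V
  rw [h, Nat.card_eq_fintype_card, ← SimpleGraph.edgeFinset_card,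
    SimpleGraph.card_edgeFinset_top_eq_card_choose_two, Nat.card_eq_fintype_card,
    Nat.choose_two_right, Nat.mul_div_cancel' (Nat.even_mul_pred_self _).two_dvd]

theorem connected_of_eq_top [Nonempty V] (h : M.graph = ⊤) : M.graph.Connected := by
  rw [h]; exact SimpleGraph.connected_top

/-- The lower bound for the genus of the complete graph, from Euler's formula and `3 |F| ≤ 2 |E|`.
-/
theorem le_of_hasGenus {s g : ℕ} (hV : Nat.card V = 12 * s + 14) (h : M.graph = ⊤)
    (hg : M.HasGenus g) : 12 * s ^ 2 + 21 * s + 10 ≤ g := by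
  have : Finite V := Nat.finite_of_card_ne_zero (by omega)
  have h1 := M.three_mul_card_face_le (by omega) h
  have h2 := M.card_edgeSet_top h
  obtain ⟨-, h3⟩ := hg
  rw [hV, show 12 * s + 14 - 1 = 12 * s + 13 by omega] at h2
  rw [hV] at h3
  zify at h1 h2 ⊢
  push_cast at h3
  by_contra hcon
  push Not at hcon
  nlinarith

/-- The lower bound, rounded up to an integer, is attained when `3 |F| = 2 |E| - 5`. -/
theorem hasGenus_of_card_face {s : ℕ} (hV : Nat.card V = 12 * s + 14) (h : M.graph = ⊤)
    (hF : 3 * Nat.card M.Face + 5 = 2 * Nat.card M.graph.edgeSet) :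
    M.HasGenus (12 * s ^ 2 + 21 * s + 10) := by
  have : Finite V := Nat.finite_of_card_ne_zero (by omega)
  have : Nonempty V := (Nat.card_pos_iff.1 (by omega)).1
  have h2 := M.card_edgeSet_top h
  refine ⟨M.connected_of_eq_top h, ?_⟩
  rw [hV, show 12 * s + 14 - 1 = 12 * s + 13 by omega] at h2
  rw [hV]
  zify at hF h2 ⊢
  nlinarith

theorem isMinimumGenus_of_hasGenus {s : ℕ} (hV : Nat.card V = 12 * s + 14) (h : M.graph = ⊤)
    (hg : M.HasGenus (12 * s ^ 2 + 21 * s + 10)) : M.IsMinimumGenus :=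
  ⟨_, hg, fun N hN _ hg' => N.le_of_hasGenus hV (hN.trans h) hg'⟩

/-- An embedding of a complete graph with renamed vertices. -/
theorem exists_hasGenus_of_equiv {W : Type*} [Finite V] (e : V ≃ W) (h : M.graph = ⊤) {g : ℕ}
    (hg : M.HasGenus g) : ∃ N : RotationSystem W, N.graph = ⊤ ∧ N.HasGenus g := by
  have hzpow : ∀ {A B : Type _} (e : A ≃ B) (f : Perm A) (i : ℤ) (a : A),
      ((e.permCongr f) ^ i) (e a) = e ((f ^ i) a) := by
    intro A B e f i a
    have := map_zpow e.permCongrHom f i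
    simp only [Equiv.permCongrHom_coe] at this
    rw [← this]
    simp
  have : Finite W := Finite.of_equiv V e
  let N : RotationSystem W :=
    { graph := ⊤
      rot := fun w => e.permCongr (M.rot (e.symm w))
      isCycleOn := by
        intro w
        have hc := M.isCycleOn (e.symm w)
        have hmem : ∀ a, a ∈ (⊤ : SimpleGraph W).neighborSet w ↔
            e.symm a ∈ M.graph.neighborSet (e.symm w) := by
          intro a; simp [h]
        refine ⟨Equiv.bijOn _ fun a => ?_, fun a ha b hb => ?_⟩
        · rw [hmem, hmem, Equiv.permCongr_apply, Equiv.symm_apply_apply, hc.apply_mem_iff]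
        · obtain ⟨i, hi⟩ := hc.2 ((hmem a).1 ha) ((hmem b).1 hb)
          refine ⟨i, ?_⟩
          have := hzpow e (M.rot (e.symm w)) i (e.symm a)
          rw [hi] at this
          simpa using this
      rot_of_not_adj := by
        intro v w hvw
        have : ¬ M.graph.Adj (e.symm v) (e.symm w) := by
          rw [h]; simpa using hvw
        simp [M.rot_of_not_adj _ _ this] }
  have hN : N.graph = ⊤ := rfl
  refine ⟨N, hN, ?_⟩
  have hc : N.arcPerm.cycleCount = M.arcPerm.cycleCount := by
    have : N.arcPerm = (e.prodCongr e).permCongr M.arcPerm := by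
      ext1 ⟨x, y⟩
      simp [N, arcPerm]
    rw [this]
    refine (Nat.card_congr
      (Quotient.congr (e.prodCongr e) fun a b => exists_congr fun i => ?_)).symm
    rw [hzpow, (e.prodCongr e).injective.eq_iff]
  have hE : Nat.card N.graph.edgeSet = Nat.card M.graph.edgeSet := by
    have h1 := N.card_edgeSet_top hN
    have h2 := M.card_edgeSet_top h
    rw [← Nat.card_congr e] at h1
    omega
  have hS : Nat.card (Sym2 W) = Nat.card (Sym2 V) := 
    Nat.card_congr ⟨Sym2.map e.symm, Sym2.map e, fun a => by simp [Sym2.map_map],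
      fun a => by simp [Sym2.map_map]⟩
  have h1 := M.cycleCount_arcPerm
  have h2 := N.cycleCount_arcPerm
  have : Nonempty W := hg.1.nonempty.map e
  refine ⟨N.connected_of_eq_top hN, ?_⟩
  rw [← hg.2, hE, ← Nat.card_congr e, show Nat.card N.Face = Nat.card M.Face by omega]

end RotationSystem

/-! ### Contraction of an edge -/

namespace Equiv.Perm

/-- Two disjoint cycles are joined into one. -/
theorem IsCycleOn.mul_swap_union {α : Type*} [DecidableEq α] [Finite α] {f : Perm α} {S T : Set α}
    (hS : f.IsCycleOn S) (hT : f.IsCycleOn T) (hST : _root_.Disjoint S T) {x y : α} (hx : x ∈ S)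
    (hy : y ∈ T) : (f * swap x y).IsCycleOn (S ∪ T) := by
  have hns : ¬ f.SameCycle x y := by
    rintro ⟨i, rfl⟩
    exact Set.disjoint_left.1 hST ((hS.1.perm_zpow i).mapsTo hx) hy
  have hxy : x ≠ y := fun h => hns (h ▸ .refl _ _)
  refine ⟨Equiv.bijOn _ fun a => ?_, fun a ha b hb => ?_⟩
  · have h1 : swap x y a ∈ S ∪ T ↔ a ∈ S ∪ T := by
      rw [swap_apply_def]
      split_ifs with h h' <;> simp_all
    rw [← h1, Perm.mul_apply, Set.mem_union, Set.mem_union, hS.apply_mem_iff, hT.apply_mem_iff]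
  · have key : ∀ c ∈ S ∪ T, (f * swap x y).SameCycle x c := by
      rintro c (hc | hc)
      · exact (hS.2 hx hc).mul_swap hns
      · exact (sameCycle_mul_swap_self hns).trans ((hT.2 hy hc).mul_swap hns)
    exact (key a ha).symm.trans (key b hb)

theorem IsCycleOn.subtypePerm_preimage {α : Type*} {f : Perm α} {S : Set α} {P : α → Prop}
    (hS : f.IsCycleOn S) (hP : ∀ x, P (f x) ↔ P x) :
    (f.subtypePerm hP).IsCycleOn {x : {x // P x} | x.1 ∈ S} :=
  ⟨Equiv.bijOn _ fun a => by simp [hS.apply_mem_iff], fun a ha b hb =>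
    sameCycle_subtypePerm.2 (hS.2 ha hb)⟩

end Equiv.Perm

namespace RotationSystem

variable {V : Type*} [DecidableEq V] {M : RotationSystem V} {p q : V}

/-- The rotation at the contracted vertex is obtained from the product of the rotations at `p` and
`q`, whose neighbourhoods are disjoint, by joining the two cycles at `q` and `p` and then removing
`q` and `p`. At the other neighbours of `q`, the name `p` takes the place of `q`. -/
theorem exists_isContraction [Finite V] (hpq : M.graph.Adj p q)
    (hcom : ∀ z, ¬ (M.graph.Adj p z ∧ M.graph.Adj q z)) (hp : M.rot p q ≠ q)
    (hq : M.rot q p ≠ p) : ∃ K : RotationSystem {z : V // z ≠ q}, M.IsContraction p q K := by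
  classical
  have hne := hpq.ne
  let A := M.graph.neighborSet p
  let B := M.graph.neighborSet q
  have hAB : Disjoint A B := Set.disjoint_left.2 fun z h h' => hcom z ⟨h, h'⟩
  have hPB : ∀ z, ¬ M.graph.Adj p z → M.rot p z = z := M.rot_of_not_adj p
  have hQA : ∀ z, ¬ M.graph.Adj q z → M.rot q z = z := M.rot_of_not_adj q
  have hQA' : ∀ z, M.graph.Adj p z → M.rot q z = z := fun z h => hQA z fun h' => hcom z ⟨h, h'⟩
  have hPB' : ∀ z, M.graph.Adj q z → M.rot p z = z := fun z h => hPB z fun h' => hcom z ⟨h', h⟩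
  let f := M.rot p * M.rot q
  have hfA : ∀ z, M.graph.Adj p z → f z = M.rot p z := fun z h => by simp [f, hQA' z h]
  have hfB : ∀ z, M.graph.Adj q z → f z = M.rot q z := fun z h => by
    simp [f, hPB' _ (M.adj_rot h)]
  have hcongr : ∀ {g h : Perm V} {S : Set V}, g.IsCycleOn S → (∀ z ∈ S, h z = g z) →
      h.IsCycleOn S := by
    intro g h S hg hgh
    have hpow : ∀ i : ℕ, ∀ z ∈ S, (h ^ i) z = (g ^ i) z := by
      intro i
      induction i with
      | zero => simp
      | succ i ih =>
        intro z hz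
        rw [pow_succ, pow_succ, Perm.mul_apply, Perm.mul_apply, hgh z hz, ih _ (hg.1.mapsTo hz)]
    refine ⟨hg.1.congr fun z hz => (hgh z hz).symm, fun a ha b hb => ?_⟩
    obtain ⟨i, -, -, hi⟩ := (hg.2 ha hb).exists_pow_eq''
    exact ⟨i, by rw [zpow_natCast, hpow i a ha, hi]⟩
  -- On `A` the product `f` is the rotation at `p`, and on `B` it is the rotation at `q`.
  have cA : f.IsCycleOn A := hcongr (M.isCycleOn p) hfA
  have cB : f.IsCycleOn B := hcongr (M.isCycleOn q) hfB
  let g := f * swap q p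
  have cg : g.IsCycleOn (A ∪ B) := cA.mul_swap_union cB hAB hpq hpq.symm
  -- The predecessors of `q` at `p` and of `p` at `q`.
  obtain ⟨a, ha, haq⟩ := (M.isCycleOn p).1.surjOn (show q ∈ M.graph.neighborSet p from hpq)
  obtain ⟨c, hc, hcp⟩ := (M.isCycleOn q).1.surjOn (show p ∈ M.graph.neighborSet q from hpq.symm)
  have haq' : a ≠ q := by rintro rfl; exact hp haq
  have hap' : a ≠ p := ha.ne'
  have hcp' : c ≠ p := by rintro rfl; exact hq hcp
  have hcq' : c ≠ q := hc.ne'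
  have hac : a ≠ c := by rintro rfl; exact hcom _ ⟨ha, hc⟩
  have gA : ∀ z, M.graph.Adj p z → z ≠ q → g z = M.rot p z := fun z h h' => by
    rw [Perm.mul_apply, swap_apply_of_ne_of_ne h' h.ne', hfA z h]
  have gB : ∀ z, M.graph.Adj q z → z ≠ p → g z = M.rot q z := fun z h h' => by
    rw [Perm.mul_apply, swap_apply_of_ne_of_ne h.ne' h', hfB z h]
  have gq : g q = M.rot q p := by
    rw [Perm.mul_apply, swap_apply_left, hfB p hpq.symm]
  have gp : g p = M.rot p q := by
    rw [Perm.mul_apply, swap_apply_right, hfA q hpq]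
  have ga : g a = q := by rw [gA a ha haq', haq]
  have gc : g c = p := by rw [gB c hc hcp', hcp]
  have cg' := cg.mul_swap_remove (.inl ha) ga haq'
  have gc' : (g * swap a q) c = p := by
    rw [Perm.mul_apply, swap_apply_of_ne_of_ne hac.symm hcq', gc]
  have cg'' := cg'.mul_swap_remove (p := c) (w := p) ⟨.inr hc, hcq'⟩ gc' hcp'
  set k := g * swap a q * swap c p with hk
  have ka : k a = M.rot q p := by
    rw [hk, Perm.mul_apply, swap_apply_of_ne_of_ne hac hap', Perm.mul_apply, swap_apply_left, gq]
  have kc : k c = M.rot p q := by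
    rw [hk, Perm.mul_apply, swap_apply_left, Perm.mul_apply,
      swap_apply_of_ne_of_ne hap'.symm hne, gp]
  have kA : ∀ z, M.graph.Adj p z → z ≠ q → M.rot p z ≠ q → k z = M.rot p z := fun z h h' h'' => by
    have h1 : z ≠ c := by rintro rfl; exact hcom _ ⟨h, hc⟩
    have h2 : z ≠ a := by rintro rfl; exact h'' haq
    rw [hk, Perm.mul_apply, swap_apply_of_ne_of_ne h1 h.ne', Perm.mul_apply,
      swap_apply_of_ne_of_ne h2 h', gA z h h']
  have kB : ∀ z, M.graph.Adj q z → z ≠ p → M.rot q z ≠ p → k z = M.rot q z := fun z h h' h'' => by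
    have h1 : z ≠ a := by rintro rfl; exact hcom _ ⟨ha, h⟩
    have h2 : z ≠ c := by rintro rfl; exact h'' hcp
    rw [hk, Perm.mul_apply, swap_apply_of_ne_of_ne h2 h', Perm.mul_apply,
      swap_apply_of_ne_of_ne h1 h.ne', gB z h h']
  have kq : k q = q := by
    rw [hk, Perm.mul_apply, swap_apply_of_ne_of_ne hcq'.symm hne.symm, Perm.mul_apply,
      swap_apply_right, ga]
  have kp : k p = p := by
    rw [hk, Perm.mul_apply, swap_apply_right, Perm.mul_apply,
      swap_apply_of_ne_of_ne hac.symm hcq', gc]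
  have kfix : ∀ z, ¬ M.graph.Adj p z → ¬ M.graph.Adj q z → k z = z := fun z h h' => by
    have h1 : z ≠ a := by rintro rfl; exact h ha
    have h2 : z ≠ c := by rintro rfl; exact h' hc
    have h3 : z ≠ p := by rintro rfl; exact h' hpq.symm
    have h4 : z ≠ q := by rintro rfl; exact h hpq
    rw [hk, Perm.mul_apply, swap_apply_of_ne_of_ne h2 h3, Perm.mul_apply,
      swap_apply_of_ne_of_ne h1 h4, Perm.mul_apply, swap_apply_of_ne_of_ne h4 h3, Perm.mul_apply,
      hQA z h', hPB z h]
  -- The rotations after the contraction, and their supports, on the vertices with `q` included.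
  let ρ : V → Perm V := fun z =>
    if z = p then k else if M.graph.Adj z q then swap p q * M.rot z * (swap p q)⁻¹ else M.rot z
  let S : V → Set V := fun z =>
    if z = p then ((A ∪ B) \ {q}) \ {p} else
      if M.graph.Adj z q then swap p q '' M.graph.neighborSet z else M.graph.neighborSet z
  have hρS : ∀ z, (ρ z).IsCycleOn (S z) := by
    intro z
    by_cases h : z = p
    · simpa only [ρ, S, if_pos h] using cg''
    by_cases h' : M.graph.Adj z q
    · simpa only [ρ, S, if_neg h, if_pos h'] using (M.isCycleOn z).conj (g := swap p q)
    · simpa only [ρ, S, if_neg h, if_neg h'] using M.isCycleOn z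
  have hρq : ∀ z, z ≠ q → ρ z q = q := by
    intro z hz
    by_cases h : z = p
    · simpa only [ρ, if_pos h] using kq
    by_cases h' : M.graph.Adj z q
    · have h'' : ¬ M.graph.Adj z p := fun h'' => hcom z ⟨h''.symm, h'.symm⟩
      simp [ρ, h, h', M.rot_of_not_adj _ _ h'']
    · simp [ρ, h, h', M.rot_of_not_adj _ _ h']
  have hρ' : ∀ z, z ≠ q → ∀ x, ρ z x ≠ q ↔ x ≠ q := by
    intro z hz x
    conv_lhs => rw [← hρq z hz]
    exact (ρ z).injective.ne_iff
  have hSq : ∀ z, z ≠ q → ∀ x, x ≠ q → (x ∈ S z ↔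
      z ≠ x ∧ (M.graph.Adj z x ∨ (z = p ∧ M.graph.Adj q x) ∨ (x = p ∧ M.graph.Adj z q))) := by
    intro z hz x hx
    by_cases h : z = p
    · subst h
      simp only [S, if_true, A, B, Set.mem_sdiff, Set.mem_union, SimpleGraph.mem_neighborSet,
        Set.mem_singleton_iff]
      grind
    by_cases h' : M.graph.Adj z q
    · have h'' : ¬ M.graph.Adj z p := fun h'' => hcom z ⟨h''.symm, h'.symm⟩
      simp only [S, if_neg h, if_pos h', Equiv.image_eq_preimage_symm, symm_swap, Set.mem_preimage,
        SimpleGraph.mem_neighborSet]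
      by_cases hxp : x = p
      · subst hxp
        simp [h, h']
      · rw [swap_apply_of_ne_of_ne hxp hx]
        have := fun h : M.graph.Adj z x => h.ne
        grind
    · have := fun h : M.graph.Adj z x => h.ne
      simp only [S, if_neg h, if_neg h', SimpleGraph.mem_neighborSet]
      grind
  let G : SimpleGraph {z : V // z ≠ q} :=
    { Adj := fun z z' => z ≠ z' ∧
        (M.graph.Adj z z' ∨ (z.1 = p ∧ M.graph.Adj q z') ∨ (z'.1 = p ∧ M.graph.Adj z q))
      symm := ⟨fun z z' h => ⟨h.1.symm, by
        have h1 := M.graph.adj_comm z z'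
        have h2 := M.graph.adj_comm z q
        have h3 := M.graph.adj_comm z' q
        grind⟩⟩
      loopless := ⟨fun z h => h.1 rfl⟩ }
  have hGS : ∀ z, G.neighborSet z = {x | x.1 ∈ S z} := by
    intro z
    ext x
    rw [Set.mem_ofPred_eq, hSq z z.2 x x.2, SimpleGraph.mem_neighborSet]
    exact and_congr_left' (not_congr Subtype.ext_iff)
  let K : RotationSystem {z : V // z ≠ q} :=
    { graph := G
      rot := fun z => (ρ z).subtypePerm (hρ' z z.2)
      isCycleOn := fun z => by
        rw [hGS]
        exact (hρS z).subtypePerm_preimage _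
      rot_of_not_adj := by
        intro z x hzx
        have hzx' : x.1 ∉ S z := fun h => hzx (by
          change x ∈ G.neighborSet z
          rw [hGS]; exact h)
        rw [hSq z z.2 x x.2] at hzx'
        refine Subtype.ext ?_
        rw [Perm.subtypePerm_apply]
        by_cases hzx'' : z.1 = x.1
        · by_cases h : z.1 = p
          · simp only [ρ, if_pos h]
            rw [← hzx'', h, kp]
          by_cases h' : M.graph.Adj z q
          · simp only [ρ, if_neg h, if_pos h', Perm.mul_apply, swap_inv]
            rw [← hzx'', swap_apply_of_ne_of_ne h z.2, M.rot_of_not_adj _ _ (by simp),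
              swap_apply_of_ne_of_ne h z.2]
          · simp only [ρ, if_neg h, if_neg h']
            rw [← hzx'', M.rot_of_not_adj _ _ (by simp)]
        · have hzx := not_and.1 hzx' hzx''
          by_cases h : z.1 = p
          · simp only [ρ, if_pos h]
            rw [h] at hzx
            exact kfix _ (by grind) (by grind)
          by_cases h' : M.graph.Adj z q
          · have hxp : x.1 ≠ p := by grind
            simp only [ρ, if_neg h, if_pos h', Perm.mul_apply, swap_inv]
            rw [swap_apply_of_ne_of_ne hxp x.2, M.rot_of_not_adj _ _ (by grind),
              swap_apply_of_ne_of_ne hxp x.2]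
          · simp only [ρ, if_neg h, if_neg h']
            exact M.rot_of_not_adj _ _ (by grind) }
  refine ⟨K, hpq, hcom, fun z z' => Iff.rfl, fun z z' hzz => ?_⟩
  have hzz' : z ≠ z' ∧ (M.graph.Adj z z' ∨ (z.1 = p ∧ M.graph.Adj q z') ∨
    (z'.1 = p ∧ M.graph.Adj z q)) := hzz
  change ρ z z' = _
  have hzne : z.1 ≠ z'.1 := fun h => hzz'.1 (Subtype.ext h)
  by_cases h : z.1 = p
  · simp only [ρ, if_pos h]
    by_cases h1 : M.graph.Adj p z'
    · rw [if_pos h1, if_pos hq]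
      by_cases h2 : M.rot p z' = q
      · have : z'.1 = a := (M.rot p).injective (h2.trans haq.symm)
        rw [if_neg (not_not.2 h2), this, ka]
      · rw [if_pos h2, kA _ h1 z'.2 h2]
    · have h1' : M.graph.Adj q z' := by
        rw [h] at hzz'
        grind
      rw [if_neg h1, if_pos hp]
      by_cases h2 : M.rot q z' = p
      · have : z'.1 = c := (M.rot q).injective (h2.trans hcp.symm)
        rw [if_neg (not_not.2 h2), this, kc]
      · rw [if_pos h2, kB _ h1' (h ▸ hzne.symm) h2]
  · by_cases h' : M.graph.Adj z q
    · have h'' : ¬ M.graph.Adj z p := fun h'' => hcom z ⟨h''.symm, h'.symm⟩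
      simp only [ρ, if_neg h, if_pos h', Perm.mul_apply, swap_inv]
      have hfix := M.rot_of_not_adj _ _ h''
      have hsw : swap p q z' = if z'.1 = p then q else z'.1 := by
        rw [swap_apply_def, if_neg z'.2]
      rw [hsw, swap_apply_def]
      have hnp : M.rot z (if z'.1 = p then q else z'.1) ≠ p := by
        intro h1
        have := (M.rot z).injective (h1.trans hfix.symm)
        split_ifs at this with h2
        · exact hne this.symm
        · exact h2 this
      rw [if_neg hnp]
      by_cases hz'p : z'.1 = p
      · simp only [hz'p, h', and_self, if_true]
      · simp only [hz'p, false_and, if_false]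
    · have hfix := M.rot_of_not_adj _ _ h'
      have hz'q : M.rot z z' ≠ q := fun h1 => z'.2 ((M.rot z).injective (h1.trans hfix.symm))
      simp only [ρ, if_neg h, h', and_false, if_false, if_neg hz'q]

end RotationSystem

namespace RotationSystem

variable {V : Type*} [DecidableEq V] {M : RotationSystem V} {p q : V}

namespace IsContraction

variable {K : RotationSystem {z : V // z ≠ q}}

open Classical in
/-- The arc of the embedding before the contraction of `pq` that becomes the arc `(x, y)`. -/
noncomputable def liftArc (M : RotationSystem V) (p q : V)
    (d : {z : V // z ≠ q} × {z : V // z ≠ q}) : V × V :=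
  if M.graph.Adj d.1 d.2 then (d.1, d.2) else if d.1.1 = p then (q, d.2) else (d.1, q)

theorem liftArc_of_adj {x y : {z : V // z ≠ q}} (h : M.graph.Adj x y) :
    liftArc M p q (x, y) = (x.1, y.1) := if_pos h

theorem liftArc_of_not_adj_left {x y : {z : V // z ≠ q}} (h : ¬ M.graph.Adj x y) (hx : x.1 = p) :
    liftArc M p q (x, y) = (q, y.1) :=
  (if_neg h).trans (if_pos hx)

theorem liftArc_of_not_adj_right {x y : {z : V // z ≠ q}} (h : ¬ M.graph.Adj x y) (hx : x.1 ≠ p) :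
    liftArc M p q (x, y) = (x.1, q) :=
  (if_neg h).trans (if_neg hx)

/-- The three kinds of arcs after the contraction. -/
theorem liftArc_cases (h : M.IsContraction p q K) {x y : {z : V // z ≠ q}}
    (hxy : K.graph.Adj x y) :
    (M.graph.Adj x y ∧ liftArc M p q (x, y) = (x.1, y.1)) ∨
    (¬ M.graph.Adj x y ∧ x.1 = p ∧ M.graph.Adj q y ∧ y.1 ≠ p ∧ liftArc M p q (x, y) = (q, y.1)) ∨
    (¬ M.graph.Adj x y ∧ y.1 = p ∧ M.graph.Adj x q ∧ x.1 ≠ p ∧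
      liftArc M p q (x, y) = (x.1, q)) := by
  obtain ⟨hne, h1⟩ := (h.2.2.1 x y).1 hxy
  have hne' : x.1 ≠ y.1 := fun h => hne (Subtype.ext h)
  by_cases hadj : M.graph.Adj x y
  · exact .inl ⟨hadj, liftArc_of_adj hadj⟩
  right
  rcases h1 with h1 | ⟨h1, h2⟩ | ⟨h1, h2⟩
  · exact absurd h1 hadj
  · exact .inl ⟨hadj, h1, h2, fun h => hne' (h1.trans h.symm), liftArc_of_not_adj_left hadj h1⟩
  · exact .inr ⟨hadj, h1, h2, fun h => hne' (h.trans h1.symm),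
      liftArc_of_not_adj_right hadj fun h => hne' (h.trans h1.symm)⟩

theorem adj_liftArc (h : M.IsContraction p q K) {x y : {z : V // z ≠ q}}
    (hxy : K.graph.Adj x y) : M.graph.Adj (liftArc M p q (x, y)).1 (liftArc M p q (x, y)).2 := by
  rcases h.liftArc_cases hxy with ⟨h1, h2⟩ | ⟨-, -, h1, -, h2⟩ | ⟨-, -, h1, -, h2⟩ <;>
    rw [h2] <;> exact h1

theorem liftArc_ne (h : M.IsContraction p q K) {x y : {z : V // z ≠ q}}
    (hxy : K.graph.Adj x y) : liftArc M p q (x, y) ≠ (p, q) ∧ liftArc M p q (x, y) ≠ (q, p) := by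
  have hx := x.2
  have hy := y.2
  rcases h.liftArc_cases hxy with ⟨h1, h2⟩ | ⟨-, -, -, h1, h2⟩ | ⟨-, -, -, h1, h2⟩ <;>
    rw [h2] <;> simp [hx, hy, h1]

theorem liftArc_injective (h : M.IsContraction p q K) {x y x' y' : {z : V // z ≠ q}}
    (hxy : K.graph.Adj x y) (hxy' : K.graph.Adj x' y')
    (he : liftArc M p q (x, y) = liftArc M p q (x', y')) : x = x' ∧ y = y' := by
  have hx := x.2
  have hy := y.2
  have hx' := x'.2
  have hy' := y'.2
  simp only [Subtype.ext_iff]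
  rcases h.liftArc_cases hxy with ⟨h1, h2⟩ | ⟨-, h0, -, h1, h2⟩ | ⟨-, h0, -, h1, h2⟩ <;>
    rcases h.liftArc_cases hxy' with ⟨k1, k2⟩ | ⟨-, k0, -, k1, k2⟩ | ⟨-, k0, -, k1, k2⟩ <;>
    rw [h2, k2, Prod.mk.injEq] at he <;> grind

theorem exists_liftArc (h : M.IsContraction p q K) {a b : V} (hab : M.graph.Adj a b)
    (h1 : (a, b) ≠ (p, q)) (h2 : (a, b) ≠ (q, p)) :
    ∃ x y, K.graph.Adj x y ∧ liftArc M p q (x, y) = (a, b) := by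
  have hpq := h.1.ne
  by_cases ha : a = q
  · subst ha
    have hb : b ≠ a := hab.ne'
    have hbp : b ≠ p := fun hb => h2 (by rw [hb])
    refine ⟨⟨p, hpq⟩, ⟨b, hb⟩, ?_, ?_⟩
    · rw [h.2.2.1]
      exact ⟨fun he => hbp (congrArg Subtype.val he).symm, .inr (.inl ⟨rfl, hab⟩)⟩
    · exact liftArc_of_not_adj_left (fun h' => h.2.1 b ⟨h', hab⟩) rfl
  by_cases hb : b = q
  · subst hb
    have hap : a ≠ p := fun ha => h1 (by rw [ha])
    refine ⟨⟨a, ha⟩, ⟨p, hpq⟩, ?_, ?_⟩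
    · rw [h.2.2.1]
      exact ⟨fun he => hap (congrArg Subtype.val he), .inr (.inr ⟨rfl, hab⟩)⟩
    · exact liftArc_of_not_adj_right (fun h' => h.2.1 a ⟨h'.symm, hab.symm⟩) hap
  · refine ⟨⟨a, ha⟩, ⟨b, hb⟩, ?_, liftArc_of_adj hab⟩
    rw [h.2.2.1]
    exact ⟨fun he => hab.ne (congrArg Subtype.val he), .inl hab⟩

/-- Face tracing commutes with the contraction, except that the contracted edge is skipped. -/
theorem liftArc_rot (h : M.IsContraction p q K) (hp : M.rot p q ≠ q) (hq : M.rot q p ≠ p)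
    {x y : {z : V // z ≠ q}} (hxy : K.graph.Adj x y) :
    (M.arcPerm (liftArc M p q (x, y)) ≠ (p, q) ∧ M.arcPerm (liftArc M p q (x, y)) ≠ (q, p) ∧
      liftArc M p q (K.arcPerm (x, y)) = M.arcPerm (liftArc M p q (x, y))) ∨
    ((M.arcPerm (liftArc M p q (x, y)) = (p, q) ∨ M.arcPerm (liftArc M p q (x, y)) = (q, p)) ∧
      liftArc M p q (K.arcPerm (x, y)) = M.arcPerm (M.arcPerm (liftArc M p q (x, y)))) := by
  have hx := x.2
  have hy := y.2
  have hpq := h.1.ne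
  have hspec := h.2.2.2 y x hxy.symm
  have hnP : ∀ z, M.graph.Adj q z → ¬ M.graph.Adj p z := fun z h1 h2 => h.2.1 z ⟨h2, h1⟩
  rw [arcPerm_apply]
  set w := K.rot y x
  by_cases hyp : y.1 = p
  · rw [if_pos hyp] at hspec
    rcases h.liftArc_cases hxy with ⟨h1, h2⟩ | ⟨-, h0, -, h1, -⟩ | ⟨h0, -, h1, -, h2⟩
    · rw [if_pos (hyp ▸ h1.symm), if_pos hq] at hspec
      rw [h2, hyp, arcPerm_apply]
      by_cases hz : M.rot p x = q
      · right
        rw [if_neg (not_not.2 hz)] at hspec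
        refine ⟨.inl (by rw [hz]), ?_⟩
        rw [hz, arcPerm_apply, ← hspec, liftArc_of_not_adj_left _ hyp]
        rw [hyp, hspec]
        exact hnP _ (M.adj_rot h.1.symm)
      · left
        rw [if_pos hz] at hspec
        refine ⟨by simp [hz], by simp [hpq], ?_⟩
        rw [liftArc_of_adj, hspec, hyp]
        rw [hspec, hyp]
        exact M.adj_rot (hyp ▸ h1.symm)
    · exact absurd hyp h1
    · rw [if_neg fun h' => h0 (hyp ▸ h'.symm), if_pos hp] at hspec
      rw [h2, arcPerm_apply]
      by_cases hz : M.rot q x = p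
      · right
        rw [if_neg (not_not.2 hz)] at hspec
        refine ⟨.inr (by rw [hz]), ?_⟩
        rw [hz, arcPerm_apply, ← hspec, liftArc_of_adj, hyp]
        rw [hspec, hyp]
        exact M.adj_rot h.1
      · left
        rw [if_pos hz] at hspec
        refine ⟨by simp [hpq.symm], by simp [hz], ?_⟩
        rw [liftArc_of_not_adj_left _ hyp, hspec]
        rw [hspec, hyp]
        exact hnP _ (M.adj_rot h1.symm)
  · left
    rw [if_neg hyp] at hspec
    obtain ⟨x', hlift, hspec⟩ : ∃ x', liftArc M p q (x, y) = (x', y.1) ∧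
        w.1 = if M.rot y x' = q then p else M.rot y x' := by
      rcases h.liftArc_cases hxy with ⟨h1, h2⟩ | ⟨-, h0, h1, -, h2⟩ | ⟨-, h0, -, -, -⟩
      · have hc : ¬ (x.1 = p ∧ M.graph.Adj y q) := by
          rintro ⟨h3, h4⟩
          exact hnP _ h4.symm (h3 ▸ h1)
        simp only [hc, if_false] at hspec
        exact ⟨x, h2, hspec⟩
      · have hc : x.1 = p ∧ M.graph.Adj y q := ⟨h0, h1.symm⟩
        simp only [hc, and_self, if_true] at hspec
        exact ⟨q, h2, hspec⟩
      · exact absurd h0 hyp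
    have hadj := h.adj_liftArc hxy
    rw [hlift] at hadj ⊢
    simp only [arcPerm_apply] at hadj ⊢
    refine ⟨by simp [hyp], by simp [hy], ?_⟩
    have hadj' := M.adj_rot hadj.symm
    by_cases hz : M.rot y x' = q
    · rw [if_pos hz] at hspec
      rw [hz] at hadj' ⊢
      refine liftArc_of_not_adj_right ?_ hyp
      rw [hspec]
      exact fun h' => hnP _ hadj'.symm h'.symm
    · rw [if_neg hz] at hspec
      rw [liftArc_of_adj, hspec]
      rwa [hspec]

theorem sameCycle_liftArc_iff [Finite V] (h : M.IsContraction p q K) (hp : M.rot p q ≠ q)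
    (hq : M.rot q p ≠ p) {x y x' y' : {z : V // z ≠ q}} (hxy : K.graph.Adj x y)
    (hxy' : K.graph.Adj x' y') :
    M.arcPerm.SameCycle (liftArc M p q (x, y)) (liftArc M p q (x', y')) ↔
      K.arcPerm.SameCycle (x, y) (x', y') := by
  constructor
  · intro hs
    obtain ⟨i, -, -, hi⟩ := hs.exists_pow_eq''
    clear hs
    induction i using Nat.strong_induction_on generalizing x y with
    | _ i ih =>
    have hw : K.graph.Adj y (K.rot y x) := K.adj_rot hxy.symm
    have hne := h.liftArc_ne hxy'
    rcases i with - | i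
    · obtain ⟨rfl, rfl⟩ := h.liftArc_injective hxy hxy' hi
      exact .refl _ _
    rcases h.liftArc_rot hp hq hxy with ⟨-, -, h1⟩ | ⟨h0, h1⟩
    · refine Perm.sameCycle_apply_left.1 (ih i (by omega) hw ?_)
      rw [arcPerm_apply] at h1
      rw [h1, ← Perm.mul_apply, ← pow_succ, hi]
    · rcases i with - | i
      · rw [zero_add, pow_one] at hi
        rw [hi] at h0
        exact absurd h0 (by simp [hne])
      · refine Perm.sameCycle_apply_left.1 (ih i (by omega) hw ?_)
        rw [arcPerm_apply] at h1
        rw [h1, ← Perm.mul_apply, ← Perm.mul_apply, ← pow_succ, ← pow_succ, hi]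
  · intro hs
    obtain ⟨i, -, -, hi⟩ := hs.exists_pow_eq''
    clear hs
    induction i generalizing x y with
    | zero =>
      rw [pow_zero, Perm.one_apply] at hi
      rw [hi]
    | succ i ih =>
      have hw : K.graph.Adj y (K.rot y x) := K.adj_rot hxy.symm
      have := ih hw (by rw [← hi, pow_succ, Perm.mul_apply, arcPerm_apply])
      rw [← arcPerm_apply] at this
      rcases h.liftArc_rot hp hq hxy with ⟨-, -, h1⟩ | ⟨-, h1⟩ <;> rw [h1] at this
      · exact Perm.sameCycle_apply_left.1 this
      · exact Perm.sameCycle_apply_left.1 (Perm.sameCycle_apply_left.1 this)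

/-- The arc of `M` that becomes a given arc of the contracted embedding. -/
noncomputable def liftDart (h : M.IsContraction p q K) (d : K.graph.Dart) : M.graph.Dart :=
  ⟨liftArc M p q d.toProd, h.adj_liftArc d.adj⟩

theorem exists_liftDart (h : M.IsContraction p q K) {d : M.graph.Dart} (h1 : d.toProd ≠ (p, q))
    (h2 : d.toProd ≠ (q, p)) : ∃ d', h.liftDart d' = d := by
  obtain ⟨x, y, hxy, he⟩ := h.exists_liftArc d.adj h1 h2
  exact ⟨⟨(x, y), hxy⟩, SimpleGraph.Dart.toProd_injective he⟩

variable [Finite V]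

/-- Contracting an edge does not change the number of faces. As neither end of the edge has degree
1, no face consists of arcs of the contracted edge only. -/
theorem card_face (h : M.IsContraction p q K) (hp : M.rot p q ≠ q) (hq : M.rot q p ≠ p) :
    Nat.card K.Face = Nat.card M.Face := by
  have hiff : ∀ d d', M.facePerm.SameCycle (h.liftDart d) (h.liftDart d') ↔
      K.facePerm.SameCycle d d' := fun d d' => by
    rw [sameCycle_facePerm_iff, sameCycle_facePerm_iff]
    exact h.sameCycle_liftArc_iff hp hq d.adj d'.adj
  let F : K.Face → M.Face := Quotient.map' h.liftDart fun _ _ => (hiff _ _).2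
  refine Nat.card_congr (Equiv.ofBijective F ⟨?_, ?_⟩)
  · intro a b hab
    induction a, b using Quotient.inductionOn₂ with
    | _ a b => exact Quotient.sound ((hiff a b).1 (Quotient.exact hab))
  · intro a
    induction a using Quotient.inductionOn with
    | _ d =>
    have hpq := h.1.ne
    by_cases h1 : d.toProd = (p, q)
    · obtain ⟨d', hd'⟩ := h.exists_liftDart (d := M.facePerm d)
        (by rw [toProd_facePerm, h1]; simp [hpq.symm]) (by rw [toProd_facePerm, h1]; simp [hq])
      refine ⟨Quotient.mk _ d', Quotient.sound ?_⟩
      rw [hd']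
      exact Perm.sameCycle_apply_left.2 (.refl _ _)
    by_cases h2 : d.toProd = (q, p)
    · obtain ⟨d', hd'⟩ := h.exists_liftDart (d := M.facePerm d)
        (by rw [toProd_facePerm, h2]; simp [hp]) (by rw [toProd_facePerm, h2]; simp [hpq])
      refine ⟨Quotient.mk _ d', Quotient.sound ?_⟩
      rw [hd']
      exact Perm.sameCycle_apply_left.2 (.refl _ _)
    · obtain ⟨d', hd'⟩ := h.exists_liftDart h1 h2
      exact ⟨Quotient.mk _ d', Quotient.sound (by rw [hd'])⟩

theorem card_edgeSet (h : M.IsContraction p q K) :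
    Nat.card K.graph.edgeSet + 1 = Nat.card M.graph.edgeSet := by
  have : Finite M.graph.Dart := Finite.of_injective _ SimpleGraph.Dart.toProd_injective
  let d₁ : M.graph.Dart := ⟨(p, q), h.1⟩
  let d₂ : M.graph.Dart := ⟨(q, p), h.1.symm⟩
  have hne : d₁ ≠ d₂ := fun he => h.1.ne (congrArg (fun d : M.graph.Dart => d.fst) he)
  have hinj : Function.Injective h.liftDart := by
    rintro ⟨⟨x, y⟩, hd⟩ ⟨⟨x', y'⟩, hd'⟩ he
    obtain ⟨rfl, rfl⟩ := h.liftArc_injective hd hd' (congrArg SimpleGraph.Dart.toProd he)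
    rfl
  have hrange : Set.range h.liftDart = {d₁, d₂}ᶜ := by
    ext d
    simp only [Set.mem_range, Set.mem_compl_iff, Set.mem_insert_iff, Set.mem_singleton_iff, not_or]
    constructor
    · rintro ⟨d', rfl⟩
      have := h.liftArc_ne d'.adj
      exact ⟨fun he => this.1 (congrArg SimpleGraph.Dart.toProd he),
        fun he => this.2 (congrArg SimpleGraph.Dart.toProd he)⟩
    · rintro ⟨h1, h2⟩
      exact h.exists_liftDart (fun he => h1 (SimpleGraph.Dart.toProd_injective he))
        (fun he => h2 (SimpleGraph.Dart.toProd_injective he))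
  have h1 : Nat.card K.graph.Dart = ({d₁, d₂}ᶜ : Set M.graph.Dart).ncard := by
    rw [← hrange, ← Nat.card_coe_set_eq]
    exact Nat.card_congr (Equiv.ofInjective _ hinj)
  have h2 := Set.ncard_add_ncard_compl ({d₁, d₂} : Set M.graph.Dart)
  rw [Set.ncard_pair hne, ← h1, card_dart, card_dart] at h2
  omega

end IsContraction

end RotationSystem

set_option linter.constructorNameAsVariable false

/-! ### Surgery on finitely many arcs -/

/-- The list `a, f a, f (f a), …` of at most `k + 1` iterates of a partial map, as far as they are
defined. -/
def partialOrbit {A : Type*} (f : A → Option A) : ℕ → A → List A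
  | 0, a => [a]
  | k + 1, a => a :: (match f a with
    | some b => partialOrbit f k b
    | none => [])

theorem sameCycle_of_mem_partialOrbit {A B : Type*} {f : A → Option A} {σ : Perm B} {φ : A → B}
    (hf : ∀ x y, f x = some y → σ (φ x) = φ y) {k : ℕ} {a b : A} (h : b ∈ partialOrbit f k a) :
    σ.SameCycle (φ a) (φ b) := by
  induction k generalizing a with
  | zero =>
    rw [partialOrbit, List.mem_singleton] at h
    exact h ▸ .refl _ _
  | succ k ih =>
    rw [partialOrbit, List.mem_cons] at h
    rcases h with rfl | h
    · exact .refl _ _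
    · cases hfa : f a with
      | none => simp [hfa] at h
      | some c =>
        rw [hfa] at h
        exact Perm.sameCycle_apply_left.1 (hf a c hfa ▸ ih h)

/-- The orbit of `a` under the partial map `f` is closed, and it does not contain `b`. -/
def ClosedOrbitAvoids {A : Type*} (f : A → Option A) (k : ℕ) (a b : A) : Prop :=
  (∀ x ∈ partialOrbit f k a, ∃ y ∈ partialOrbit f k a, f x = some y) ∧ b ∉ partialOrbit f k a

instance {A : Type*} [DecidableEq A] (f : A → Option A) (k : ℕ) (a b : A) :
    Decidable (ClosedOrbitAvoids f k a b) :=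
  inferInstanceAs (Decidable (_ ∧ _))

theorem ClosedOrbitAvoids.not_sameCycle {A B : Type*} [Finite B] {f : A → Option A} {σ : Perm B}
    {φ : A → B} (hφ : Function.Injective φ) (hf : ∀ x y, f x = some y → σ (φ x) = φ y) {k : ℕ}
    {a b : A} (h : ClosedOrbitAvoids f k a b) : ¬ σ.SameCycle (φ a) (φ b) := by
  intro hs
  obtain ⟨i, -, -, hi⟩ := hs.exists_pow_eq''
  have key : ∀ i : ℕ, ∃ c ∈ partialOrbit f k a, (σ ^ i) (φ a) = φ c := by
    intro i
    induction i with
    | zero => exact ⟨a, by cases k <;> simp [partialOrbit], rfl⟩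
    | succ i ih =>
      obtain ⟨c, hc, hi⟩ := ih
      obtain ⟨d, hd, hcd⟩ := h.1 c hc
      exact ⟨d, hd, by rw [pow_succ', Perm.mul_apply, hi, hf c d hcd]⟩
  obtain ⟨c, hc, hi'⟩ := key i
  exact h.2 (hφ (hi'.symm.trans hi) ▸ hc)

namespace Surgery

/-- Names for the vertices near the vertex `o`: the letters, and two vertices `D` and `E`, which
separate `y` from `v` and `x` from `a` in the rotation at `o`. -/
inductive Spot
  | o | a | b | c | u | v | w | x | y | D | E
  deriving DecidableEq

/-- The vertices at which edges may be added. -/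
def Spot.IsLetter (i : Spot) : Prop := i ≠ .o ∧ i ≠ .D ∧ i ≠ .E

instance (i : Spot) : Decidable i.IsLetter := inferInstanceAs (Decidable (_ ∧ _))

/-- What is recorded of an embedding: corners `(x, y, z)`, where `z` follows `x` in the rotation at
`y`, and the edges, in both directions, that were added. -/
structure State where
  corners : List (Spot × Spot × Spot)
  added : List (Spot × Spot)

/-- The element that follows `x` in the rotation at `y`, if it is known. -/
def State.next (S : State) (x y : Spot) : Option Spot :=
  (S.corners.find? fun c => c.1 = x ∧ c.2.1 = y).map fun c => c.2.2

/-- Face tracing. -/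
def State.step (S : State) (d : Spot × Spot) : Option (Spot × Spot) :=
  (S.next d.1 d.2).map fun z => (d.2, z)

/-- The elementary operations: `chord p u q w` and `tube p u q w` add the edge `uw` in the corners
`(p, u)` and `(q, w)` inside a face and on a handle, respectively, and `spin v p₀ p₁ p₂` attaches
a handle that interchanges two blocks of the rotation at `v`. -/
inductive Op
  | chord (p u q w : Spot)
  | tube (p u q w : Spot)
  | spin (v p₀ p₁ p₂ : Spot)

/-- The number of handles that an operation attaches. -/
def Op.handles : Op → ℕ
  | .chord .. => 0
  | _ => 1

/-- Replace the known corners at the given arcs. -/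
def State.update (S : State) (new : List (Spot × Spot × Spot)) : List (Spot × Spot × Spot) :=
  new ++ S.corners.filter fun c => ∀ c' ∈ new, ¬ (c.1 = c'.1 ∧ c.2.1 = c'.2.1)

/-- An edge `uw` may be added: `u` and `w` are different letters, and they are not adjacent, where
`B` contains the pairs of letters that were adjacent at the beginning. -/
def State.CanAdd (B : List (Spot × Spot)) (S : State) (u w : Spot) : Prop :=
  u ≠ w ∧ u.IsLetter ∧ w.IsLetter ∧ (u, w) ∉ B ∧ (u, w) ∉ S.added

instance (B : List (Spot × Spot)) (S : State) (u w : Spot) : Decidable (S.CanAdd B u w) :=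
  inferInstanceAs (Decidable (_ ∧ _))

/-- The state after adding the edge `uw`, where `p'` and `q'` follow `p` and `q`. -/
def State.addEdge (S : State) (p u q w p' q' : Spot) : State :=
  ⟨S.update [(p, u, w), (w, u, p'), (q, w, u), (u, w, q')], (u, w) :: (w, u) :: S.added⟩

/-- The rotation at `v` after its first two blocks have been closed up separately. -/
def State.splitRot (S : State) (v p₀ p₁ : Spot) (x : Spot) : Option Spot :=
  S.next (if x = p₀ then p₁ else if x = p₁ then p₀ else x) v

/-- Perform an operation, if it is certain to be possible. Faces are traced for 12
steps; that two corners lie on different faces is accepted only when the first face has closed up by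
then. -/
def State.exec (B : List (Spot × Spot)) (S : State) : Op → Option State
  | .chord p u q w =>
    match S.next p u, S.next q w with
    | some p', some q' =>
      if S.CanAdd B u w ∧ (q, w) ∈ partialOrbit S.step 12 (p, u)
      then some (S.addEdge p u q w p' q') else none
    | _, _ => none
  | .tube p u q w =>
    match S.next p u, S.next q w with
    | some p', some q' =>
      if S.CanAdd B u w ∧ ClosedOrbitAvoids S.step 12 (p, u) (q, w)
      then some (S.addEdge p u q w p' q') else none
    | _, _ => none
  | .spin v p₀ p₁ p₂ =>
    match S.next p₀ v, S.next p₁ v, S.next p₂ v with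
    | some q₀, some q₁, some q₂ =>
      if (v ≠ .D ∧ v ≠ .E) ∧ (p₀ ≠ p₁ ∧ p₀ ≠ p₂ ∧ p₁ ≠ p₂) ∧
        ClosedOrbitAvoids S.step 12 (p₀, v) (p₁, v) ∧
        ClosedOrbitAvoids S.step 12 (p₀, v) (p₂, v) ∧
        ClosedOrbitAvoids S.step 12 (p₁, v) (p₂, v) ∧
        ClosedOrbitAvoids (S.splitRot v p₀ p₁) 12 p₁ p₂
      then some ⟨S.update [(p₀, v, q₁), (p₁, v, q₂), (p₂, v, q₀)], S.added⟩ else none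
    | _, _, _ => none

/-- Perform a list of operations. -/
def State.run (B : List (Spot × Spot)) : List Op → State → Option State
  | [], S => some S
  | op :: ops, S => (S.exec B op).bind fun S' => State.run B ops S'

/-- The state `S`, with spots named by `φ`, is true of the embedding `M`, which agrees with `M₁`
wherever `S` says nothing. -/
structure Realizes {V : Type*} (φ : Spot → V) (M₁ : RotationSystem V) (S : State)
    (M : RotationSystem V) : Prop where
  adj : ∀ x y z, (x, y, z) ∈ S.corners → M.graph.Adj (φ x) (φ y)
  rot : ∀ x y z, (x, y, z) ∈ S.corners → M.rot (φ y) (φ x) = φ z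
  rot_eq : ∀ X Y, (∀ x y z, (x, y, z) ∈ S.corners → ¬ (X = φ x ∧ Y = φ y)) →
    M.rot Y X = M₁.rot Y X
  rot_eq' : ∀ Y, (∀ i : Spot, i ≠ .D → i ≠ .E → Y ≠ φ i) → M.rot Y = M₁.rot Y
  rot_D : M.rot (φ .D) = M₁.rot (φ .D)
  rot_E : M.rot (φ .E) = M₁.rot (φ .E)
  adj_iff : ∀ X Y, M.graph.Adj X Y ↔
    M₁.graph.Adj X Y ∨ ∃ i j, (i, j) ∈ S.added ∧ X = φ i ∧ Y = φ j

variable {V : Type*} {φ : Spot → V} {M₁ M : RotationSystem V} {S S' : State}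
  {B : List (Spot × Spot)}

theorem State.mem_of_next {x y z : Spot} (h : S.next x y = some z) : (x, y, z) ∈ S.corners := by
  rw [State.next, Option.map_eq_some_iff] at h
  obtain ⟨⟨a, b, c⟩, h, rfl⟩ := h
  have h1 := List.find?_some h
  simp only [Bool.decide_and, Bool.and_eq_true, decide_eq_true_eq] at h1
  obtain ⟨rfl, rfl⟩ := h1
  exact List.mem_of_find?_eq_some h

namespace Realizes

theorem step (h : Realizes φ M₁ S M) (d e : Spot × Spot) (hde : S.step d = some e) :
    M.arcPerm (φ d.1, φ d.2) = (φ e.1, φ e.2) := by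
  rw [State.step, Option.map_eq_some_iff] at hde
  obtain ⟨z, hz, rfl⟩ := hde
  rw [RotationSystem.arcPerm_apply, h.rot _ _ _ (State.mem_of_next hz)]

theorem not_adj (hφ : Function.Injective φ) (h : Realizes φ M₁ S M) {u w : Spot}
    (hB : ∀ i j : Spot, i.IsLetter → j.IsLetter → M₁.graph.Adj (φ i) (φ j) → (i, j) ∈ B)
    (hc : S.CanAdd B u w) : ¬ M.graph.Adj (φ u) (φ w) := by
  rw [h.adj_iff]
  rintro (h' | ⟨i, j, h', hi, hj⟩)
  · exact hc.2.2.2.1 (hB u w hc.2.1 hc.2.2.1 h')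
  · rw [hφ hi, hφ hj] at hc
    exact hc.2.2.2.2 h'

/-- If the known faces are triangles, then the embedding is still triangular. -/
theorem isTriangular (hM₁ : M₁.IsTriangular) (h : Realizes φ M₁ S M)
    (h1 : ∀ c ∈ S.corners, (c.2.1, c.2.2, c.1) ∈ S.corners)
    (h2 : ∀ e ∈ S.added, ∃ c ∈ S.corners, c.1 = e.1 ∧ c.2.1 = e.2) : M.IsTriangular := by
  rw [RotationSystem.isTriangular_iff] at hM₁ ⊢
  intro X Y hXY
  by_cases hk : ∃ x y z, (x, y, z) ∈ S.corners ∧ X = φ x ∧ Y = φ y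
  · obtain ⟨x, y, z, hm, rfl, rfl⟩ := hk
    rw [h.rot _ _ _ hm, h.rot _ _ _ (h1 _ hm)]
  push Not at hk
  have hk' : ∀ x y z, (x, y, z) ∈ S.corners → ¬ (X = φ x ∧ Y = φ y) :=
    fun x y z hm hxy => hk x y z hm hxy.1 hxy.2
  have hadj : M₁.graph.Adj X Y := by
    rcases (h.adj_iff X Y).1 hXY with h' | ⟨i, j, hij, rfl, rfl⟩
    · exact h'
    · obtain ⟨⟨x, y, z⟩, hc, rfl, rfl⟩ := h2 _ hij
      exact absurd rfl (hk _ _ _ hc rfl)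
  have hrot := h.rot_eq X Y hk'
  rw [hrot, h.rot_eq Y _ _, hM₁ X Y hadj]
  rintro x y w hm ⟨hx, hy⟩
  have := h.rot _ _ _ (h1 _ (h1 _ hm))
  simp only at this
  rw [← hx, ← hy, ← hrot] at this
  exact hk _ _ _ (h1 _ (h1 _ hm)) ((M.rot Y).injective this).symm hx

variable [DecidableEq V]

theorem addEdge (hφ : Function.Injective φ) (h : Realizes φ M₁ S M) {p u q w p' q' : Spot}
    (hp : S.next p u = some p') (hq : S.next q w = some q') (hc : S.CanAdd B u w)
    {N : RotationSystem V} (hN : M.AddEdge N (φ p) (φ u) (φ q) (φ w)) :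
    Realizes φ M₁ (S.addEdge p u q w p' q') N := by
  have hp' := h.rot _ _ _ (State.mem_of_next hp)
  have hq' := h.rot _ _ _ (State.mem_of_next hq)
  have hpu := h.adj _ _ _ (State.mem_of_next hp)
  have hqw := h.adj _ _ _ (State.mem_of_next hq)
  have hrot := hN.rot_eq
  have hadj : ∀ X Y, N.graph.Adj X Y ↔ _ := fun X Y => hN.adj_iff
  obtain ⟨huw, hu, hw, -, -⟩ := hc
  have hnuw : p ≠ w := by
    rintro rfl; exact hN.2.1 hpu.symm
  have hnwu : q ≠ u := by
    rintro rfl; exact hN.2.1 hqw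
  have hmem : ∀ c, c ∈ (S.addEdge p u q w p' q').corners ↔
      c ∈ [(p, u, w), (w, u, p'), (q, w, u), (u, w, q')] ∨ (c ∈ S.corners ∧
      ∀ c' ∈ [(p, u, w), (w, u, p'), (q, w, u), (u, w, q')], ¬ (c.1 = c'.1 ∧ c.2.1 = c'.2.1)) := by
    intro c
    simp only [State.addEdge, State.update, List.mem_append, List.mem_filter, decide_eq_true_eq]
  refine ⟨?_, ?_, ?_, ?_, ?_, ?_, ?_⟩
  · intro x y z hxyz
    rw [hadj]
    rw [hmem] at hxyz
    rcases hxyz with hxyz | ⟨hxyz, -⟩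
    · simp only [List.mem_cons, Prod.mk.injEq, List.not_mem_nil, or_false] at hxyz
      rcases hxyz with ⟨rfl, rfl, rfl⟩ | ⟨rfl, rfl, rfl⟩ | ⟨rfl, rfl, rfl⟩ | ⟨rfl, rfl, rfl⟩
      · exact .inl hpu
      · exact .inr (.inr ⟨rfl, rfl⟩)
      · exact .inl hqw
      · exact .inr (.inl ⟨rfl, rfl⟩)
    · exact .inl (h.adj _ _ _ hxyz)
  · intro x y z hxyz
    rw [hrot]
    simp only [Prod.mk.injEq, hφ.eq_iff]
    rw [hmem] at hxyz
    rcases hxyz with hxyz | ⟨hxyz, hne⟩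
    · simp only [List.mem_cons, Prod.mk.injEq, List.not_mem_nil, or_false] at hxyz
      rcases hxyz with ⟨rfl, rfl, rfl⟩ | ⟨rfl, rfl, rfl⟩ | ⟨rfl, rfl, rfl⟩ | ⟨rfl, rfl, rfl⟩
      · simp
      · rw [if_neg (by rintro ⟨rfl, -⟩; exact hnuw rfl), if_pos ⟨rfl, rfl⟩, hp']
      · rw [if_neg (fun h => huw h.2.symm), if_neg (fun h => huw h.2.symm), if_pos ⟨rfl, rfl⟩]
      · rw [if_neg (fun h => huw h.2.symm), if_neg (fun h => huw h.2.symm),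
          if_neg (fun h => hnwu h.1.symm), if_pos ⟨rfl, rfl⟩, hq']
    · simp only [List.mem_cons, List.not_mem_nil, or_false, forall_eq_or_imp, forall_eq] at hne
      rw [if_neg hne.1, if_neg hne.2.1, if_neg hne.2.2.1, if_neg hne.2.2.2, h.rot _ _ _ hxyz]
  · intro X Y hXY
    rw [hrot]
    simp only [Prod.mk.injEq]
    have hXY' := fun x y z hxyz => hXY x y z ((hmem _).2 hxyz)
    simp only [List.mem_cons, Prod.mk.injEq, List.not_mem_nil, or_false, forall_eq_or_imp,
      forall_eq] at hXY'
    have h1 := hXY' p u w (.inl (.inl ⟨rfl, rfl, rfl⟩))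
    have h2 := hXY' w u p' (.inl (.inr (.inl ⟨rfl, rfl, rfl⟩)))
    have h3 := hXY' q w u (.inl (.inr (.inr (.inl ⟨rfl, rfl, rfl⟩))))
    have h4 := hXY' u w q' (.inl (.inr (.inr (.inr ⟨rfl, rfl, rfl⟩))))
    rw [if_neg h1, if_neg h2, if_neg h3, if_neg h4]
    refine h.rot_eq X Y fun x y z hxyz hk => ?_
    obtain ⟨rfl, rfl⟩ := hk
    simp only [hφ.eq_iff] at h1 h2 h3 h4
    exact hXY' x y z (.inr ⟨hxyz, h1, h2, h3, h4⟩) ⟨rfl, rfl⟩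
  · intro Y hY
    rw [hN.2.2.2.2.2.2.2 Y (hY u hu.2.1 hu.2.2) (hY w hw.2.1 hw.2.2), h.rot_eq' Y hY]
  · rw [hN.2.2.2.2.2.2.2 _ (fun h => hu.2.1 (hφ h).symm) (fun h => hw.2.1 (hφ h).symm), h.rot_D]
  · rw [hN.2.2.2.2.2.2.2 _ (fun h => hu.2.2 (hφ h).symm) (fun h => hw.2.2 (hφ h).symm), h.rot_E]
  · intro X Y
    rw [hadj, h.adj_iff]
    simp only [State.addEdge, List.mem_cons, Prod.mk.injEq]
    constructor
    · rintro ((h | ⟨i, j, h, h'⟩) | ⟨h, h'⟩ | ⟨h, h'⟩)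
      · exact .inl h
      · exact .inr ⟨i, j, .inr (.inr h), h'⟩
      · exact .inr ⟨u, w, .inl ⟨rfl, rfl⟩, h, h'⟩
      · exact .inr ⟨w, u, .inr (.inl ⟨rfl, rfl⟩), h, h'⟩
    · rintro (h | ⟨i, j, ⟨rfl, rfl⟩ | ⟨rfl, rfl⟩ | h, h'⟩)
      · exact .inl (.inl h)
      · exact .inr (.inl h')
      · exact .inr (.inr h')
      · exact .inl (.inr ⟨i, j, h, h'⟩)

theorem spin (hφ : Function.Injective φ) (h : Realizes φ M₁ S M) {v p₀ p₁ p₂ q₀ q₁ q₂ : Spot}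
    (h0 : S.next p₀ v = some q₀) (h1 : S.next p₁ v = some q₁) (h2 : S.next p₂ v = some q₂)
    (hv : v ≠ .D ∧ v ≠ .E) (hp : p₀ ≠ p₁ ∧ p₀ ≠ p₂ ∧ p₁ ≠ p₂) {N : RotationSystem V}
    (hG : N.graph = M.graph) (hN : ∀ z, z ≠ φ v → N.rot z = M.rot z)
    (hNv : N.rot (φ v) = M.rot (φ v) * (swap (φ p₀) (φ p₁) * swap (φ p₁) (φ p₂))) :
    Realizes φ M₁ ⟨S.update [(p₀, v, q₁), (p₁, v, q₂), (p₂, v, q₀)], S.added⟩ N := by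
  have r0 := h.rot _ _ _ (State.mem_of_next h0)
  have r1 := h.rot _ _ _ (State.mem_of_next h1)
  have r2 := h.rot _ _ _ (State.mem_of_next h2)
  have hp' : φ p₀ ≠ φ p₁ ∧ φ p₀ ≠ φ p₂ ∧ φ p₁ ≠ φ p₂ := by simpa [hφ.ne_iff] using hp
  have n0 : N.rot (φ v) (φ p₀) = φ q₁ := by
    rw [hNv, Perm.mul_apply, Perm.mul_apply, swap_apply_of_ne_of_ne hp'.1 hp'.2.1,
      swap_apply_left, r1]
  have n1 : N.rot (φ v) (φ p₁) = φ q₂ := by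
    rw [hNv, Perm.mul_apply, Perm.mul_apply, swap_apply_left,
      swap_apply_of_ne_of_ne hp'.2.1.symm hp'.2.2.symm, r2]
  have n2 : N.rot (φ v) (φ p₂) = φ q₀ := by
    rw [hNv, Perm.mul_apply, Perm.mul_apply, swap_apply_right, swap_apply_right, r0]
  have nne : ∀ X Y, ¬ (X = φ p₀ ∧ Y = φ v) → ¬ (X = φ p₁ ∧ Y = φ v) → ¬ (X = φ p₂ ∧ Y = φ v) →
      N.rot Y X = M.rot Y X := by
    intro X Y k0 k1 k2
    by_cases hY : Y = φ v
    · subst hY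
      simp only [and_true] at k0 k1 k2
      rw [hNv, Perm.mul_apply, Perm.mul_apply, swap_apply_of_ne_of_ne k1 k2,
        swap_apply_of_ne_of_ne k0 k1]
    · rw [hN Y hY]
  have hmem : ∀ c, c ∈ S.update [(p₀, v, q₁), (p₁, v, q₂), (p₂, v, q₀)] ↔
      c ∈ [(p₀, v, q₁), (p₁, v, q₂), (p₂, v, q₀)] ∨ (c ∈ S.corners ∧
      ∀ c' ∈ [(p₀, v, q₁), (p₁, v, q₂), (p₂, v, q₀)], ¬ (c.1 = c'.1 ∧ c.2.1 = c'.2.1)) := by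
    intro c
    simp only [State.update, List.mem_append, List.mem_filter, decide_eq_true_eq]
  refine ⟨?_, ?_, ?_, ?_, ?_, ?_, ?_⟩
  · intro x y z hxyz
    rw [hG]
    replace hxyz := (hmem _).1 hxyz
    rcases hxyz with hxyz | ⟨hxyz, -⟩
    · simp only [List.mem_cons, Prod.mk.injEq, List.not_mem_nil, or_false] at hxyz
      rcases hxyz with ⟨rfl, rfl, rfl⟩ | ⟨rfl, rfl, rfl⟩ | ⟨rfl, rfl, rfl⟩
      · exact h.adj _ _ _ (State.mem_of_next h0)
      · exact h.adj _ _ _ (State.mem_of_next h1)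
      · exact h.adj _ _ _ (State.mem_of_next h2)
    · exact h.adj _ _ _ hxyz
  · intro x y z hxyz
    replace hxyz := (hmem _).1 hxyz
    rcases hxyz with hxyz | ⟨hxyz, hne⟩
    · simp only [List.mem_cons, Prod.mk.injEq, List.not_mem_nil, or_false] at hxyz
      rcases hxyz with ⟨rfl, rfl, rfl⟩ | ⟨rfl, rfl, rfl⟩ | ⟨rfl, rfl, rfl⟩
      · exact n0
      · exact n1
      · exact n2
    · simp only [List.mem_cons, List.not_mem_nil, or_false, forall_eq_or_imp, forall_eq] at hne
      rw [nne, h.rot _ _ _ hxyz] <;> simp only [hφ.eq_iff]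
      exacts [hne.1, hne.2.1, hne.2.2]
  · intro X Y hXY
    have hXY' := fun x y z hxyz => hXY x y z ((hmem _).2 hxyz)
    simp only [List.mem_cons, Prod.mk.injEq, List.not_mem_nil, or_false, forall_eq_or_imp,
      forall_eq] at hXY'
    have k0 := hXY' p₀ v q₁ (.inl (.inl ⟨rfl, rfl, rfl⟩))
    have k1 := hXY' p₁ v q₂ (.inl (.inr (.inl ⟨rfl, rfl, rfl⟩)))
    have k2 := hXY' p₂ v q₀ (.inl (.inr (.inr ⟨rfl, rfl, rfl⟩)))
    rw [nne X Y k0 k1 k2]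
    refine h.rot_eq X Y fun x y z hxyz hk => ?_
    obtain ⟨rfl, rfl⟩ := hk
    simp only [hφ.eq_iff] at k0 k1 k2
    exact hXY' x y z (.inr ⟨hxyz, k0, k1, k2⟩) ⟨rfl, rfl⟩
  · intro Y hY
    rw [hN Y (hY v hv.1 hv.2), h.rot_eq' Y hY]
  · rw [hN _ (fun h => hv.1 (hφ h).symm), h.rot_D]
  · rw [hN _ (fun h => hv.2 (hφ h).symm), h.rot_E]
  · intro X Y
    rw [hG, h.adj_iff]

variable [Finite V]

theorem exec (hφ : Function.Injective φ)
    (hB : ∀ i j : Spot, i.IsLetter → j.IsLetter → M₁.graph.Adj (φ i) (φ j) → (i, j) ∈ B)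
    (h : Realizes φ M₁ S M) {op : Op} (hop : S.exec B op = some S') {k : ℕ}
    (hk : RotationSystem.HandleSteps k M₁ M) :
    ∃ N, RotationSystem.HandleSteps (k + op.handles) M₁ N ∧ Realizes φ M₁ S' N := by
  have hφ2 : Function.Injective fun d : Spot × Spot => (φ d.1, φ d.2) := by
    rintro ⟨a, b⟩ ⟨c, d⟩ hab
    simpa [hφ.eq_iff] using hab
  have hne : ∀ u w : Spot, u ≠ w → φ u ≠ φ w := fun u w => hφ.ne
  cases op with
  | chord p u q w =>
    simp only [State.exec] at hop
    split at hop
    · rename_i p' q' hp hq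
      split_ifs at hop with hc
      rw [Option.some.injEq] at hop
      subst hop
      have hpu := h.adj _ _ _ (State.mem_of_next hp)
      have hqw := h.adj _ _ _ (State.mem_of_next hq)
      obtain ⟨N, hN⟩ :=
        RotationSystem.exists_addEdge (hne _ _ hc.1.1) (h.not_adj hφ hB hc.1) hpu hqw
      refine ⟨N, hk.inFace (φ u) (φ w) ⟨φ p, φ q, M.sameFace_iff.2 ⟨hpu, hqw, ?_⟩, hN⟩,
        h.addEdge hφ hp hq hc.1 hN⟩
      exact sameCycle_of_mem_partialOrbit (φ := fun d : Spot × Spot => (φ d.1, φ d.2)) h.step hc.2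
    · exact absurd hop (by simp)
  | tube p u q w =>
    simp only [State.exec] at hop
    split at hop
    · rename_i p' q' hp hq
      split_ifs at hop with hc
      rw [Option.some.injEq] at hop
      subst hop
      have hpu := h.adj _ _ _ (State.mem_of_next hp)
      have hqw := h.adj _ _ _ (State.mem_of_next hq)
      obtain ⟨N, hN⟩ :=
        RotationSystem.exists_addEdge (hne _ _ hc.1.1) (h.not_adj hφ hB hc.1) hpu hqw
      refine ⟨N, hk.onHandle (φ u) (φ w) ⟨φ p, φ q, fun hs => ?_, hN⟩, h.addEdge hφ hp hq hc.1 hN⟩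
      exact hc.2.not_sameCycle hφ2 h.step (M.sameFace_iff.1 hs).2.2
    · exact absurd hop (by simp)
  | spin v p₀ p₁ p₂ =>
    simp only [State.exec] at hop
    split at hop
    · rename_i q₀ q₁ q₂ h0 h1 h2
      split_ifs at hop with hc
      rw [Option.some.injEq] at hop
      subst hop
      obtain ⟨hv, hp, c01, c02, c12, cr⟩ := hc
      have a0 := h.adj _ _ _ (State.mem_of_next h0)
      have a1 := h.adj _ _ _ (State.mem_of_next h1)
      have a2 := h.adj _ _ _ (State.mem_of_next h2)
      have n01 := c01.not_sameCycle hφ2 h.step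
      have n02 := c02.not_sameCycle hφ2 h.step
      have n12 := c12.not_sameCycle hφ2 h.step
      have hns := cr.not_sameCycle (σ := M.rot (φ v) * swap (φ p₀) (φ p₁)) hφ fun x y hxy => by
        rw [← h.rot _ _ _ (State.mem_of_next hxy), Perm.mul_apply, swap_apply_def]
        simp only [hφ.eq_iff, apply_ite φ]
      obtain ⟨N, hG, hN, hNv⟩ := RotationSystem.exists_vertexHandle a0 a1 a2 hns
      refine ⟨N, hk.atVertex (φ v) ⟨hG, hN, .inl ⟨![φ p₀, φ p₁, φ p₂], ?_, ?_, hNv⟩⟩,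
        h.spin hφ h0 h1 h2 hv hp hG hN hNv⟩
      · intro i
        fin_cases i
        exacts [a0, a1, a2]
      · intro i j hij hs
        have hs := (M.sameFace_iff.1 hs).2.2
        fin_cases i <;> fin_cases j
        exacts [hij rfl, n01 hs, n02 hs, n01 hs.symm, hij rfl, n12 hs, n02 hs.symm, n12 hs.symm,
          hij rfl]
    · exact absurd hop (by simp)

theorem run (hφ : Function.Injective φ)
    (hB : ∀ i j : Spot, i.IsLetter → j.IsLetter → M₁.graph.Adj (φ i) (φ j) → (i, j) ∈ B)
    (h : Realizes φ M₁ S M) {ops : List Op} (hops : S.run B ops = some S') {k : ℕ}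
    (hk : RotationSystem.HandleSteps k M₁ M) :
    ∃ N, RotationSystem.HandleSteps (k + (ops.map Op.handles).sum) M₁ N ∧ Realizes φ M₁ S' N := by
  induction ops generalizing S M k with
  | nil =>
    simp only [State.run, Option.some.injEq] at hops
    subst hops
    exact ⟨M, hk, h⟩
  | cons op ops ih =>
    simp only [State.run, Option.bind_eq_some_iff] at hops
    obtain ⟨S'', h1, h2⟩ := hops
    obtain ⟨N, hN, hN'⟩ := h.exec hφ hB h1 hk
    obtain ⟨P, hP, hP'⟩ := ih hN' h2 hN
    refine ⟨P, ?_, hP'⟩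
    rwa [List.map_cons, List.sum_cons, ← add_assoc]

end Realizes

/-- The triangles at `o` between letters, and those that lie between them. -/
def initial : State where
  corners := [(.u, .o, .y), (.y, .o, .D), (.D, .o, .v), (.v, .o, .c), (.b, .o, .x), (.x, .o, .E),
    (.E, .o, .a), (.a, .o, .w)].flatMap fun t =>
      [(t.1, t.2.1, t.2.2), (t.2.1, t.2.2, t.1), (t.2.2, t.1, t.2.1)]
  added := []

/-- The pairs of letters that are adjacent after the edge flips. -/
def initialPairs : List (Spot × Spot) :=
  [(.u, .y), (.y, .u), (.v, .c), (.c, .v), (.b, .x), (.x, .b), (.a, .w), (.w, .a)]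

/-- Each of four handles adds six edges: three of them merge three triangles at a vertex into a
nonagon, in which the ears at that vertex are cut off and the remaining hexagon is triangulated;
the last one joins two disjoint triangles. -/
def script : List Op :=
  [.spin .o .u .v .b, .chord .y .u .o .c, .chord .c .v .o .x, .chord .x .b .o .y,
    .chord .v .x .b .y, .chord .c .v .x .y, .chord .u .c .v .y, .spin .o .v .a .u,
    .chord .x .v .o .w, .chord .w .a .o .c, .chord .c .u .o .x, .chord .w .a .c .u,
    .chord .w .a .u .x, .chord .a .x .v .w, .spin .x .u .w .y, .chord .a .u .x .v,
    .chord .v .w .x .b, .chord .b .y .x .a, .chord .u .v .w .b, .chord .v .b .y .a,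
    .chord .u .v .b .a, .tube .y .u .x .b, .chord .y .u .b .w, .chord .c .y .u .w,
    .chord .u .c .y .w, .chord .u .c .w .x, .chord .u .c .x .b]

/-- The state after the surgery. -/
def final : State := (initial.run initialPairs script).getD initial

theorem run_script : initial.run initialPairs script = some final := by
  have h : (initial.run initialPairs script).isSome = true := by decide +kernel
  obtain ⟨S, hS⟩ := Option.isSome_iff_exists.1 h
  rw [final, hS, Option.getD_some]

theorem handles_script : (script.map Op.handles).sum = 4 := by decide

theorem final_triangles : ∀ c ∈ final.corners, (c.2.1, c.2.2, c.1) ∈ final.corners := by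
  decide +kernel

theorem final_corners : ∀ e ∈ final.added, ∃ c ∈ final.corners, c.1 = e.1 ∧ c.2.1 = e.2 := by
  decide +kernel

/-- The end points of the edge that an operation adds, in both orders. -/
def Op.edges : Op → List (Spot × Spot)
  | .chord _ u _ w => [(u, w), (w, u)]
  | .tube _ u _ w => [(u, w), (w, u)]
  | .spin .. => []

theorem final_added : final.added = script.reverse.flatMap Op.edges := by
  decide +kernel

theorem mem_final_added_iff (i j : Spot) : (i, j) ∈ final.added ∨ (i, j) ∈ initialPairs ↔
    i.IsLetter ∧ j.IsLetter ∧ i ≠ j := by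
  have key : ∀ i ∈ [Spot.o, .a, .b, .c, .u, .v, .w, .x, .y, .D, .E],
      ∀ j ∈ [Spot.o, .a, .b, .c, .u, .v, .w, .x, .y, .D, .E],
      ((i, j) ∈ script.reverse.flatMap Op.edges ∨ (i, j) ∈ initialPairs ↔
        i.IsLetter ∧ j.IsLetter ∧ i ≠ j) := by
    decide +kernel
  rw [final_added]
  exact key i (by cases i <;> simp) j (by cases j <;> simp)

end Surgery

/-! ### Handles that add edges between numbered vertices -/

namespace RotationSystem

variable {V : Type*} {M N : RotationSystem V}

theorem sameCycle_arcPerm {x y z : V} (h : M.rot y x = z) : M.arcPerm.SameCycle (x, y) (y, z) := by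
  subst h
  exact Perm.sameCycle_apply_right.2 (Perm.SameCycle.refl M.arcPerm (x, y))

theorem AddEdge.card_edgeSet [Finite V] [DecidableEq V] {p u q w : V} (h : M.AddEdge N p u q w) :
    Nat.card N.graph.edgeSet = Nat.card M.graph.edgeSet + 1 := by
  classical
  have := Fintype.ofFinite V
  rw [h.2.2.2.2.1, Nat.card_eq_fintype_card, Nat.card_eq_fintype_card,
    ← SimpleGraph.edgeFinset_card, ← SimpleGraph.edgeFinset_card,
    SimpleGraph.card_edgeFinset_sup_edge _ h.2.1 h.1]

/-- In a triangular embedding, different arcs into a vertex belong to different faces. -/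
theorem IsTriangular.not_sameCycle (hM : M.IsTriangular) {x y v : V} (hx : M.graph.Adj x v)
    (hxy : x ≠ y) : ¬ M.arcPerm.SameCycle (x, v) (y, v) := by
  intro hs
  have hne := (M.adj_rot hx.symm).ne
  rcases (hM x v hx).sameCycle hs with h | h | h <;> grind [SimpleGraph.Adj.ne]

/-- A vertex is on a face if an arc from it is. -/
theorem onCommonFace_of_sameCycle {S : Set V} {x y : V} (hxy : M.graph.Adj x y)
    (h : ∀ z ∈ S, ∃ w, M.arcPerm.SameCycle (x, y) (z, w)) : M.OnCommonFace S := by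
  refine ⟨⟨(x, y), hxy⟩, fun z hz => ?_⟩
  obtain ⟨w, hw⟩ := h z hz
  exact ⟨⟨(z, w), M.adj_of_sameCycle hw hxy⟩, M.sameCycle_facePerm_iff.2 hw, rfl⟩

variable [DecidableEq V] [Finite V]

/-- In a triangular embedding a handle at `v` may interchange any two blocks of the rotation. -/
theorem vertexHandle_of_isTriangular (hM : M.IsTriangular) {v p₀ p₁ p₂ : V}
    (h₀ : M.graph.Adj p₀ v) (h₁ : M.graph.Adj p₁ v) (h₂ : M.graph.Adj p₂ v)
    (h01 : p₀ ≠ p₁) (h02 : p₀ ≠ p₂) (h12 : p₁ ≠ p₂)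
    (hns : ¬ (M.rot v * swap p₀ p₁).SameCycle p₁ p₂) :
    ∃ N, M.VertexHandle N v ∧ N.arcPerm.cycleCount + 2 = M.arcPerm.cycleCount ∧
      N.graph = M.graph ∧ (∀ z, z ≠ v → N.rot z = M.rot z) ∧ N.rot v p₀ = M.rot v p₁ ∧
      N.rot v p₁ = M.rot v p₂ ∧ N.rot v p₂ = M.rot v p₀ := by
  obtain ⟨N, hG, hN, hv⟩ := exists_vertexHandle h₀ h₁ h₂ hns
  refine ⟨N, ⟨hG, hN, .inl ⟨![p₀, p₁, p₂], ?_, ?_, hv⟩⟩,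
    cycleCount_of_vertexHandle hN hv (hM.not_sameCycle h₀ h01) (hM.not_sameCycle h₀ h02)
      (hM.not_sameCycle h₁ h12), hG, hN, ?_, ?_, ?_⟩
  · intro i
    fin_cases i <;> simpa
  · intro i j hij hs
    rw [sameFace_iff] at hs
    refine hM.not_sameCycle hs.1 ?_ hs.2.2
    fin_cases i <;> fin_cases j <;> simp_all [eq_comm]
  all_goals
    rw [hv, Perm.mul_apply, Perm.mul_apply]
    simp [swap_apply_of_ne_of_ne, h01, h02, h12.symm, h02.symm]

theorem addEdgeInFace_of_sameCycle {p u q w : V} (huw : u ≠ w) (hadj : ¬ M.graph.Adj u w)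
    (hpu : M.graph.Adj p u) (hqw : M.graph.Adj q w) (hs : M.arcPerm.SameCycle (p, u) (q, w)) :
    ∃ N, M.AddEdgeInFace N u w ∧ M.AddEdge N p u q w ∧
      N.arcPerm.cycleCount = M.arcPerm.cycleCount := by
  obtain ⟨N, hN⟩ := exists_addEdge huw hadj hpu hqw
  have hf := M.sameFace_iff.2 ⟨hpu, hqw, hs⟩
  exact ⟨N, ⟨p, q, hf, hN⟩, hN, hN.cycleCount_of_sameFace hf⟩

set_option maxHeartbeats 1000000 in
/-- Let `[z, m, d]` be a triangle of a triangular embedding and let `o`, `g` be further neighbours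
of `z`. A handle at `z` merges the faces entering `z` from `d`, `o` and `g` into one, which leaves
room for the edges from `o` to `d`, `g` and `m`. The blocks at `z` can be interchanged for either
cyclic order of `d`, `o`, `g`. -/
theorem exists_handle_and_three_edges (hM : M.IsTriangular) {o d g m z : V}
    (hT : M.IsTriangle z m d) (ho : M.graph.Adj o z) (hg : M.graph.Adj g z) (hod : o ≠ d)
    (hog : o ≠ g) (hom : o ≠ m) (hdg : d ≠ g) (hgm : g ≠ m) (hnd : ¬ M.graph.Adj o d)
    (hng : ¬ M.graph.Adj o g) (hnm : ¬ M.graph.Adj o m) :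
    ∃ H₁ H₂ H₃ N : RotationSystem V, M.VertexHandle H₁ z ∧ H₁.OnCommonFace {o, d, g, m} ∧
      H₁.AddEdgeInFace H₂ o d ∧ H₂.AddEdgeInFace H₃ o g ∧ H₃.AddEdgeInFace N o m ∧
      N.arcPerm.cycleCount + 2 = M.arcPerm.cycleCount ∧
      Nat.card N.graph.edgeSet = Nat.card M.graph.edgeSet + 3 ∧
      (∀ x y, N.graph.Adj x y ↔ M.graph.Adj x y ∨ x = o ∧ (y = d ∨ y = g ∨ y = m) ∨
        y = o ∧ (x = d ∨ x = g ∨ x = m)) ∧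
      ∀ y, y ≠ z → y ≠ o → y ≠ d → y ≠ g → y ≠ m → N.rot y = M.rot y := by
  obtain ⟨hzm, hmd, hdz, hzd⟩ := id hT
  have hmd' := hT.rotate.1
  have hdz' := hT.rotate.rotate.1
  -- The triangles `[o, z, α]` and `[g, z, β]`.
  obtain ⟨α, hα⟩ : ∃ α, M.rot z o = α := ⟨_, rfl⟩
  obtain ⟨β, hβ⟩ : ∃ β, M.rot z g = β := ⟨_, rfl⟩
  obtain ⟨-, -, hαo, hoα⟩ := id (hM.isTriangle ho hα)
  obtain ⟨-, -, hβg, hgβ⟩ := id (hM.isTriangle hg hβ)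
  have hzα := (hM.isTriangle ho hα).rotate.1
  have hzβ := (hM.isTriangle hg hβ).rotate.1
  have hαo' := (hM.isTriangle ho hα).rotate.rotate.1
  have hβg' := (hM.isTriangle hg hβ).rotate.rotate.1
  have h1 := hzm.ne
  have h2 := hmd'.ne
  have h3 := hdz'.ne
  have h4 := ho.ne
  have h5 := hg.ne
  have h6 := hzα.ne
  have h7 := hzβ.ne
  have h8 := hαo'.ne
  have h9 := hβg'.ne
  have hβo : β ≠ o := by rintro rfl; exact hng hβg'
  have hαd : α ≠ d := by rintro rfl; exact hnd hαo'.symm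
  have hαg : α ≠ g := by rintro rfl; exact hng hαo'.symm
  have hαm : α ≠ m := by rintro rfl; exact hnm hαo'.symm
  rcases (M.isCycleOn z).not_sameCycle_or (p₂ := g) hdz'.symm ho.symm hod.symm hog with hns | hns
  · obtain ⟨H₁, hH₁, c₁, hG, hr, r₀, r₁, r₂⟩ :=
      vertexHandle_of_isTriangular hM hdz' ho hg hod.symm hdg hog hns
    -- The merged face is `d z α o z β g z m`, where `d`, `z`, `m` is what is left of the triangle.
    rw [hα] at r₀
    rw [hβ] at r₁
    rw [hzd] at r₂
    have a1 := sameCycle_arcPerm r₀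
    have a2 := a1.trans (sameCycle_arcPerm (z := o) (by rw [hr α h6.symm, hαo]))
    have a3 := a2.trans (sameCycle_arcPerm (z := z) (by rw [hr o h4, hoα]))
    have a4 := a3.trans (sameCycle_arcPerm r₁)
    have a5 := a4.trans (sameCycle_arcPerm (z := g) (by rw [hr β h7.symm, hβg]))
    have a6 := a5.trans (sameCycle_arcPerm (z := z) (by rw [hr g h5, hgβ]))
    have a7 := a6.trans (sameCycle_arcPerm r₂)
    have a8 := a7.trans (sameCycle_arcPerm (z := d) (by rw [hr m h1.symm, hmd]))
    obtain ⟨H₂, f₂, e₂, c₂⟩ := addEdgeInFace_of_sameCycle (M := H₁) hod (by rwa [hG])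
      (by rwa [hG]) (by rwa [hG]) (a2.symm.trans a8)
    have b1 := sameCycle_arcPerm (M := H₂) (x := d) (y := o) (z := z) (by grind [e₂.rot_eq])
    have b2 := b1.trans (sameCycle_arcPerm (z := β) (by grind [e₂.rot_eq]))
    have b3 := b2.trans (sameCycle_arcPerm (z := g) (by grind [e₂.rot_eq]))
    obtain ⟨H₃, f₃, e₃, c₃⟩ := addEdgeInFace_of_sameCycle (M := H₂) hog (by grind [e₂.adj_iff])
      (by grind [e₂.adj_iff]) (by grind [e₂.adj_iff]) b3
    have d1 := sameCycle_arcPerm (M := H₃) (x := d) (y := o) (z := g)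
      (by grind [e₃.rot_eq])
    have d2 := d1.trans (sameCycle_arcPerm (z := z) (by grind [e₂.rot_eq, e₃.rot_eq]))
    have d3 := d2.trans (sameCycle_arcPerm (z := m) (by grind [e₂.rot_eq, e₃.rot_eq]))
    obtain ⟨N, f₄, e₄, c₄⟩ := addEdgeInFace_of_sameCycle (M := H₃) hom
      (by grind [e₂.adj_iff, e₃.adj_iff]) (by grind [e₂.adj_iff, e₃.adj_iff])
      (by grind [e₂.adj_iff, e₃.adj_iff]) d3
    refine ⟨H₁, H₂, H₃, N, hH₁, ?_, f₂, f₃, f₄, by omega, ?_, ?_, ?_⟩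
    · refine onCommonFace_of_sameCycle (x := d) (y := z) (by rwa [hG]) ?_
      rintro y (rfl | rfl | rfl | rfl)
      exacts [⟨_, a3⟩, ⟨_, .refl _ _⟩, ⟨_, a6⟩, ⟨_, a8⟩]
    · rw [e₄.card_edgeSet, e₃.card_edgeSet, e₂.card_edgeSet, hG]
    · intro x y
      rw [e₄.adj_iff, e₃.adj_iff, e₂.adj_iff, hG]
      tauto
    · intro y g1 g2 g3 g4 g5
      rw [e₄.2.2.2.2.2.2.2 y g2 g5, e₃.2.2.2.2.2.2.2 y g2 g4, e₂.2.2.2.2.2.2.2 y g2 g3, hr y g1]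
  · obtain ⟨H₁, hH₁, c₁, hG, hr, r₀, r₁, r₂⟩ :=
      vertexHandle_of_isTriangular hM hdz' hg ho hdg hod.symm hog.symm hns
    -- The merged face is `d z β g z α o z m`.
    rw [hβ] at r₀
    rw [hα] at r₁
    rw [hzd] at r₂
    have a1 := sameCycle_arcPerm r₀
    have a2 := a1.trans (sameCycle_arcPerm (z := g) (by rw [hr β h7.symm, hβg]))
    have a3 := a2.trans (sameCycle_arcPerm (z := z) (by rw [hr g h5, hgβ]))
    have a4 := a3.trans (sameCycle_arcPerm r₁)
    have a5 := a4.trans (sameCycle_arcPerm (z := o) (by rw [hr α h6.symm, hαo]))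
    have a6 := a5.trans (sameCycle_arcPerm (z := z) (by rw [hr o h4, hoα]))
    have a7 := a6.trans (sameCycle_arcPerm r₂)
    have a8 := a7.trans (sameCycle_arcPerm (z := d) (by rw [hr m h1.symm, hmd]))
    obtain ⟨H₂, f₂, e₂, c₂⟩ := addEdgeInFace_of_sameCycle (M := H₁) hod (by rwa [hG])
      (by rwa [hG]) (by rwa [hG]) (a5.symm.trans a8)
    have b1 := sameCycle_arcPerm (M := H₂) (x := α) (y := o) (z := d) (by grind [e₂.rot_eq])
    have b2 := b1.trans (sameCycle_arcPerm (z := z) (by grind [e₂.rot_eq]))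
    have b3 := b2.trans (sameCycle_arcPerm (z := β) (by grind [e₂.rot_eq]))
    have b4 := b3.trans (sameCycle_arcPerm (z := g) (by grind [e₂.rot_eq]))
    obtain ⟨H₃, f₃, e₃, c₃⟩ := addEdgeInFace_of_sameCycle (M := H₂) hog (by grind [e₂.adj_iff])
      (by grind [e₂.adj_iff]) (by grind [e₂.adj_iff]) b4
    have d1 := sameCycle_arcPerm (M := H₃) (x := d) (y := o) (z := z)
      (by grind [e₂.rot_eq, e₃.rot_eq])
    have d2 := d1.trans (sameCycle_arcPerm (z := m) (by grind [e₂.rot_eq, e₃.rot_eq]))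
    obtain ⟨N, f₄, e₄, c₄⟩ := addEdgeInFace_of_sameCycle (M := H₃) hom
      (by grind [e₂.adj_iff, e₃.adj_iff]) (by grind [e₂.adj_iff, e₃.adj_iff])
      (by grind [e₂.adj_iff, e₃.adj_iff]) d2
    refine ⟨H₁, H₂, H₃, N, hH₁, ?_, f₂, f₃, f₄, by omega, ?_, ?_, ?_⟩
    · refine onCommonFace_of_sameCycle (x := d) (y := z) (by rwa [hG]) ?_
      rintro y (rfl | rfl | rfl | rfl)
      exacts [⟨_, a6⟩, ⟨_, .refl _ _⟩, ⟨_, a3⟩, ⟨_, a8⟩]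
    · rw [e₄.card_edgeSet, e₃.card_edgeSet, e₂.card_edgeSet, hG]
    · intro x y
      rw [e₄.adj_iff, e₃.adj_iff, e₂.adj_iff, hG]
      tauto
    · intro y g1 g2 g3 g4 g5
      rw [e₄.2.2.2.2.2.2.2 y g2 g5, e₃.2.2.2.2.2.2.2 y g2 g4, e₂.2.2.2.2.2.2.2 y g2 g3, hr y g1]

/-- A handle that joins the face with the corner `(p, o)` to the triangle `[q, e, e']` carries the
edge `(o, e)`; afterwards `p` and `q` are on one face, which leaves room for the edge `(p, q)`. -/
theorem exists_edge_on_handle_and_edge {p o q e e' : V} (hT : M.IsTriangle q e e')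
    (hpo : M.graph.Adj p o) (hoq : o ≠ q) (hoe : o ≠ e) (hoe' : o ≠ e') (hpq : p ≠ q)
    (hpe : p ≠ e) (hnpq : ¬ M.graph.Adj p q) (hnoe : ¬ M.graph.Adj o e) :
    ∃ H N : RotationSystem V, M.AddEdgeOnHandle H o e ∧ H.AddEdgeInFace N p q ∧
      N.arcPerm.cycleCount + 2 = M.arcPerm.cycleCount ∧
      Nat.card N.graph.edgeSet = Nat.card M.graph.edgeSet + 2 ∧
      (∀ x y, N.graph.Adj x y ↔ M.graph.Adj x y ∨ x = o ∧ y = e ∨ x = e ∧ y = o ∨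
        x = p ∧ y = q ∨ x = q ∧ y = p) := by
  obtain ⟨hqe, r1, r2, r3⟩ := id hT
  have hns : ¬ M.SameFace p o q e := by
    rw [sameFace_iff]
    rintro ⟨-, -, hs⟩
    rcases hT.sameCycle hs.symm with h | h | h <;> grind
  obtain ⟨H, hH⟩ := exists_addEdge hoe hnoe hpo hqe
  have c := hH.cycleCount_of_not_sameFace hns
  have hw : M.graph.Adj ((M.rot p).symm o) p := (M.adj_rot_symm hpo).symm
  have hw' : M.rot p ((M.rot p).symm o) = o := (M.rot p).apply_symm_apply o
  have h1 := hpo.ne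
  have h2 := hqe.ne
  have h3 := hT.rotate.1.ne
  have h4 := hT.rotate.rotate.1.ne
  have a1 := sameCycle_arcPerm (M := H) (x := (M.rot p).symm o) (y := p) (z := o)
    (by rw [hH.rot_eq]; grind)
  have a2 := a1.trans (sameCycle_arcPerm (z := e) (by grind [hH.rot_eq]))
  have a3 := a2.trans (sameCycle_arcPerm (z := e') (by grind [hH.rot_eq]))
  have a4 := a3.trans (sameCycle_arcPerm (z := q) (by grind [hH.rot_eq]))
  have h5 := hT.rotate.rotate.1
  obtain ⟨N, f, hN, c'⟩ := addEdgeInFace_of_sameCycle hpq (by grind [hH.adj_iff])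
    (hH.adj_iff.2 (.inl hw)) (hH.adj_iff.2 (.inl h5)) a4
  refine ⟨H, N, ⟨p, q, hns, hH⟩, f, by omega, by rw [hN.card_edgeSet, hH.card_edgeSet],
    fun x y => ?_⟩
  rw [hN.adj_iff, hH.adj_iff]
  tauto

end RotationSystem

/-! ### Residues modulo `12 * s + 6` -/

section Residues

variable {s : ℕ}

theorem natCast_eq_iff_of_lt {n a b : ℕ} (ha : a < n) (hb : b < n) :
    (a : ZMod n) = b ↔ a = b := by
  rw [ZMod.natCast_eq_natCast_iff', Nat.mod_eq_of_lt ha, Nat.mod_eq_of_lt hb]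

theorem neg_natCast_eq {n a b : ℕ} (h : a + b = n) : -(a : ZMod n) = b := by
  rw [neg_eq_iff_add_eq_zero, ← Nat.cast_add, h, ZMod.natCast_self]

theorem index_zmultiples_natCast {n : ℕ} [NeZero n] (a : ℕ) :
    (AddSubgroup.zmultiples (a : ZMod n)).index = n.gcd a := by
  have h := (AddSubgroup.zmultiples (a : ZMod n)).card_mul_index
  rw [Nat.card_zmultiples, ZMod.addOrderOf_coe _ (NeZero.ne n), Nat.card_zmod] at h
  have hpos : 0 < n / n.gcd a :=
    Nat.div_pos (Nat.le_of_dvd (NeZero.pos n) (n.gcd_dvd_left a))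
      (Nat.gcd_pos_of_pos_left _ (NeZero.pos n))
  refine Nat.eq_of_mul_eq_mul_left hpos ?_
  rw [h, Nat.div_mul_cancel (n.gcd_dvd_left a)]

/-- The element of order 2 of `ZMod (12 * s + 6)`. -/
def half (s : ℕ) : ZMod (12 * s + 6) := (6 * s + 3 : ℕ)

theorem neg_half : -half s = half s := neg_natCast_eq (by ring)

theorem half_ne_zero : half s ≠ 0 := by
  rw [half, ← Nat.cast_zero, Ne, natCast_eq_iff_of_lt (by omega) (by omega)]
  omega

theorem addOrderOf_eq_two_iff_eq_half {g : ZMod (12 * s + 6)} : addOrderOf g = 2 ↔ g = half s := by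
  rw [addOrderOf_eq_prime_iff (p := 2)]
  constructor
  · rintro ⟨h, h0⟩
    obtain ⟨k, hk, rfl⟩ : ∃ k < 12 * s + 6, g = (k : ℕ) := ⟨g.val, g.val_lt, by simp⟩
    rw [two_nsmul, ← Nat.cast_add, ZMod.natCast_eq_zero_iff] at h
    obtain ⟨c, hc⟩ := h
    have hc2 : c < 2 := by
      by_contra! hc2
      nlinarith
    have hk0 : k ≠ 0 := by rintro rfl; simp at h0
    rw [half, natCast_eq_iff_of_lt hk (by omega)]
    interval_cases c <;> omega
  · rintro rfl
    refine ⟨?_, half_ne_zero⟩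
    rw [two_nsmul]
    nth_rw 1 [← neg_half]
    exact neg_add_cancel _

end Residues

/-! ### Current graphs given by a rotation of order 3 -/

/-- The arc `corner s l` of `ZMod (12 * s + 6)`, given by its representative, enters a vortex
through the corner with label `l`. -/
def corner (s : ℕ) : CornerLabel → ℕ
  | .a => 12 * s + 5
  | .b => 9 * s + 5
  | .c => 3 * s + 5
  | .u => 9 * s + 4
  | .v => 12 * s + 4
  | .w => 9 * s + 1
  | .x => 1
  | .y => 2

/-- The label of the next corner of the same vortex. -/
def CornerLabel.next : CornerLabel → CornerLabel
  | .a => .c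
  | .c => .b
  | .b => .a
  | .v => .w
  | .w => .u
  | .u => .v
  | .x => .x
  | .y => .y

/-- The rotations for which `orderThreeGraph` below is a current graph with the required
properties. They have order 3, fix only the free end and the vortices of degree 1, permute the
negatives of the corners as the vortices require, satisfy Kirchhoff's law elsewhere, and give a
single face. -/
structure IsAdmissible (s : ℕ) (r : Perm (ZMod (12 * s + 6))) : Prop where
  cube : ∀ x, r (r (r x)) = x
  fixed : ∀ x, r x = x → x = 0 ∨ x = -1 ∨ x = -2
  zero : r 0 = 0
  vortex : ∀ l, r (-(corner s l : ZMod (12 * s + 6))) = -(corner s l.next : ZMod (12 * s + 6))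
  kirchhoff : ∀ x, (∀ l, x ≠ -(corner s l : ZMod (12 * s + 6))) → x + r x + r (r x) = 0
  cycle : ∀ a b, (r * (swap 0 (half s) * Equiv.neg _)).SameCycle a b

/-- The current graph with arcs `ZMod (12 * s + 6)`. A nonzero arc carries itself as current, and
the arc `0` is the reverse of the arc of order 2, whose current it shares; `r` permutes the arcs
around each tail. -/
abbrev orderThreeGraph (s : ℕ) (r : Perm (ZMod (12 * s + 6))) :
    CurrentGraph (ZMod (12 * s + 6)) CornerLabel where
  Arc := ZMod (12 * s + 6)
  rev := swap 0 (half s) * Equiv.neg _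
  rev_rev a := by
    have h1 := @neg_half s
    have h2 := @half_ne_zero s
    have h3 := neg_eq_iff_eq_neg (a := a) (b := half s)
    simp only [Perm.mul_apply, Equiv.neg_apply, swap_apply_def, neg_eq_zero]
    split_ifs <;> grind
  rev_ne a := by
    simp only [Perm.mul_apply, Equiv.neg_apply, swap_apply_def, neg_eq_zero]
    split_ifs with h h'
    · rw [h]; exact half_ne_zero
    · exact fun h0 => h h0.symm
    · intro ha
      apply h'
      have : addOrderOf a = 2 := by
        rw [addOrderOf_eq_prime_iff (p := 2)]
        exact ⟨by rw [two_nsmul]; nth_rw 1 [← ha]; exact neg_add_cancel _, h⟩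
      rw [addOrderOf_eq_two_iff_eq_half.1 this, neg_half]
  rot := r
  current a := if a = 0 then half s else a
  current_rev a := by
    have h1 := @neg_half s
    have h2 := @half_ne_zero s
    have h3 := neg_eq_iff_eq_neg (a := a) (b := half s)
    simp only [Perm.mul_apply, Equiv.neg_apply, swap_apply_def, neg_eq_zero]
    split_ifs <;> grind
  label a := [CornerLabel.a, .b, .c, .u, .v, .w, .x, .y].find? fun l => a.val = corner s l

theorem CurrentGraph.excess_eq_sum {Γ Λ : Type} [AddCommGroup Γ] (G : CurrentGraph Γ Λ) {a : G.Arc}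
    (S : Finset G.Arc) (hS : ∀ b, b ∈ S ↔ G.rot.SameCycle a b) :
    G.excess a = ∑ b ∈ S, G.current (G.rev b) := by
  classical
  unfold CurrentGraph.excess
  congr 1
  ext b
  rw [Finset.mem_filter_univ, hS]

namespace OrderThree

variable {s : ℕ} {r : Perm (ZMod (12 * s + 6))}

local notation "Z" => ZMod (12 * s + 6)

theorem corner_lt (l : CornerLabel) : corner s l < 12 * s + 6 := by
  cases l <;> simp only [corner] <;> omega

theorem corner_injective (hs : 1 ≤ s) : (corner s).Injective := by
  intro l l' h
  cases l <;> cases l' <;> simp only [corner] at h <;> first | rfl | omega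

theorem natCast_corner_inj (hs : 1 ≤ s) {l l' : CornerLabel} :
    (corner s l : Z) = corner s l' ↔ l = l' := by
  rw [natCast_eq_iff_of_lt (corner_lt l) (corner_lt l'), (corner_injective hs).eq_iff]

theorem corner_ne_zero (l : CornerLabel) : (corner s l : Z) ≠ 0 := by
  rw [← Nat.cast_zero, Ne, natCast_eq_iff_of_lt (corner_lt l) (by omega)]
  cases l <;> simp [corner]

theorem corner_ne_half (hs : 1 ≤ s) (l : CornerLabel) : (corner s l : Z) ≠ half s := by
  rw [half, Ne, natCast_eq_iff_of_lt (corner_lt l) (by omega)]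
  cases l <;> simp only [corner] <;> omega

theorem neg_one_eq : (-1 : Z) = -(corner s .x : Z) := by simp [corner]

theorem neg_two_eq : (-2 : Z) = -(corner s .y : Z) := by simp [corner]

theorem label_eq_some_iff (hs : 1 ≤ s) {a : Z} {l : CornerLabel} :
    (orderThreeGraph s r).label a = some l ↔ a = (corner s l : Z) := by
  have hval : ∀ l, a.val = corner s l ↔ a = (corner s l : Z) := fun l => by
    rw [← (ZMod.val_injective _).eq_iff (b := (corner s l : Z)),
      ZMod.val_natCast_of_lt (corner_lt l)]
  rw [← hval]
  have hinj := corner_injective hs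
  constructor
  · intro h
    simpa using List.find?_some h
  · intro h
    change List.find? _ _ = _
    rw [List.find?_eq_some_iff_append]
    refine ⟨by simpa using h, ?_⟩
    have : ∀ l', l' ≠ l → a.val ≠ corner s l' := fun l' hl' h' => hl' (hinj (h'.symm.trans h))
    cases l
    · exact ⟨[], _, rfl, by simp⟩
    · exact ⟨[.a], _, rfl, by simp [this]⟩
    · exact ⟨[.a, .b], _, rfl, by simp [this]⟩
    · exact ⟨[.a, .b, .c], _, rfl, by simp [this]⟩
    · exact ⟨[.a, .b, .c, .u], _, rfl, by simp [this]⟩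
    · exact ⟨[.a, .b, .c, .u, .v], _, rfl, by simp [this]⟩
    · exact ⟨[.a, .b, .c, .u, .v, .w], _, rfl, by simp [this]⟩
    · exact ⟨[.a, .b, .c, .u, .v, .w, .x], _, rfl, by simp [this]⟩

theorem current_of_ne {a : Z} (ha : a ≠ 0) : (orderThreeGraph s r).current a = a := if_neg ha

theorem current_zero : (orderThreeGraph s r).current (0 : Z) = half s :=
  if_pos (c := (0 : Z) = 0) (e := (0 : Z)) rfl

theorem current_corner (l : CornerLabel) :
    (orderThreeGraph s r).current (corner s l : Z) = (corner s l : Z) :=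
  current_of_ne (corner_ne_zero l)

theorem rev_of_ne {a : Z} (h0 : a ≠ 0) (hh : a ≠ half s) : (orderThreeGraph s r).rev a = -a :=
  swap_apply_of_ne_of_ne (by simpa) fun h => hh (by rw [← neg_half, ← h]; exact (neg_neg a).symm)

theorem rev_corner (hs : 1 ≤ s) (l : CornerLabel) :
    (orderThreeGraph s r).rev (corner s l : Z) = -(corner s l : Z) :=
  rev_of_ne (corner_ne_zero l) (corner_ne_half hs l)

theorem rev_neg_corner (hs : 1 ≤ s) (l : CornerLabel) :
    (orderThreeGraph s r).rev (-(corner s l : Z)) = (corner s l : Z) := by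
  rw [← rev_corner (r := r) hs, (orderThreeGraph s r).rev_rev]

theorem rev_half : (orderThreeGraph s r).rev (half s) = (0 : Z) := by
  change swap 0 (half s) (-half s) = 0
  rw [neg_half, swap_apply_right]

theorem rev_zero : (orderThreeGraph s r).rev (0 : Z) = half s := by
  rw [← rev_half (r := r), (orderThreeGraph s r).rev_rev]

theorem current_rev_corner (hs : 1 ≤ s) (l : CornerLabel) :
    (orderThreeGraph s r).current ((orderThreeGraph s r).rev (-(corner s l : Z))) =
      (corner s l : Z) := by
  rw [rev_neg_corner hs, current_corner]

theorem sameCycle_iff (h : IsAdmissible s r) {a b : Z} :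
    r.SameCycle a b ↔ b = a ∨ b = r a ∨ b = r (r a) := by
  constructor
  · rintro ⟨i, rfl⟩
    have hc := h.cube a
    induction i using Int.induction_on with
    | zero => exact .inl rfl
    | succ i ih =>
      rw [add_comm (i : ℤ), zpow_add, Perm.mul_apply, zpow_one]
      rcases ih with ih | ih | ih <;> rw [ih] <;> simp [hc]
    | pred i ih =>
      rw [sub_eq_neg_add, zpow_add, Perm.mul_apply, zpow_neg_one, Perm.inv_def]
      have hinv : r.symm a = r (r a) := by rw [symm_apply_eq, hc]
      rcases ih with ih | ih | ih <;> rw [ih] <;> simp [hinv]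
  · rintro (rfl | rfl | rfl)
    · exact .refl _ _
    · simp [Perm.SameCycle.refl]
    · simp [Perm.SameCycle.refl]

theorem degree_of_fixed {a : Z} (ha : r a = a) : (orderThreeGraph s r).degree a = 1 :=
  Function.minimalPeriod_eq_one_iff_isFixedPt.2 ha

theorem degree_of_ne (h : IsAdmissible s r) {a : Z} (ha : r a ≠ a) :
    (orderThreeGraph s r).degree a = 3 := by
  have : Fact (Nat.Prime 3) := ⟨Nat.prime_three⟩
  exact Function.minimalPeriod_eq_prime (h.cube a) ha

theorem excess_of_fixed (h : IsAdmissible s r) {a : Z} (ha : r a = a) :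
    (orderThreeGraph s r).excess a =
      (orderThreeGraph s r).current ((orderThreeGraph s r).rev a) := by
  refine ((orderThreeGraph s r).excess_eq_sum ({a} : Finset Z) fun b => ?_).trans
    (Finset.sum_singleton _ _)
  rw [Finset.mem_singleton]
  exact ((sameCycle_iff h).trans (by simp [ha])).symm

theorem excess_of_ne (h : IsAdmissible s r) {a : Z} (ha : r a ≠ a) :
    (orderThreeGraph s r).excess a = -(a + r a + r (r a)) := by
  have h1 : r (r a) ≠ a := fun h' => ha (by conv_lhs => rw [← h', h.cube])
  have h2 : r (r a) ≠ r a := fun h' => ha (r.injective h')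
  have h0 : ∀ b : Z, r b ≠ b → b ≠ 0 := by rintro _ hb rfl; exact hb h.zero
  have h3 : r (r (r a)) ≠ r (r a) := fun h' => h2 (r.injective h')
  have hc : ∀ b : Z, r b ≠ b →
      (orderThreeGraph s r).current ((orderThreeGraph s r).rev b) = -b := fun b hb =>
    ((orderThreeGraph s r).current_rev b).trans (congrArg Neg.neg (current_of_ne (h0 b hb)))
  rw [(orderThreeGraph s r).excess_eq_sum ({a, r a, r (r a)} : Finset Z) fun b => by
      rw [Finset.mem_insert, Finset.mem_insert, Finset.mem_singleton]
      exact (sameCycle_iff h).symm,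
    Finset.sum_insert (by simp [ha.symm, h1.symm]), Finset.sum_insert (by simp [h2.symm]),
    Finset.sum_singleton, hc _ ha, hc _ h2, hc _ h3]
  ring

theorem next_eq_self_iff {l : CornerLabel} : l.next = l ↔ l = .x ∨ l = .y := by
  cases l <;> simp [CornerLabel.next]

theorem next_next_next (l : CornerLabel) : l.next.next.next = l := by cases l <;> rfl

theorem rot_neg_corner_eq_iff (hs : 1 ≤ s) (h : IsAdmissible s r) {l : CornerLabel} :
    r (-(corner s l : Z)) = -(corner s l : Z) ↔ l = .x ∨ l = .y := by
  rw [h.vortex, neg_inj, natCast_corner_inj hs, next_eq_self_iff]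

/-- The excess of the vortex with a corner `l`, as a natural number. -/
def cornerExcess (s : ℕ) : CornerLabel → ℕ
  | .x => 1
  | .y => 2
  | .a | .b | .c => 24 * s + 15
  | .u | .v | .w => 30 * s + 9

theorem excess_neg_corner (hs : 1 ≤ s) (h : IsAdmissible s r) (l : CornerLabel) :
    (orderThreeGraph s r).excess (-(corner s l : Z)) = (cornerExcess s l : Z) := by
  by_cases hl : l = .x ∨ l = .y
  · rw [excess_of_fixed h ((rot_neg_corner_eq_iff hs h).2 hl), current_rev_corner hs]
    rcases hl with rfl | rfl <;> rfl
  · rw [excess_of_ne h (fun h' => hl ((rot_neg_corner_eq_iff hs h).1 h')), h.vortex, h.vortex,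
      ← neg_add, ← neg_add, neg_neg, ← Nat.cast_add, ← Nat.cast_add]
    congr 1
    cases l <;> simp only [corner, cornerExcess, CornerLabel.next] <;> first | omega | simp at hl

theorem gcd_cornerExcess (l : CornerLabel) : (12 * s + 6).gcd (cornerExcess s l) =
    match l with
    | .x => 1
    | .y => 2
    | _ => 3 := by
  have h1 : (12 * s + 6).gcd (24 * s + 15) = 3 := by
    rw [show 24 * s + 15 = 3 + (12 * s + 6) * 2 by ring, Nat.gcd_add_mul_left_right,
      show 12 * s + 6 = 3 * (4 * s + 2) by ring, Nat.gcd_mul_right_left]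
  have h2 : (12 * s + 6).gcd (30 * s + 9) = 3 := by
    have hd : (4 * s + 2).gcd (10 * s + 3) ∣ 4 := by
      have := Nat.dvd_sub ((Nat.gcd_dvd_left (4 * s + 2) (10 * s + 3)).mul_left 5)
        ((Nat.gcd_dvd_right (4 * s + 2) (10 * s + 3)).mul_left 2)
      rwa [show 5 * (4 * s + 2) - 2 * (10 * s + 3) = 4 by omega] at this
    have hd' := Nat.gcd_dvd_right (4 * s + 2) (10 * s + 3)
    rw [show 12 * s + 6 = 3 * (4 * s + 2) by ring, show 30 * s + 9 = 3 * (10 * s + 3) by ring,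
      Nat.gcd_mul_left]
    generalize (4 * s + 2).gcd (10 * s + 3) = d at hd hd'
    have : d ≤ 4 := Nat.le_of_dvd (by norm_num) hd
    interval_cases d <;> omega
  cases l
  · exact h1
  · exact h1
  · exact h1
  · exact h2
  · exact h2
  · exact h2
  · exact Nat.gcd_one_right _
  · exact Nat.gcd_eq_right (by simp only [cornerExcess]; omega)

theorem isFreeEnd_iff (hs : 1 ≤ s) (h : IsAdmissible s r) {a : Z} :
    (orderThreeGraph s r).IsFreeEnd a ↔ a = 0 := by
  constructor
  · rintro ⟨h1, h2⟩
    rw [addOrderOf_eq_two_iff_eq_half] at h2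
    by_contra ha
    rw [current_of_ne ha] at h2
    subst h2
    by_cases hr : r (half s) = half s
    · rcases h.fixed _ hr with h' | h' | h'
      · exact ha h'
      · rw [← neg_half, neg_one_eq, neg_inj] at h'
        exact corner_ne_half hs _ h'.symm
      · rw [← neg_half, neg_two_eq, neg_inj] at h'
        exact corner_ne_half hs _ h'.symm
    · rw [degree_of_ne h hr] at h1
      omega
  · rintro rfl
    exact ⟨degree_of_fixed h.zero, by rw [addOrderOf_eq_two_iff_eq_half, current_zero]⟩

theorem excess_eq_zero (h : IsAdmissible s r) {a : Z} (ha : ∀ l, a ≠ -(corner s l : Z))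
    (h0 : a ≠ 0) : (orderThreeGraph s r).excess a = 0 := by
  rw [excess_of_ne h, h.kirchhoff a ha, neg_zero]
  intro hr
  rcases h.fixed a hr with rfl | rfl | rfl
  exacts [h0 rfl, ha _ neg_one_eq, ha _ neg_two_eq]

theorem isVortex_iff (hs : 1 ≤ s) (h : IsAdmissible s r) {a : Z} :
    (orderThreeGraph s r).IsVortex a ↔ ∃ l, a = -(corner s l : Z) := by
  rw [CurrentGraph.IsVortex, isFreeEnd_iff hs h]
  constructor
  · rintro ⟨h1, h2⟩
    by_contra! hl
    exact h1 (excess_eq_zero h hl h2)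
  · rintro ⟨l, rfl⟩
    refine ⟨fun h0 => ?_, neg_ne_zero.2 (corner_ne_zero l)⟩
    rw [excess_neg_corner hs h, ZMod.natCast_eq_zero_iff, ← Nat.gcd_eq_left_iff_dvd,
      gcd_cornerExcess] at h0
    cases l <;> simp only at h0 <;> omega

theorem corner_mod_three (l : CornerLabel) (hl : ¬ (l = .x ∨ l = .y)) :
    corner s l % 3 = corner s l.next % 3 ∧ (corner s l % 3 = 1 ∨ corner s l % 3 = 2) := by
  cases l <;> simp only [corner, CornerLabel.next] <;> first | omega | simp at hl

theorem isV1_neg_corner (hs : 1 ≤ s) (h : IsAdmissible s r) :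
    (orderThreeGraph s r).IsV1 (-(corner s .x : Z)) := by
  refine ⟨degree_of_fixed ((rot_neg_corner_eq_iff hs h).2 (.inl rfl)), ?_⟩
  rw [excess_neg_corner hs h, ← AddSubgroup.index_eq_one, index_zmultiples_natCast,
    gcd_cornerExcess]

theorem isV2_neg_corner (hs : 1 ≤ s) (h : IsAdmissible s r) :
    (orderThreeGraph s r).IsV2 (-(corner s .y : Z)) := by
  refine ⟨degree_of_fixed ((rot_neg_corner_eq_iff hs h).2 (.inr rfl)), ?_⟩
  rw [excess_neg_corner hs h, index_zmultiples_natCast, gcd_cornerExcess]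

theorem isV3_neg_corner (hs : 1 ≤ s) (h : IsAdmissible s r) {l : CornerLabel}
    (hl : ¬ (l = .x ∨ l = .y)) : (orderThreeGraph s r).IsV3 (-(corner s l : Z)) := by
  have hval : ∀ l, ((orderThreeGraph s r).current ((orderThreeGraph s r).rev
      (-(corner s l : Z)))).val = corner s l := fun l => by
    rw [current_rev_corner hs, ZMod.val_natCast_of_lt (corner_lt l)]
  refine ⟨degree_of_ne h fun h' => hl ((rot_neg_corner_eq_iff hs h).1 h'), ?_,
    corner s l % 3, (corner_mod_three l hl).2, ?_⟩
  · rw [excess_neg_corner hs h, index_zmultiples_natCast, gcd_cornerExcess]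
    cases l <;> simp at hl ⊢
  · intro b hb
    have hl' : ¬ (l.next = .x ∨ l.next = .y) := by cases l <;> simp [CornerLabel.next] at hl ⊢
    rcases (sameCycle_iff h).1 hb with rfl | rfl | rfl
    · rw [hval]
    · rw [h.vortex, hval, (corner_mod_three l hl).1]
    · rw [h.vortex, h.vortex, hval, (corner_mod_three l hl).1, (corner_mod_three _ hl').1]

theorem isStandard (hs : 1 ≤ s) (h : IsAdmissible s r) : (orderThreeGraph s r).IsStandard where
  indexOne := ⟨⟨(0 : Z)⟩, h.cycle⟩
  degree_eq (a : Z) := by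
    by_cases ha : r a = a
    · exact .inl (degree_of_fixed ha)
    · exact .inr (degree_of_ne h ha)
  current_ne_zero (a : Z) := by
    by_cases ha : a = 0
    · rw [ha, current_zero]; exact half_ne_zero
    · rwa [current_of_ne ha]
  current_unique (g : Z) h0 h2 := by
    refine ⟨g, current_of_ne h0, fun (b : Z) hb => ?_⟩
    rw [Ne, addOrderOf_eq_two_iff_eq_half] at h2
    by_cases hb0 : b = 0
    · rw [hb0, current_zero] at hb
      exact absurd hb.symm h2
    · rwa [current_of_ne hb0] at hb
  current_order_two (g : Z) hg := by
    refine ⟨(0 : Z), fun (b : Z) => ?_⟩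
    rw [addOrderOf_eq_two_iff_eq_half.1 hg, rev_zero]
    constructor
    · intro hb
      by_cases hb0 : b = 0
      · exact .inl hb0
      · rw [current_of_ne hb0] at hb
        exact .inr hb
    · rintro (rfl | rfl)
      · exact current_zero
      · exact current_of_ne half_ne_zero
  order_two_end (a : Z) ha := by
    rw [isFreeEnd_iff hs h, isFreeEnd_iff hs h]
    rw [addOrderOf_eq_two_iff_eq_half] at ha
    by_cases h0 : a = 0
    · exact .inl h0
    · rw [current_of_ne h0] at ha
      exact .inr (ha ▸ rev_half)
  kirchhoff (a : Z) h3 hn := by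
    refine excess_eq_zero h ?_ ?_
    · rintro l rfl
      rw [rev_neg_corner hs, (label_eq_some_iff hs).2 rfl] at hn
      cases hn
    · rintro rfl
      rw [degree_of_fixed h.zero] at h3
      omega
  label_isSome_iff (a : Z) := by
    rw [isVortex_iff hs h, Option.isSome_iff_exists]
    refine exists_congr fun l => ?_
    rw [label_eq_some_iff hs]
    constructor
    · intro hl
      rw [← (orderThreeGraph s r).rev_rev a, hl, rev_corner hs]
    · rintro rfl
      exact rev_neg_corner hs l
  label_injective (a b : Z) l ha hb := by
    rw [label_eq_some_iff hs] at ha hb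
    rw [ha, hb]
  vortex_type (a : Z) ha := by
    obtain ⟨l, rfl⟩ := (isVortex_iff hs h).1 ha
    by_cases hl : l = .x ∨ l = .y
    · rcases hl with rfl | rfl
      · exact .inl (isV1_neg_corner hs h)
      · exact .inr (.inl (isV2_neg_corner hs h))
    · exact .inr (.inr (isV3_neg_corner hs h hl))

theorem facePerm_corner (hs : 1 ≤ s) (h : IsAdmissible s r) (l : CornerLabel) :
    (orderThreeGraph s r).facePerm (corner s l : Z) = -(corner s l.next : Z) := by
  change r ((orderThreeGraph s r).rev (corner s l : Z)) = _
  rw [rev_corner hs, h.vortex]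

theorem corner_y_eq_neg : (corner s .y : Z) = -(corner s .v : Z) :=
  (neg_natCast_eq rfl).symm

theorem corner_x_eq_neg : (corner s .x : Z) = -(corner s .a : Z) :=
  (neg_natCast_eq rfl).symm

theorem corner_c_eq_neg : (corner s .c : Z) = -(corner s .w : Z) :=
  (neg_natCast_eq (by simp only [corner]; omega)).symm

theorem hasVortices (hs : 1 ≤ s) (h : IsAdmissible s r) {γ δ ε : Z}
    (hγ : γ = 3 * s + 5) (hδ : δ = 2) (hε : ε = 1) :
    (orderThreeGraph s r).HasVortices γ δ ε := by
  have eγ : γ = (corner s .c : Z) := by rw [hγ]; simp [corner]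
  have eδ : δ = (corner s .y : Z) := by rw [hδ]; simp [corner]
  have eε : ε = (corner s .x : Z) := by rw [hε]; simp [corner]
  have hF : ∀ (a b : (orderThreeGraph s r).Arc) (l : CornerLabel),
      (orderThreeGraph s r).facePerm a = b → (orderThreeGraph s r).label a = some l →
      (orderThreeGraph s r).label ((orderThreeGraph s r).facePerm.symm b) = some l := by
    rintro a b l rfl hl
    rwa [symm_apply_apply]
  have hlab : ∀ l, (orderThreeGraph s r).label (corner s l : Z) = some l := fun l =>
    (label_eq_some_iff hs).2 rfl
  have hFc := fun l => facePerm_corner hs h l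
  rw [eγ, eδ, eε]
  refine ⟨(corner s .y : Z), (corner s .c : Z), (corner s .x : Z), current_corner _,
    current_corner _, current_corner _, ?_, ?_, ?_, ?_, ?_, ?_, ?_, hlab _, ?_, ?_, ?_, hlab _, ?_,
    hlab _, ?_, ?_, ?_, ?_⟩
  · rw [rev_corner hs]; exact isV1_neg_corner hs h
  · rw [rev_corner hs]; exact isV2_neg_corner hs h
  · rw [corner_y_eq_neg]; exact isV3_neg_corner hs h (by simp)
  · rw [corner_x_eq_neg]; exact isV3_neg_corner hs h (by simp)
  · rw [rev_corner hs, excess_neg_corner hs h]; rfl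
  · rw [rev_corner hs, excess_neg_corner hs h]; rfl
  · exact hF (corner s .u : Z) _ _ ((hFc .u).trans corner_y_eq_neg.symm) (hlab _)
  · rw [hFc, rev_corner hs]; rfl
  · rw [corner_y_eq_neg, rev_neg_corner hs]; exact hlab _
  · rw [corner_y_eq_neg, rev_neg_corner hs, hFc, corner_c_eq_neg]; rfl
  · exact hF (corner s .b : Z) _ _ ((hFc .b).trans corner_x_eq_neg.symm) (hlab _)
  · rw [hFc, rev_corner hs]; rfl
  · rw [corner_x_eq_neg, rev_neg_corner hs]; exact hlab _
  · rw [corner_x_eq_neg, rev_neg_corner hs, hFc, rev_corner hs]; rfl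
  · rw [corner_c_eq_neg, rev_neg_corner hs]; exact hlab _

end OrderThree

/-! ### Subdividing a cyclic order -/

section Subdivision

variable {α β : Type*}

/-- The involution of the disjoint union that interchanges `a` and `b` when `p` matches them. -/
def PEquiv.sumPerm (p : α ≃. β) : Perm (α ⊕ β) where
  toFun := Sum.elim (fun a => (p a).elim (.inl a) .inr) fun b => (p.symm b).elim (.inr b) .inl
  invFun := Sum.elim (fun a => (p a).elim (.inl a) .inr) fun b => (p.symm b).elim (.inr b) .inl
  left_inv := by
    rintro (a | b)
    · cases h : p a with
      | none => simp [h]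
      | some b => simp [h, p.eq_some_iff.2 h]
    · cases h : p.symm b with
      | none => simp [h]
      | some a => simp [h, p.eq_some_iff.1 h]
  right_inv := by
    rintro (a | b)
    · cases h : p a with
      | none => simp [h]
      | some b => simp [h, p.eq_some_iff.2 h]
    · cases h : p.symm b with
      | none => simp [h]
      | some a => simp [h, p.eq_some_iff.1 h]

/-- The element `b` is inserted into the cycle of `f` behind the element `a` that `p` matches it
with. -/
def subdivide (f : Perm α) (p : α ≃. β) : Perm (α ⊕ β) := Perm.sumCongr f 1 * p.sumPerm

variable {f : Perm α} {p : α ≃. β} {a : α} {b : β}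

theorem subdivide_inl_of_none (h : p a = none) : subdivide f p (.inl a) = .inl (f a) := by
  simp [subdivide, PEquiv.sumPerm, h]

theorem subdivide_inl_of_some (h : p a = some b) : subdivide f p (.inl a) = .inr b := by
  simp [subdivide, PEquiv.sumPerm, h]

theorem subdivide_inr_of_some (h : p a = some b) : subdivide f p (.inr b) = .inl (f a) := by
  simp [subdivide, PEquiv.sumPerm, p.eq_some_iff.2 h]

theorem subdivide_inr_of_none (h : ∀ a, p a ≠ some b) : subdivide f p (.inr b) = .inr b := by
  cases h' : p.symm b with
  | none => simp [subdivide, PEquiv.sumPerm, h']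
  | some a => exact absurd (p.eq_some_iff.1 h') (h a)

/-- A subdivided cycle is a cycle on the old elements and the inserted ones. -/
theorem isCycleOn_subdivide {S : Set α} (hf : f.IsCycleOn S) (hp : ∀ a b, p a = some b → a ∈ S) :
    (subdivide f p).IsCycleOn (Sum.elim (· ∈ S) fun b => ∃ a, p a = some b) := by
  have hone : ∀ z, (subdivide f p).SameCycle z (subdivide f p z) := fun z =>
    Perm.sameCycle_apply_right.2 (.refl _ _)
  have hstep : ∀ a, (subdivide f p).SameCycle (.inl a) (.inl (f a)) := by
    intro a
    cases h : p a with
    | none => simpa [subdivide_inl_of_none h] using hone (.inl a)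
    | some b =>
      have h1 := hone (.inl a)
      rw [subdivide_inl_of_some h] at h1
      refine h1.trans ?_
      simpa [subdivide_inr_of_some h] using hone (.inr b)
  have hinl : ∀ a a', f.SameCycle a a' → (subdivide f p).SameCycle (.inl a) (.inl a') := by
    rintro a _ ⟨i, rfl⟩
    induction i using Int.induction_on with
    | zero => exact .refl _ _
    | succ i ih => rw [add_comm, zpow_add, Perm.mul_apply, zpow_one]; exact ih.trans (hstep _)
    | pred i ih =>
      refine ih.trans ?_
      have := hstep ((f ^ (-(i : ℤ) - 1)) a)
      rwa [← Perm.mul_apply, mul_self_zpow, show -(i : ℤ) - 1 + 1 = -i by ring,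
        Perm.sameCycle_comm] at this
  have hinr : ∀ z, Sum.elim (· ∈ S) (fun b => ∃ a, p a = some b) z →
      ∃ a ∈ S, (subdivide f p).SameCycle z (.inl a) := by
    rintro (a | b) hz
    · exact ⟨a, hz, .refl _ _⟩
    · obtain ⟨a, ha⟩ := hz
      refine ⟨a, hp _ _ ha, ?_⟩
      have := hone (.inl a)
      rwa [subdivide_inl_of_some ha, Perm.sameCycle_comm] at this
  refine ⟨Equiv.bijOn _ ?_, fun z hz z' hz' => ?_⟩
  · rintro (a | b)
    · change Sum.elim (· ∈ S) (fun b => ∃ a, p a = some b) _ ↔ a ∈ S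
      cases h : p a with
      | none => rw [subdivide_inl_of_none h]; exact hf.apply_mem_iff
      | some b => rw [subdivide_inl_of_some h]; exact ⟨fun _ => hp _ _ h, fun _ => ⟨a, h⟩⟩
    · change Sum.elim (· ∈ S) (fun b => ∃ a, p a = some b) _ ↔ ∃ a, p a = some b
      by_cases h : ∃ a, p a = some b
      · obtain ⟨a, ha⟩ := h
        rw [subdivide_inr_of_some ha]
        exact ⟨fun _ => ⟨a, ha⟩, fun _ => hf.apply_mem_iff.2 (hp _ _ ha)⟩
      · push Not at h
        rw [subdivide_inr_of_none h]
        rfl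
  · obtain ⟨a, ha, hza⟩ := hinr z hz
    obtain ⟨a', ha', hza'⟩ := hinr z' hz'
    exact (hza.trans (hinl _ _ (hf.2 ha ha'))).trans hza'.symm

end Subdivision

/-! ### The letters at the numbered vertices -/

/-- The label of the corner at which the letter `L` appears in the rotation at a number congruent
to `m` modulo 3. -/
def Letter.spoke : Letter → ℕ → CornerLabel
  | .a, m => CornerLabel.next^[m] .a
  | .b, m => CornerLabel.next^[m] .b
  | .c, m => CornerLabel.next^[m] .c
  | .u, m => CornerLabel.next^[2 * m] .u
  | .v, m => CornerLabel.next^[2 * m] .v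
  | .w, m => CornerLabel.next^[2 * m] .w
  | .x, _ => .x
  | .y₀, _ => .y
  | .y₁, _ => .y

/-- `L.Near m`: the letter `L` is adjacent to the numbers of the same parity as `m`. -/
def Letter.Near : Letter → ℕ → Prop
  | .y₀, m => m % 2 = 0
  | .y₁, m => m % 2 = 1
  | _, _ => True

instance (L : Letter) (m : ℕ) : Decidable (L.Near m) := by
  cases L <;> simp only [Letter.Near] <;> infer_instance

namespace OrderThree

variable {s : ℕ} {r : Perm (ZMod (12 * s + 6))}

local notation "Z" => ZMod (12 * s + 6)

theorem nextIncoming_pow_corner (hs : 1 ≤ s) (h : IsAdmissible s r) (k : ℕ) (l : CornerLabel) :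
    ((orderThreeGraph s r).nextIncoming ^ k) (corner s l : Z) =
      (corner s (CornerLabel.next^[k] l) : Z) := by
  induction k with
  | zero => rfl
  | succ k ih =>
    rw [pow_succ', Perm.mul_apply, ih, Function.iterate_succ_apply']
    change (orderThreeGraph s r).rev ((orderThreeGraph s r).facePerm (corner s _ : Z)) = _
    rw [facePerm_corner hs h, rev_neg_corner hs]

theorem letterAt_corner (hs : 1 ≤ s) (h : IsAdmissible s r) (i : Z) (l : CornerLabel) :
    (orderThreeGraph s r).letterAt i (corner s l : Z) =
      some (CornerLabel.toLetter i (CornerLabel.next^[i.val * corner s l % 3] l)) := by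
  rw [CurrentGraph.letterAt, current_corner, ZMod.val_natCast_of_lt (corner_lt l),
    nextIncoming_pow_corner hs h, (label_eq_some_iff hs).2 rfl, Option.map_some]

theorem next_iterate_iterate (k : ℕ) (l : CornerLabel) :
    CornerLabel.next^[k] (CornerLabel.next^[2 * k] l) = l := by
  rw [← Function.iterate_add_apply, show k + 2 * k = 3 * k by ring, Function.iterate_mul,
    show CornerLabel.next^[3] = id from funext next_next_next, Function.iterate_id, id]

theorem letterAt_eq_none (hs : 1 ≤ s) (h : IsAdmissible s r) (i : Z) {a : Z}
    (ha : ∀ l, a ≠ (corner s l : Z)) : (orderThreeGraph s r).letterAt i a = none := by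
  rw [CurrentGraph.letterAt, Option.map_eq_none_iff, ← Option.not_isSome_iff_eq_none,
    Option.isSome_iff_exists]
  rintro ⟨l, hl⟩
  rw [label_eq_some_iff hs,
    ← next_iterate_iterate (i.val * ((orderThreeGraph s r).current a).val % 3) l,
    ← nextIncoming_pow_corner hs h] at hl
  exact ha _ (Equiv.injective _ hl)

theorem toLetter_iterate_iff (i : Z) (l : CornerLabel) (L : Letter) :
    CornerLabel.toLetter i (CornerLabel.next^[i.val * corner s l % 3] l) = L ↔
      l = L.spoke (i.val % 3) ∧ L.Near i.val := by
  rw [Nat.mul_mod]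
  have h3 : i.val % 3 = 0 ∨ i.val % 3 = 1 ∨ i.val % 3 = 2 := by omega
  have h2 : i.val % 2 = 0 ∨ i.val % 2 = 1 := by omega
  have hl : corner s l % 3 = match l with
      | .a | .b | .c | .y => 2
      | _ => 1 := by
    cases l <;> simp only [corner] <;> omega
  rw [hl]
  rcases h3 with h3 | h3 | h3 <;> rcases h2 with h2 | h2 <;> rw [h3] <;> cases l <;> cases L <;>
    simp [Letter.spoke, Letter.Near, CornerLabel.toLetter, CornerLabel.next, h2]

theorem letterAt_eq_some_iff (hs : 1 ≤ s) (h : IsAdmissible s r) {i a : Z} {L : Letter} :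
    (orderThreeGraph s r).letterAt i a = some L ↔
      a = (corner s (L.spoke (i.val % 3)) : Z) ∧ L.Near i.val := by
  by_cases ha : ∃ l, a = (corner s l : Z)
  · obtain ⟨l, rfl⟩ := ha
    rw [letterAt_corner hs h, Option.some_inj, toLetter_iterate_iff, natCast_corner_inj hs]
  · push Not at ha
    rw [letterAt_eq_none hs h i ha]
    simp [ha]

theorem val_add_natCast_mod {d : ℕ} (hd : d ∣ 12 * s + 6) (i : Z) (k : ℕ) :
    (i + (k : Z)).val % d = (i.val + k) % d := by
  rw [ZMod.val_add, ZMod.val_natCast, Nat.mod_mod_of_dvd _ hd, Nat.add_mod,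
    Nat.mod_mod_of_dvd _ hd, ← Nat.add_mod]

theorem three_dvd : 3 ∣ 12 * s + 6 := by omega

theorem two_dvd : 2 ∣ 12 * s + 6 := by omega

/-- At the neighbour that follows `i` in the rotation at `L`, the corner of `L` is the previous one
of the vortex. -/
theorem spoke_add (L : Letter) (i : Z) :
    (L.spoke ((i + (corner s (L.spoke (i.val % 3)) : Z)).val % 3)).next =
      L.spoke (i.val % 3) := by
  rw [val_add_natCast_mod three_dvd]
  have h3 : i.val % 3 = 0 ∨ i.val % 3 = 1 ∨ i.val % 3 = 2 := by omega
  cases L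
  all_goals first
    | rfl
    | rcases h3 with h3 | h3 | h3 <;> rw [Nat.add_mod, h3] <;>
        simp [Letter.spoke, CornerLabel.next, corner, Nat.add_mod, Nat.mul_mod]

theorem spoke_sub (L : Letter) (i : Z) :
    L.spoke ((i - (corner s (L.spoke (i.val % 3)).next : Z)).val % 3) =
      (L.spoke (i.val % 3)).next := by
  have h := val_add_natCast_mod three_dvd (i - (corner s (L.spoke (i.val % 3)).next : Z))
    (corner s (L.spoke (i.val % 3)).next)
  rw [sub_add_cancel] at h
  generalize (i - (corner s (L.spoke (i.val % 3)).next : Z)).val = m at h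
  have h3 : i.val % 3 = 0 ∨ i.val % 3 = 1 ∨ i.val % 3 = 2 := by omega
  have hm : m % 3 = 0 ∨ m % 3 = 1 ∨ m % 3 = 2 := by omega
  cases L
  all_goals first
    | rfl
    | rcases h3 with h3 | h3 | h3 <;> rcases hm with hm | hm | hm <;> rw [h3] at h ⊢ <;> rw [hm] <;>
        simp only [Letter.spoke, CornerLabel.next, corner, Function.iterate_succ,
          Function.iterate_zero, Function.comp, id, Nat.reduceMul] at h ⊢ <;> omega

theorem near_add (L : Letter) (i : Z) :
    L.Near (i + (corner s (L.spoke (i.val % 3)) : Z)).val ↔ L.Near i.val := by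
  have h := val_add_natCast_mod two_dvd i (corner s (L.spoke (i.val % 3)))
  cases L <;> first
    | exact Iff.rfl
    | simp only [Letter.Near, Letter.spoke, corner] at h ⊢; omega

theorem near_sub (L : Letter) (i : Z) :
    L.Near (i - (corner s (L.spoke (i.val % 3)).next : Z)).val ↔ L.Near i.val := by
  have h := val_add_natCast_mod two_dvd (i - (corner s (L.spoke (i.val % 3)).next : Z))
    (corner s (L.spoke (i.val % 3)).next)
  rw [sub_add_cancel] at h
  cases L <;> first
    | exact Iff.rfl
    | simp only [Letter.Near, Letter.spoke, CornerLabel.next, corner] at h ⊢; omega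

/-- The rotation at the letter `L`, restricted to the numbers. -/
def letterPerm (s : ℕ) (L : Letter) : Perm (ZMod (12 * s + 6)) where
  toFun i := if L.Near i.val then i + (corner s (L.spoke (i.val % 3)) : ZMod (12 * s + 6)) else i
  invFun i :=
    if L.Near i.val then i - (corner s (L.spoke (i.val % 3)).next : ZMod (12 * s + 6)) else i
  left_inv i := by
    by_cases h : L.Near i.val
    · simp only [h, if_true, near_add, spoke_add, add_sub_cancel_right]
    · simp only [h, if_false]
  right_inv i := by
    by_cases h : L.Near i.val
    · simp only [h, if_true, near_sub, spoke_sub, sub_add_cancel]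
    · simp only [h, if_false]

theorem letterPerm_apply {L : Letter} {i : Z} (h : L.Near i.val) :
    letterPerm s L i = i + (corner s (L.spoke (i.val % 3)) : Z) := if_pos h

theorem near_letterPerm {L : Letter} {i : Z} : L.Near (letterPerm s L i).val ↔ L.Near i.val := by
  by_cases h : L.Near i.val
  · rw [letterPerm_apply h, near_add]
  · simp [letterPerm, h]

/-- The rotation at the numbered vertex `0`, without the letters. -/
def logPerm (r : Perm (ZMod (12 * s + 6))) : Perm (ZMod (12 * s + 6)) := r * Equiv.neg _

theorem logPerm_apply (a : Z) : logPerm r a = r (-a) := rfl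

/-- The log without the second occurrence of the element of order 2 is a cyclic order of the nonzero
elements, since the current graph has one face. -/
theorem isCycleOn_logPerm (h : IsAdmissible s r) : (logPerm r).IsCycleOn {0}ᶜ := by
  have h1 : (r * (swap 0 (half s) * Equiv.neg _)).IsCycleOn Set.univ :=
    ⟨Set.bijOn_univ.2 (Equiv.bijective _), fun a _ b _ => h.cycle a b⟩
  have e : logPerm r = r * (swap 0 (half s) * Equiv.neg _) * swap (half s) 0 := by
    ext1 a
    rw [logPerm_apply, Perm.mul_apply, Perm.mul_apply, Perm.mul_apply, Equiv.neg_apply,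
      show -swap (half s) 0 a = swap (half s) 0 (-a) by
        have := @neg_half s
        have := neg_eq_iff_eq_neg (a := a) (b := half s)
        have := neg_eq_zero (a := a)
        simp only [swap_apply_def]
        grind, swap_comm, swap_apply_self]
  rw [e, Set.compl_eq_univ_sdiff]
  refine h1.mul_swap_remove (Set.mem_univ _) ?_ half_ne_zero
  rw [Perm.mul_apply, Perm.mul_apply, Equiv.neg_apply, neg_half, swap_apply_right, h.zero]

/-- The rotation at the numbered vertex `i`, without the letters. -/
def numPerm (r : Perm (ZMod (12 * s + 6))) (i : ZMod (12 * s + 6)) : Perm (ZMod (12 * s + 6)) :=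
  Equiv.addLeft i * logPerm r * (Equiv.addLeft i)⁻¹

theorem numPerm_apply (i j : Z) : numPerm r i j = i + r (i - j) := by
  change i + r (-(-i + j)) = _
  rw [neg_add, neg_neg, ← sub_eq_add_neg]

theorem isCycleOn_numPerm (h : IsAdmissible s r) (i : Z) : (numPerm r i).IsCycleOn {i}ᶜ := by
  have h1 := (isCycleOn_logPerm h).conj (g := Equiv.addLeft i)
  rwa [show Equiv.addLeft i '' {0}ᶜ = {i}ᶜ by simp] at h1

/-- The matching of the numbers `j` with the letters that follow them in the rotation at `i`. -/
def letterMatching (hs : 1 ≤ s) (h : IsAdmissible s r) (i : ZMod (12 * s + 6)) :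
    ZMod (12 * s + 6) ≃. Letter where
  toFun j := (orderThreeGraph s r).letterAt i (j - i)
  invFun L := if L.Near i.val then some (i + (corner s (L.spoke (i.val % 3)) : Z)) else none
  inv j L := by
    rw [letterAt_eq_some_iff hs h]
    by_cases hL : L.Near i.val <;> simp [hL, sub_eq_iff_eq_add, eq_comm, add_comm]

theorem letterMatching_eq_some_iff (hs : 1 ≤ s) (h : IsAdmissible s r) {i j : Z} {L : Letter} :
    letterMatching hs h i j = some L ↔
      j = i + (corner s (L.spoke (i.val % 3)) : Z) ∧ L.Near i.val := by
  change (orderThreeGraph s r).letterAt i (j - i) = some L ↔ _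
  rw [letterAt_eq_some_iff hs h, sub_eq_iff_eq_add, add_comm i]

/-! ### The rotations at the letters are cyclic -/

theorem sameCycle_add_mul {f : Perm Z} {P : Z → Prop} {d : ℕ}
    (h : ∀ i, P i → P (i + (d : Z)) ∧ f.SameCycle i (i + (d : Z))) {i : Z} (hi : P i) (k : ℕ) :
    P (i + (k * d : ℕ)) ∧ f.SameCycle i (i + (k * d : ℕ)) := by
  induction k with
  | zero => simpa [Perm.SameCycle.refl] using hi
  | succ k ih =>
    obtain ⟨h1, h2⟩ := h _ ih.1
    rw [add_mul, one_mul, Nat.cast_add, ← add_assoc]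
    exact ⟨h1, ih.2.trans h2⟩

theorem exists_mul_eq_three {e : ℕ} (he : (12 * s + 6).gcd e = 3) :
    ∃ k : ℕ, ((k * e : ℕ) : Z) = (3 : ℕ) := by
  have h := Nat.gcd_eq_gcd_ab (12 * s + 6) e
  rw [he] at h
  refine ⟨((Nat.gcdB (12 * s + 6) e : ℤ) : Z).val, ?_⟩
  have h' := congrArg (Int.cast : ℤ → Z) h
  push_cast at h' ⊢
  have h0 : (12 * s + 6 : Z) = 0 := by exact_mod_cast ZMod.natCast_self (12 * s + 6)
  rw [h', h0, ZMod.natCast_val, ZMod.cast_id]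
  ring

theorem sameCycle_letterPerm_self {L : Letter} (i : Z) :
    (letterPerm s L).SameCycle i (letterPerm s L i) :=
  Perm.sameCycle_apply_right.2 (.refl _ _)

theorem spoke_letterPerm {L : Letter} {i : Z} (h : L.Near i.val) :
    L.spoke ((letterPerm s L i).val % 3) = (L.spoke (i.val % 3)).next.next := by
  rw [letterPerm_apply h, ← next_next_next (L.spoke ((i + _ : Z).val % 3)), spoke_add]

/-- Three steps around a letter of a (V3) vortex add the excess of the vortex. -/
theorem letterPerm_three {L : Letter} (hL : ∀ m, L.Near m)
    (hspoke : ∀ m < 3, ¬ (L.spoke m = .x ∨ L.spoke m = .y)) (i : Z) :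
    letterPerm s L (letterPerm s L (letterPerm s L i)) =
      i + (cornerExcess s (L.spoke (i.val % 3)) : Z) := by
  have hn := fun i : Z => spoke_letterPerm (hL i.val)
  have he := fun i : Z => letterPerm_apply (hL i.val)
  rw [he (letterPerm s L (letterPerm s L i)), hn, hn, he (letterPerm s L i), hn, he i,
    add_assoc, add_assoc, ← Nat.cast_add, ← Nat.cast_add]
  have h0 := hspoke (i.val % 3) (Nat.mod_lt _ (by norm_num))
  generalize L.spoke (i.val % 3) = l at h0 ⊢
  congr 2
  cases l <;> simp only [corner, cornerExcess, CornerLabel.next] <;>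
    first | omega | simp at h0

/-- The rotation at a letter of a (V3) vortex is cyclic: the excess generates the multiples of 3,
and single steps change the residue modulo 3. -/
theorem sameCycle_letterPerm_of_three {L : Letter} (hL : ∀ m, L.Near m)
    (hspoke : ∀ m < 3, ¬ (L.spoke m = .x ∨ L.spoke m = .y))
    (hexc : ∀ m < 3, cornerExcess s (L.spoke m) = cornerExcess s (L.spoke 0)) (i j : Z) :
    (letterPerm s L).SameCycle i j := by
  have hone := fun i : Z => sameCycle_letterPerm_self (L := L) i
  have hlt := fun i : Z => Nat.mod_lt i.val (show 0 < 3 by norm_num)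
  have hexcess : ∀ i : Z,
      (letterPerm s L).SameCycle i (i + (cornerExcess s (L.spoke 0) : Z)) := fun i => by
    have := ((hone i).trans (hone _)).trans (hone _)
    rwa [letterPerm_three hL hspoke, hexc _ (hlt i)] at this
  obtain ⟨k, hk⟩ := exists_mul_eq_three (s := s) (e := cornerExcess s (L.spoke 0)) (by
    rw [gcd_cornerExcess]
    have := hspoke 0 (by norm_num)
    cases hl : L.spoke 0 <;> simp [hl] at this ⊢)
  have hthree : ∀ i : Z, (letterPerm s L).SameCycle i (i + ((3 : ℕ) : Z)) := fun i => by
    have := (sameCycle_add_mul (P := fun _ => True) (fun i _ => ⟨trivial, hexcess i⟩)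
      (i := i) trivial k).2
    rwa [hk] at this
  have hmod : ∀ i j : Z, i.val % 3 = j.val % 3 → (letterPerm s L).SameCycle i j := fun i j h => by
    have hij : i + ((j - i).val : ℕ) = j := by simp
    have h1 := val_add_natCast_mod three_dvd i (j - i).val
    have := (sameCycle_add_mul (P := fun _ => True) (fun i _ => ⟨trivial, hthree i⟩)
      (i := i) trivial ((j - i).val / 3)).2
    rw [hij] at h1
    rwa [show (j - i).val / 3 * 3 = (j - i).val by omega, hij] at this
  -- The residues of the numbers modulo 3 are permuted cyclically.
  have h1 := val_add_natCast_mod three_dvd i (corner s (L.spoke (i.val % 3)))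
  have h2 := val_add_natCast_mod three_dvd (letterPerm s L i)
    (corner s (L.spoke ((letterPerm s L i).val % 3)))
  rw [← letterPerm_apply (hL _)] at h1 h2
  have h3 := corner_mod_three (s := s) _ (hspoke _ (hlt i))
  have h4 := corner_mod_three (s := s) _ (hspoke _ (hlt (letterPerm s L i)))
  rw [letterPerm_apply (hL _), spoke_add, ← letterPerm_apply (hL _)] at h4
  by_cases hi : i.val % 3 = j.val % 3
  · exact hmod _ _ hi
  by_cases hi' : (letterPerm s L i).val % 3 = j.val % 3
  · exact (hone i).trans (hmod _ _ hi')
  · exact ((hone i).trans (hone _)).trans (hmod _ _ (by omega))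

/-- The rotation at a letter is cyclic because the excess of its vortex generates the subgroup of
index 1, 2 or 3. -/
theorem sameCycle_letterPerm (L : Letter) {i j : Z} (hi : L.Near i.val) (hj : L.Near j.val) :
    (letterPerm s L).SameCycle i j := by
  have hij : i + ((j - i).val : ℕ) = j := by simp
  have hstep : ∀ {i : Z} {l : CornerLabel}, L.Near i.val → L.spoke (i.val % 3) = l →
      L.Near (i + (corner s l : Z)).val ∧ (letterPerm s L).SameCycle i (i + (corner s l : Z)) := by
    rintro i _ hi rfl
    rw [← letterPerm_apply hi]
    exact ⟨near_letterPerm.2 hi, sameCycle_letterPerm_self i⟩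
  have hy : (∀ m, L.spoke m = .y) → (i.val % 2 = j.val % 2) →
      (letterPerm s L).SameCycle i j := fun hsp hpar => by
    have h1 := val_add_natCast_mod two_dvd i (j - i).val
    rw [hij] at h1
    have := (sameCycle_add_mul (P := fun i => L.Near i.val) (d := corner s .y)
      (fun i hi => hstep hi (hsp _)) hi ((j - i).val / 2)).2
    rwa [show (j - i).val / 2 * corner s .y = (j - i).val by simp only [corner]; omega,
      hij] at this
  cases L
  case x =>
    have := (sameCycle_add_mul (i := i) (P := fun _ => True) (d := corner s .x)
      (fun i _ => hstep trivial rfl) trivial (j - i).val).2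
    rwa [corner, mul_one, hij] at this
  case y₀ => exact hy (fun _ => rfl) (Eq.trans hi (Eq.symm hj))
  case y₁ => exact hy (fun _ => rfl) (Eq.trans hi (Eq.symm hj))
  all_goals
    refine sameCycle_letterPerm_of_three ?_ ?_ ?_ i j
    · exact fun _ => trivial
    all_goals
      intro m hm
      interval_cases m <;> simp [Letter.spoke, CornerLabel.next, cornerExcess]

theorem isCycleOn_letterPerm (L : Letter) :
    (letterPerm s L).IsCycleOn {i | L.Near i.val} :=
  ⟨Equiv.bijOn _ fun _ => near_letterPerm, fun _ hi _ hj => sameCycle_letterPerm L hi hj⟩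

/-! ### The derived embedding -/

/-- The graph of the derived embedding. -/
def derivedGraph (s : ℕ) : SimpleGraph (DerivedVertex (12 * s + 6)) where
  Adj
    | .inl i, .inl j => i ≠ j
    | .inl i, .inr L => L.Near i.val
    | .inr L, .inl i => L.Near i.val
    | .inr _, .inr _ => False
  symm := ⟨by rintro (i | L) (j | L') h <;> first | exact h | exact h.symm⟩
  loopless := ⟨by rintro (i | L) h <;> first | exact h | exact h rfl⟩

/-- The derived embedding of `orderThreeGraph s r`: the rotation at a number `i` is the translated
log, with each letter inserted behind its corner. No letter is adjacent to another one, so the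
rotation at a letter is subdivided by nothing. -/
def derived (hs : 1 ≤ s) (h : IsAdmissible s r) :
    RotationSystem (DerivedVertex (12 * s + 6)) where
  graph := derivedGraph s
  rot
    | .inl i => subdivide (numPerm r i) (letterMatching hs h i)
    | .inr L => subdivide (letterPerm s L) ⊥
  isCycleOn := by
    rintro (i | L)
    · have hp : ∀ j L, letterMatching hs h i j = some L → j ∈ ({i}ᶜ : Set Z) := by
        intro j L hj
        rw [letterMatching_eq_some_iff] at hj
        rw [hj.1]
        change ¬ _ = i
        rw [add_eq_left]
        exact corner_ne_zero _
      have hS : (derivedGraph s).neighborSet (.inl i) =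
          Sum.elim (· ∈ ({i}ᶜ : Set Z)) fun L => ∃ j, letterMatching hs h i j = some L := by
        ext (j | L)
        · exact ne_comm
        · change L.Near i.val ↔ ∃ j, letterMatching hs h i j = some L
          simp [letterMatching_eq_some_iff hs h]
      rw [hS]
      exact isCycleOn_subdivide (isCycleOn_numPerm h i) hp
    · have hS : (derivedGraph s).neighborSet (.inr L) =
          Sum.elim (· ∈ {i : Z | L.Near i.val}) fun L' => ∃ j, (⊥ : Z ≃. Letter) j = some L' := by
        ext (j | L')
        · exact Iff.rfl
        · change False ↔ ∃ j, (⊥ : Z ≃. Letter) j = some L'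
          simp
      rw [hS]
      exact isCycleOn_subdivide (isCycleOn_letterPerm L) (by simp)
  rot_of_not_adj := by
    rintro (i | L) (j | L') hn
    · obtain rfl : i = j := not_not.1 hn
      rw [subdivide_inl_of_none, numPerm_apply, sub_self, h.zero, add_zero]
      rw [Option.eq_none_iff_forall_ne_some]
      intro L hL
      rw [letterMatching_eq_some_iff, left_eq_add] at hL
      exact corner_ne_zero _ hL.1
    · refine subdivide_inr_of_none fun j hj => ?_
      rw [letterMatching_eq_some_iff] at hj
      exact hn hj.2
    · rw [subdivide_inl_of_none (by simp)]
      exact congrArg Sum.inl (if_neg hn)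
    · exact subdivide_inr_of_none (by simp)

theorem current_facePerm (h : IsAdmissible s r) {a : Z} (ha : a ≠ half s) :
    (orderThreeGraph s r).current ((orderThreeGraph s r).facePerm a) =
      r (-(orderThreeGraph s r).current a) := by
  have hr : ∀ b : Z, b ≠ 0 → r b ≠ 0 := fun b hb h0 => hb (r.injective (h0.trans h.zero.symm))
  change (orderThreeGraph s r).current (r ((orderThreeGraph s r).rev a)) = _
  by_cases h0 : a = 0
  · subst h0
    rw [rev_zero, current_zero, neg_half]
    exact current_of_ne (hr _ half_ne_zero)
  · rw [rev_of_ne h0 ha, current_of_ne h0]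
    exact current_of_ne (hr _ (neg_ne_zero.2 h0))

section Derived

variable (hs : 1 ≤ s) (h : IsAdmissible s r)

theorem derived_adj_num {i j : Z} : (derived hs h).graph.Adj (num i) (num j) ↔ i ≠ j := Iff.rfl

theorem derived_adj_lett {i : Z} {L : Letter} :
    (derived hs h).graph.Adj (num i) (lett _ L) ↔ L.Near i.val := Iff.rfl

theorem derived_rot_num_num {i j : Z} (hij : ∀ l, j ≠ i + (corner s l : Z)) :
    (derived hs h).rot (num i) (num j) = num (i + r (i - j)) := by
  rw [← numPerm_apply]
  refine subdivide_inl_of_none ?_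
  rw [Option.eq_none_iff_forall_ne_some]
  intro L hL
  rw [letterMatching_eq_some_iff] at hL
  exact hij _ hL.1

theorem derived_rot_num_lett {i : Z} {L : Letter} (hL : L.Near i.val) :
    (derived hs h).rot (num i) (lett _ L) =
      num (i - (corner s (L.spoke (i.val % 3)).next : Z)) := by
  refine (subdivide_inr_of_some ((letterMatching_eq_some_iff hs h).2 ⟨rfl, hL⟩)).trans ?_
  rw [numPerm_apply, sub_add_cancel_left, h.vortex, ← sub_eq_add_neg]

theorem derived_rot_num_corner {i : Z} {L : Letter} (hL : L.Near i.val) :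
    (derived hs h).rot (num i) (num (i + (corner s (L.spoke (i.val % 3)) : Z))) = lett _ L :=
  subdivide_inl_of_some ((letterMatching_eq_some_iff hs h).2 ⟨rfl, hL⟩)

theorem derived_rot_lett {i : Z} {L : Letter} (hL : L.Near i.val) :
    (derived hs h).rot (lett _ L) (num i) = num (i + (corner s (L.spoke (i.val % 3)) : Z)) := by
  rw [← letterPerm_apply hL]
  exact subdivide_inl_of_none (by simp)

/-- Every corner at a number is followed by a letter. -/
theorem exists_near_spoke (hs : 1 ≤ s) (h : IsAdmissible s r) (i : Z) (l : CornerLabel) :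
    ∃ L : Letter, L.Near i.val ∧ L.spoke (i.val % 3) = l := by
  have h1 := letterAt_corner hs h i l
  rw [letterAt_eq_some_iff hs h, natCast_corner_inj hs] at h1
  exact ⟨_, h1.2, h1.1.symm⟩

/-- A face through a corner of a vortex is a triangle with a letter; the other faces are triangles
by Kirchhoff's law. -/
theorem derived_isTriangular : (derived hs h).IsTriangular := by
  rw [RotationSystem.isTriangular_iff]
  rintro (j | L) (i | L') hadj
  · change j ≠ i at hadj
    by_cases hc : ∃ l, j = i + (corner s l : Z)
    · obtain ⟨l, rfl⟩ := hc
      obtain ⟨L, hL, rfl⟩ := exists_near_spoke hs h i l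
      exact (congrArg (fun v => (derived hs h).rot v (num i))
        (derived_rot_num_corner hs h hL)).trans (derived_rot_lett hs h hL)
    · push Not at hc
      have hk : ∀ l, i - j ≠ -(corner s l : Z) := fun l hl => hc l (by
        rw [sub_eq_iff_eq_add] at hl
        rw [hl]
        ring)
      refine (congrArg (fun v => (derived hs h).rot v (num i))
        (derived_rot_num_num hs h hc)).trans ?_
      rw [derived_rot_num_num]
      · have := h.kirchhoff _ hk
        congr 1
        rw [add_sub_cancel_left]
        linear_combination this
      · -- The next corner belongs to the same vertex of the current graph, which is no vortex.
        intro l hl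
        have hr : r (i - j) = -(corner s l : Z) := by linear_combination -hl
        rw [← next_next_next l, ← h.vortex] at hr
        exact hk _ (r.injective hr)
  · have hL : L'.Near j.val := hadj
    refine (congrArg (fun v => (derived hs h).rot v (lett _ L'))
      (derived_rot_lett hs h hL)).trans ?_
    rw [derived_rot_num_lett hs h ((near_add L' j).2 hL), spoke_add, add_sub_cancel_right]
  · have hL : L.Near i.val := hadj
    refine (congrArg (fun v => (derived hs h).rot v (num i))
      (derived_rot_num_lett hs h hL)).trans ?_
    have := derived_rot_num_corner hs h ((near_sub L i).2 hL)
    rwa [spoke_sub, sub_add_cancel] at this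
  · exact hadj.elim

theorem isDerived : (orderThreeGraph s r).IsDerived (derived hs h) where
  adj_num _ _ := Iff.rfl
  adj_lett i L := by
    rw [derived_adj_lett]
    constructor
    · exact fun hL => ⟨(corner s (L.spoke (i.val % 3)) : Z),
        (letterAt_eq_some_iff hs h).2 ⟨rfl, hL⟩⟩
    · rintro ⟨a, ha⟩
      exact ((letterAt_eq_some_iff hs h).1 ha).2
  not_adj _ _ := id
  rot_num i (a : Z) ha hfree := by
    have hah : a ≠ half s := by
      rintro rfl
      exact hfree ((isFreeEnd_iff hs h).2 rev_half)
    rw [current_facePerm h hah, derived_rot_num_num, sub_add_cancel_left]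
    intro l hl
    rw [add_right_inj] at hl
    have hal : a = (corner s l : Z) := by
      by_cases h0 : a = 0
      · rw [h0, current_zero] at hl
        exact absurd hl.symm (corner_ne_half hs l)
      · rwa [current_of_ne h0] at hl
    rw [hal, letterAt_corner hs h] at ha
    cases ha
  rot_num_lett i (a : Z) L ha := by
    obtain ⟨rfl, hL⟩ := (letterAt_eq_some_iff hs h).1 ha
    rw [current_facePerm h (corner_ne_half hs _), current_corner, h.vortex, ← sub_eq_add_neg]
    exact ⟨derived_rot_num_corner hs h hL, derived_rot_num_lett hs h hL, derived_rot_lett hs h hL⟩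

end Derived

end OrderThree

/-! ### The rotations of the current graphs -/

namespace OrderThree

/-- The rotation of the current graph for `s ≥ 2`, on representatives of arcs whose tails belong to
the four families of vertices, with outgoing currents that are sent by the rotation as follows
(to be read cyclically): `9s + 4 + 3k → 12s - 6k → 3s + 8 + 3k` for `k < s`, and
`9s - 2 - 3k → 9 + 6k → 3s - 1 - 3k`, `3k + 4 → 6s + 8 + 3k → 6s - 6 - 6k`,
`6s - 2 - 3k → 12s - 1 - 3k → 6s + 15 + 6k` for `k < s - 1`. -/
def familySucc (s x : ℕ) : ℕ :=
  if x % 3 = 1 then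
    if x < 3 * s then x + 6 * s + 4
    else if x < 6 * s then x + 6 * s + 1
    else if x < 9 * s then 18 * s + 5 - 2 * x
    else 30 * s + 8 - 2 * x
  else if x % 3 = 2 then
    if x < 3 * s then x + 6 * s - 1
    else if x < 6 * s + 6 then x + 6 * s - 4
    else if x < 9 * s + 3 then 18 * s + 10 - 2 * x
    else 30 * s + 13 - 2 * x
  else if x % 2 = 0 then
    if x < 6 * s then 3 * s + 1 - x / 2 else 9 * s + 8 - x / 2
  else
    if x < 6 * s then 3 * s + 3 - x / 2 else 9 * s + 5 - x / 2

/-- The rotation of the current graph for `s ≥ 2`, on representatives. Besides the families, there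
are the vertices of degree 1, the two vortices of type (V3) and two further vertices, with
outgoing currents `3`, `6 * s`, `6 * s + 3` and `6 * s + 1`, `12 * s + 2`, `6 * s + 9`. -/
def succArc (s x : ℕ) : ℕ :=
  if x = 0 ∨ 12 * s + 4 ≤ x then x
  else if x = 1 then 9 * s + 1 else if x = 9 * s + 1 then 3 * s + 1 else if x = 3 * s + 1 then 1
  else if x = 2 then 3 * s + 5 else if x = 3 * s + 5 then 3 * s + 2 else if x = 3 * s + 2 then 2
  else if x = 3 then 6 * s else if x = 6 * s then 6 * s + 3 else if x = 6 * s + 3 then 3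
  else if x = 6 * s + 1 then 12 * s + 2 else if x = 12 * s + 2 then 6 * s + 9
  else if x = 6 * s + 9 then 6 * s + 1
  else familySucc s x

section Families

variable {s k : ℕ}

theorem succArc_eq_familySucc {x : ℕ} (h : ¬ ((x = 0 ∨ 12 * s + 4 ≤ x) ∨ x = 1 ∨ x = 9 * s + 1 ∨
    x = 3 * s + 1 ∨ x = 2 ∨ x = 3 * s + 5 ∨ x = 3 * s + 2 ∨ x = 3 ∨ x = 6 * s ∨ x = 6 * s + 3 ∨
    x = 6 * s + 1 ∨ x = 12 * s + 2 ∨ x = 6 * s + 9)) : succArc s x = familySucc s x := by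
  push Not at h
  obtain ⟨h0, h1, h2, h3, h4, h5, h6, h7, h8, h9, h10, h11, h12⟩ := h
  rw [succArc, if_neg (by omega), if_neg h1, if_neg h2, if_neg h3, if_neg h4, if_neg h5, if_neg h6,
    if_neg h7, if_neg h8, if_neg h9, if_neg h10, if_neg h11, if_neg h12]

theorem succArc_exceptional (hs : 2 ≤ s) :
    (succArc s 1 = 9 * s + 1 ∧ succArc s (9 * s + 1) = 3 * s + 1 ∧ succArc s (3 * s + 1) = 1) ∧
    (succArc s 2 = 3 * s + 5 ∧ succArc s (3 * s + 5) = 3 * s + 2 ∧ succArc s (3 * s + 2) = 2) ∧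
    (succArc s 3 = 6 * s ∧ succArc s (6 * s) = 6 * s + 3 ∧ succArc s (6 * s + 3) = 3) ∧
    succArc s (6 * s + 1) = 12 * s + 2 ∧ succArc s (12 * s + 2) = 6 * s + 9 ∧
      succArc s (6 * s + 9) = 6 * s + 1 := by
  refine ⟨⟨?_, ?_, ?_⟩, ⟨?_, ?_, ?_⟩, ⟨?_, ?_, ?_⟩, ?_, ?_, ?_⟩
  · rw [succArc, if_neg, if_pos] <;> omega
  · rw [succArc, if_neg, if_neg, if_pos] <;> omega
  · rw [succArc, if_neg, if_neg, if_neg, if_pos] <;> omega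
  · rw [succArc, if_neg, if_neg, if_neg, if_neg, if_pos] <;> omega
  · rw [succArc, if_neg, if_neg, if_neg, if_neg, if_neg, if_pos] <;> omega
  · rw [succArc, if_neg, if_neg, if_neg, if_neg, if_neg, if_neg, if_pos] <;> omega
  · rw [succArc, if_neg, if_neg, if_neg, if_neg, if_neg, if_neg, if_neg, if_pos] <;> omega
  · rw [succArc, if_neg, if_neg, if_neg, if_neg, if_neg, if_neg, if_neg, if_neg, if_pos] <;> omega
  · rw [succArc, if_neg, if_neg, if_neg, if_neg, if_neg, if_neg, if_neg, if_neg, if_neg,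
      if_pos] <;> omega
  · rw [succArc, if_neg, if_neg, if_neg, if_neg, if_neg, if_neg, if_neg, if_neg, if_neg, if_neg,
      if_pos] <;> omega
  · rw [succArc, if_neg, if_neg, if_neg, if_neg, if_neg, if_neg, if_neg, if_neg, if_neg, if_neg,
      if_neg, if_pos] <;> omega
  · rw [succArc, if_neg, if_neg, if_neg, if_neg, if_neg, if_neg, if_neg, if_neg, if_neg, if_neg,
      if_neg, if_neg, if_pos] <;> omega

theorem succArc_fixed {x : ℕ} (hx : x = 0 ∨ 12 * s + 4 ≤ x) : succArc s x = x := if_pos hx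

theorem succArc_A₁ (hk : k < s) (hs : 2 ≤ s) :
    succArc s (9 * s + 4 + 3 * k) = 12 * s - 6 * k := by
  rw [succArc_eq_familySucc (by omega), familySucc]
  split_ifs <;> omega

theorem succArc_A₂ (hk : k < s) (hs : 2 ≤ s) :
    succArc s (12 * s - 6 * k) = 3 * s + 8 + 3 * k := by
  rw [succArc_eq_familySucc (by omega), familySucc]
  split_ifs <;> omega

theorem succArc_A₃ (hk : k < s) (hs : 2 ≤ s) :
    succArc s (3 * s + 8 + 3 * k) = 9 * s + 4 + 3 * k := by
  rw [succArc_eq_familySucc (by omega), familySucc]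
  split_ifs <;> omega

theorem succArc_B₁ (hk : k + 1 < s) :
    succArc s (9 * s - 2 - 3 * k) = 9 + 6 * k := by
  rw [succArc_eq_familySucc (by omega), familySucc]
  split_ifs <;> omega

theorem succArc_B₂ (hk : k + 1 < s) :
    succArc s (9 + 6 * k) = 3 * s - 1 - 3 * k := by
  rw [succArc_eq_familySucc (by omega), familySucc]
  split_ifs <;> omega

theorem succArc_B₃ (hk : k + 1 < s) :
    succArc s (3 * s - 1 - 3 * k) = 9 * s - 2 - 3 * k := by
  rw [succArc_eq_familySucc (by omega), familySucc]
  split_ifs <;> omega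

theorem succArc_C₁ (hk : k + 1 < s) :
    succArc s (3 * k + 4) = 6 * s + 8 + 3 * k := by
  rw [succArc_eq_familySucc (by omega), familySucc]
  split_ifs <;> omega

theorem succArc_C₂ (hk : k + 1 < s) :
    succArc s (6 * s + 8 + 3 * k) = 6 * s - 6 - 6 * k := by
  rw [succArc_eq_familySucc (by omega), familySucc]
  split_ifs <;> omega

theorem succArc_C₃ (hk : k + 1 < s) :
    succArc s (6 * s - 6 - 6 * k) = 3 * k + 4 := by
  rw [succArc_eq_familySucc (by omega), familySucc]
  split_ifs <;> omega

theorem succArc_D₁ (hk : k + 1 < s) :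
    succArc s (6 * s - 2 - 3 * k) = 12 * s - 1 - 3 * k := by
  rw [succArc_eq_familySucc (by omega), familySucc]
  split_ifs <;> omega

theorem succArc_D₂ (hk : k + 1 < s) :
    succArc s (12 * s - 1 - 3 * k) = 6 * s + 15 + 6 * k := by
  rw [succArc_eq_familySucc (by omega), familySucc]
  split_ifs <;> omega

theorem succArc_D₃ (hk : k + 1 < s) :
    succArc s (6 * s + 15 + 6 * k) = 6 * s - 2 - 3 * k := by
  rw [succArc_eq_familySucc (by omega), familySucc]
  split_ifs <;> omega

/-- To prove a statement about all arcs, it suffices to treat the arcs with exceptional tails and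
the members of the families. -/
theorem arc_cases (hs : 2 ≤ s) {P : ℕ → Prop}
    (free : P 0) (vx : P (12 * s + 5)) (vy : P (12 * s + 4))
    (abc : P 1 ∧ P (9 * s + 1) ∧ P (3 * s + 1)) (uvw : P 2 ∧ P (3 * s + 5) ∧ P (3 * s + 2))
    (t : P 3 ∧ P (6 * s) ∧ P (6 * s + 3)) (j : P (6 * s + 1) ∧ P (12 * s + 2) ∧ P (6 * s + 9))
    (A : ∀ k < s, P (9 * s + 4 + 3 * k) ∧ P (12 * s - 6 * k) ∧ P (3 * s + 8 + 3 * k))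
    (B : ∀ k, k + 1 < s → P (9 * s - 2 - 3 * k) ∧ P (9 + 6 * k) ∧ P (3 * s - 1 - 3 * k))
    (C : ∀ k, k + 1 < s → P (3 * k + 4) ∧ P (6 * s + 8 + 3 * k) ∧ P (6 * s - 6 - 6 * k))
    (D : ∀ k, k + 1 < s → P (6 * s - 2 - 3 * k) ∧ P (12 * s - 1 - 3 * k) ∧ P (6 * s + 15 + 6 * k))
    {x : ℕ} (hx : x < 12 * s + 6) : P x := by
  have of_eq : ∀ {y}, P y → y = x → P x := by rintro y hy rfl; exact hy
  by_cases h0 : x = 0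
  · exact of_eq free h0.symm
  by_cases h5 : x = 12 * s + 5
  · exact of_eq vx h5.symm
  by_cases h4 : x = 12 * s + 4
  · exact of_eq vy h4.symm
  by_cases h1 : x % 3 = 1
  · by_cases e1 : x = 1
    · exact of_eq abc.1 e1.symm
    by_cases e2 : x = 9 * s + 1
    · exact of_eq abc.2.1 e2.symm
    by_cases e3 : x = 3 * s + 1
    · exact of_eq abc.2.2 e3.symm
    by_cases e4 : x = 6 * s + 1
    · exact of_eq j.1 e4.symm
    by_cases h3 : x < 3 * s
    · exact of_eq (C ((x - 4) / 3) (by omega)).1 (by omega)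
    by_cases h6 : x < 6 * s
    · exact of_eq (D ((6 * s - 2 - x) / 3) (by omega)).1 (by omega)
    by_cases h9 : x < 9 * s
    · exact of_eq (B ((9 * s - 2 - x) / 3) (by omega)).1 (by omega)
    · exact of_eq (A ((x - (9 * s + 4)) / 3) (by omega)).1 (by omega)
  by_cases h2 : x % 3 = 2
  · by_cases e1 : x = 2
    · exact of_eq uvw.1 e1.symm
    by_cases e2 : x = 3 * s + 5
    · exact of_eq uvw.2.1 e2.symm
    by_cases e3 : x = 3 * s + 2
    · exact of_eq uvw.2.2 e3.symm
    by_cases e4 : x = 12 * s + 2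
    · exact of_eq j.2.1 e4.symm
    by_cases h3 : x < 3 * s
    · exact of_eq (B ((3 * s - 1 - x) / 3) (by omega)).2.2 (by omega)
    by_cases h6 : x < 6 * s + 6
    · exact of_eq (A ((x - (3 * s + 8)) / 3) (by omega)).2.2 (by omega)
    by_cases h9 : x < 9 * s + 3
    · exact of_eq (C ((x - (6 * s + 8)) / 3) (by omega)).2.1 (by omega)
    · exact of_eq (D ((12 * s - 1 - x) / 3) (by omega)).2.1 (by omega)
  by_cases h6 : x % 2 = 0
  · by_cases e1 : x = 6 * s
    · exact of_eq t.2.1 e1.symm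
    by_cases h3 : x < 6 * s
    · exact of_eq (C ((6 * s - 6 - x) / 6) (by omega)).2.2 (by omega)
    · exact of_eq (A ((12 * s - x) / 6) (by omega)).2.1 (by omega)
  · by_cases e1 : x = 3
    · exact of_eq t.1 e1.symm
    by_cases e2 : x = 6 * s + 3
    · exact of_eq t.2.2 e2.symm
    by_cases e3 : x = 6 * s + 9
    · exact of_eq j.2.2 e3.symm
    by_cases h3 : x < 6 * s
    · exact of_eq (B ((x - 9) / 6) (by omega)).2.1 (by omega)
    · exact of_eq (D ((x - (6 * s + 15)) / 6) (by omega)).2.2 (by omega)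

/-- The local properties of the rotation at the arc `x`. -/
structure IsRegular (s x : ℕ) : Prop where
  lt : succArc s x < 12 * s + 6
  cube : succArc s (succArc s (succArc s x)) = x
  fixed : succArc s x = x → x = 0 ∨ x = 12 * s + 5 ∨ x = 12 * s + 4
  kirchhoff : (∃ l, x + corner s l = 12 * s + 6) ∨
    ∃ m, x + succArc s x + succArc s (succArc s x) = (12 * s + 6) * m

/-- A vertex of degree 3 that satisfies Kirchhoff's law. -/
theorem isRegular_triple {x y z m : ℕ} (hx : x < 12 * s + 6) (hy : y < 12 * s + 6)
    (hz : z < 12 * s + 6) (hxy : succArc s x = y) (hyz : succArc s y = z) (hzx : succArc s z = x)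
    (hne : x ≠ y) (hm : x + y + z = (12 * s + 6) * m) :
    IsRegular s x ∧ IsRegular s y ∧ IsRegular s z := by
  have h1 : y ≠ z := fun h => hne (by rw [← hzx, ← h, hyz, h])
  have h2 : z ≠ x := fun h => hne (by rw [← hxy, ← h, hzx, h])
  refine ⟨⟨?_, ?_, ?_, .inr ⟨m, ?_⟩⟩, ⟨?_, ?_, ?_, .inr ⟨m, ?_⟩⟩, ⟨?_, ?_, ?_, .inr ⟨m, ?_⟩⟩⟩ <;>
    simp only [hxy, hyz, hzx] <;> omega

/-- A vortex of type (V3). -/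
theorem isRegular_vortex {l : CornerLabel} {x y z : ℕ} (hx : x + corner s l = 12 * s + 6)
    (hy : y + corner s l.next = 12 * s + 6) (hz : z + corner s l.next.next = 12 * s + 6)
    (hxy : succArc s x = y) (hyz : succArc s y = z) (hzx : succArc s z = x) (hne : x ≠ y) :
    IsRegular s x ∧ IsRegular s y ∧ IsRegular s z := by
  have h1 : y ≠ z := fun h => hne (by rw [← hzx, ← h, hyz, h])
  have h2 : z ≠ x := fun h => hne (by rw [← hxy, ← h, hzx, h])
  have hpos : ∀ l, 0 < corner s l := fun l => by cases l <;> simp [corner]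
  have p1 := hpos l
  have p2 := hpos l.next
  have p3 := hpos l.next.next
  refine ⟨⟨?_, ?_, ?_, .inl ⟨_, hx⟩⟩, ⟨?_, ?_, ?_, .inl ⟨_, hy⟩⟩, ⟨?_, ?_, ?_, .inl ⟨_, hz⟩⟩⟩ <;>
    simp only [hxy, hyz, hzx] <;> omega

theorem isRegular (hs : 2 ≤ s) {x : ℕ} (hx : x < 12 * s + 6) : IsRegular s x := by
  obtain ⟨⟨a1, a2, a3⟩, ⟨u1, u2, u3⟩, ⟨t1, t2, t3⟩, j1, j2, j3⟩ := succArc_exceptional hs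
  have hfix : ∀ x, x = 0 ∨ x = 12 * s + 5 ∨ x = 12 * s + 4 →
      ((∃ l, x + corner s l = 12 * s + 6) ∨ x = 0) → IsRegular s x := fun x h h' => by
    have e : succArc s x = x := succArc_fixed (by omega)
    refine ⟨by omega, by simp only [e], fun _ => h, ?_⟩
    rcases h' with h' | rfl
    · exact .inl h'
    · exact .inr ⟨0, by simp only [e]; omega⟩
  refine arc_cases hs (hfix _ (.inl rfl) (.inr rfl)) (hfix _ (.inr (.inl rfl)) (.inl ⟨.x, rfl⟩))
    (hfix _ (.inr (.inr rfl)) (.inl ⟨.y, rfl⟩)) ?_ ?_ ?_ ?_ (fun k hk => ?_) (fun k hk => ?_)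
    (fun k hk => ?_) (fun k hk => ?_) hx
  · exact isRegular_vortex (l := .a) (by simp only [corner]; omega)
      (by simp only [corner, CornerLabel.next]; omega)
      (by simp only [corner, CornerLabel.next]; omega) a1 a2 a3 (by omega)
  · exact isRegular_vortex (l := .v) (by simp only [corner]; omega)
      (by simp only [corner, CornerLabel.next]; omega)
      (by simp only [corner, CornerLabel.next]; omega) u1 u2 u3 (by omega)
  · exact isRegular_triple (m := 1) (by omega) (by omega) (by omega) t1 t2 t3 (by omega) (by omega)
  · exact isRegular_triple (m := 2) (by omega) (by omega) (by omega) j1 j2 j3 (by omega) (by omega)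
  · exact isRegular_triple (m := 2) (by omega) (by omega) (by omega) (succArc_A₁ hk hs)
      (succArc_A₂ hk hs) (succArc_A₃ hk hs) (by omega) (by omega)
  · exact isRegular_triple (m := 1) (by omega) (by omega) (by omega) (succArc_B₁ hk)
      (succArc_B₂ hk) (succArc_B₃ hk) (by omega) (by omega)
  · exact isRegular_triple (m := 1) (by omega) (by omega) (by omega) (succArc_C₁ hk)
      (succArc_C₂ hk) (succArc_C₃ hk) (by omega) (by omega)
  · exact isRegular_triple (m := 2) (by omega) (by omega) (by omega) (succArc_D₁ hk)
      (succArc_D₂ hk) (succArc_D₃ hk) (by omega) (by omega)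

end Families

/-- The rotation of the current graph for `s ≥ 2`. -/
def largeRot {s : ℕ} (hs : 2 ≤ s) : Perm (ZMod (12 * s + 6)) where
  toFun x := (succArc s x.val : ℕ)
  invFun x := (succArc s (succArc s x.val) : ℕ)
  left_inv x := by
    have h := isRegular hs x.val_lt
    beta_reduce
    rw [ZMod.val_natCast_of_lt h.lt, h.cube, ZMod.natCast_zmod_val]
  right_inv x := by
    have h := isRegular hs x.val_lt
    beta_reduce
    rw [ZMod.val_natCast_of_lt (isRegular hs h.lt).lt, h.cube, ZMod.natCast_zmod_val]

section LargeRot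

variable {s : ℕ} (hs : 2 ≤ s)

theorem largeRot_natCast {x : ℕ} (hx : x < 12 * s + 6) :
    largeRot hs (x : ZMod (12 * s + 6)) = (succArc s x : ℕ) := by
  change ((succArc s (x : ZMod (12 * s + 6)).val : ℕ) : ZMod (12 * s + 6)) = _
  rw [ZMod.val_natCast_of_lt hx]

theorem exists_natCast (x : ZMod (12 * s + 6)) : ∃ k < 12 * s + 6, x = (k : ℕ) :=
  ⟨x.val, x.val_lt, by simp⟩

/-- The face-boundary walk, starting from the arc `2`, runs through all arcs: it is composed of
four long regular runs and some transitional arcs. -/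
theorem sameCycle_largeRot {x : ℕ} (hx : x < 12 * s + 6) :
    (largeRot hs * (swap 0 (half s) * Equiv.neg _)).SameCycle ((2 : ℕ) : ZMod (12 * s + 6))
      (x : ℕ) := by
  obtain ⟨f, hf⟩ : ∃ f, f = largeRot hs * (swap 0 (half s) * Equiv.neg _) := ⟨_, rfl⟩
  rw [← hf]
  obtain ⟨P, hP⟩ : ∃ P : ℕ → Prop,
      P = fun x => f.SameCycle ((2 : ℕ) : ZMod (12 * s + 6)) (x : ℕ) := ⟨_, rfl⟩
  have hPx : ∀ x, P x ↔ f.SameCycle ((2 : ℕ) : ZMod (12 * s + 6)) (x : ℕ) := fun x => by rw [hP]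
  rw [← hPx]
  have happly : ∀ x y : ℕ, f x = y → P x → P y := fun x y h hx => by
    rw [hPx] at hx ⊢
    rw [← h]
    exact Perm.sameCycle_apply_right.2 hx
  have of_eq : ∀ {x y}, P x → x = y → P y := by rintro x _ h rfl; exact h
  -- The walk goes from `x` to its reverse `y` and on to the arc that follows `y` at its tail.
  have step : ∀ {x y z w : ℕ}, P x → succArc s y = z →
      x ≠ 0 ∧ x ≠ 6 * s + 3 ∧ y ≠ 0 ∧ x + y = 12 * s + 6 ∧ z = w → P w := by
    rintro x y z w h hz ⟨hx0, h3, hy, hxy, rfl⟩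
    refine happly x z ?_ h
    rw [hf, Perm.mul_apply, Perm.mul_apply, Equiv.neg_apply, neg_natCast_eq hxy,
      swap_apply_of_ne_of_ne, largeRot_natCast hs (by omega), hz]
    · rw [ne_eq, ZMod.natCast_eq_zero_iff]
      exact Nat.not_dvd_of_pos_of_lt (by omega) (by omega)
    · rw [half, Ne, natCast_eq_iff_of_lt (by omega) (by omega)]
      omega
  obtain ⟨⟨a1, a2, a3⟩, ⟨u1, u2, u3⟩, ⟨t1, t2, t3⟩, j1, j2, j3⟩ := succArc_exceptional hs
  have p_two : P 2 := (hPx 2).2 (.refl _ _)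
  have p_vy : P (12 * s + 4) :=
    step p_two (succArc_fixed (x := 12 * s + 4) (by omega)) (by omega)
  have p_c : P (3 * s + 5) :=
    step p_vy u1 (by omega)
  have p_k : P (3 * s + 1) :=
    step p_c a2 (by omega)
  have p_D : P (12 * s + 3) :=
    step p_k (succArc_D₂ (k := s - 2) (by omega)) (by omega)
  have p_t : P (6 * s) :=
    step p_D t1 (by omega)
  have p_A : P (6 * s + 5) :=
    step p_t (succArc_A₂ (k := s - 1) (by omega) hs) (by omega)
  have p_j : P (12 * s + 2) :=
    step p_A j1 (by omega)
  have run_CD : ∀ k, k + 1 < s → P (6 * s + 8 + 3 * k) ∧ P (12 * s - 1 - 3 * k) := by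
    intro k hk
    have run : P (6 * s + 8 + 3 * k) → P (6 * s + 8 + 3 * k) ∧ P (12 * s - 1 - 3 * k) := fun h =>
      ⟨h, step h (succArc_D₁ (k := k) (by omega)) (by omega)⟩
    induction k with
    | zero => exact run (step p_j (succArc_C₁ (k := 0) (by omega)) (by omega))
    | succ k ih =>
      have h := (ih (by omega) fun h =>
        ⟨h, step h (succArc_D₁ (k := k) (by omega)) (by omega)⟩).2
      exact run (step h (succArc_C₁ (k := k + 1) (by omega)) (by omega))
  have p_vx' : P 1 :=
    step (run_CD (s - 2) (by omega)).2 a3 (by omega)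
  have p_vx : P (12 * s + 5) :=
    step p_vx' (succArc_fixed (x := 12 * s + 5) (by omega)) (by omega)
  have p_w : P (9 * s + 1) :=
    step p_vx a1 (by omega)
  have p_b : P (3 * s + 2) :=
    step p_w u2 (by omega)
  have run_AB : ∀ k, k + 1 < s → P (12 * s - 6 * k) →
      P (3 * s - 2 - 3 * k) ∧ P (12 * s - 3 - 6 * k) ∧ P (3 * s - 1 - 3 * k) := by
    intro k hk h1
    have h2 : P (3 * s - 2 - 3 * k) :=
      step h1 (succArc_C₃ (k := s - 2 - k) (by omega)) (by omega)
    have h3 : P (12 * s - 3 - 6 * k) := by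
      by_cases hk' : k + 2 = s
      · exact step h2 j2 (by omega)
      · exact step h2 (succArc_D₂ (k := s - 3 - k) (by omega)) (by omega)
    exact ⟨h2, h3, step h3 (succArc_B₂ (k := k) (by omega)) (by omega)⟩
  have run_A : ∀ k < s, P (12 * s - 6 * k) := by
    intro k hk
    induction k with
    | zero => exact step p_b (succArc_A₁ (k := 0) (by omega) hs) (by omega)
    | succ k ih =>
      have h := (run_AB k (by omega) (ih (by omega))).2.2
      exact step h (succArc_A₁ (k := k + 1) (by omega) hs) (by omega)
  have p_h : P (6 * s + 3) :=
    step (run_A (s - 1) (by omega)) t2 (by omega)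
  have p_zero : P 0 := by
    refine happly (6 * s + 3) 0 ?_ p_h
    change f (half s) = _
    rw [hf, Perm.mul_apply, Perm.mul_apply, Equiv.neg_apply, neg_half, swap_apply_right,
      ← Nat.cast_zero, largeRot_natCast hs (by omega), succArc_fixed (.inl rfl)]
  have p_three : P 3 := by
    refine happly 0 3 ?_ p_zero
    rw [hf, Perm.mul_apply, Perm.mul_apply, Equiv.neg_apply, Nat.cast_zero, neg_zero,
      swap_apply_left, half, largeRot_natCast hs (by omega), t3]
  have run_BC : ∀ k, k + 1 < s → P (3 * s + 4 + 3 * k) →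
      P (6 + 6 * k) ∧ P (3 * s + 8 + 3 * k) ∧ P (9 + 6 * k) := by
    intro k hk h1
    have h2 : P (6 + 6 * k) :=
      step h1 (succArc_C₂ (k := s - 2 - k) (by omega)) (by omega)
    have h3 : P (3 * s + 8 + 3 * k) := step h2 (succArc_A₂ (k := k) (by omega) hs) (by omega)
    exact ⟨h2, h3, step h3 (succArc_B₁ (k := k) (by omega)) (by omega)⟩
  have run_D : ∀ k, k + 1 < s → P (3 * s + 4 + 3 * k) := by
    intro k hk
    induction k with
    | zero => exact step p_three (succArc_D₃ (k := s - 2) (by omega)) (by omega)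
    | succ k ih =>
      have h := (run_BC k (by omega) (ih (by omega))).2.2
      exact step h (succArc_D₃ (k := s - 3 - k) (by omega)) (by omega)
  have p_j' : P (6 * s + 1) :=
    step (run_BC (s - 2) (by omega) (run_D _ (by omega))).2.2 j3 (by omega)
  have p_A' : P (12 * s + 1) :=
    step p_j' (succArc_A₃ (k := s - 1) (by omega) hs) (by omega)
  have run_A' : ∀ k, k + 1 < s → P (6 * s + 4 + 3 * k) → P (12 * s - 2 - 3 * k) := by
    intro k hk h
    exact step h (succArc_A₃ (k := s - 2 - k) (by omega) hs) (by omega)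
  have run_B : ∀ k, k + 1 < s → P (6 * s + 4 + 3 * k) := by
    intro k hk
    induction k with
    | zero => exact step p_A' (succArc_B₃ (k := s - 2) (by omega)) (by omega)
    | succ k ih =>
      have h := run_A' k (by omega) (ih (by omega))
      exact step h (succArc_B₃ (k := s - 3 - k) (by omega)) (by omega)
  have h_AB := fun k hk => run_AB k hk (run_A k (by omega))
  have h_BC := fun k hk => run_BC k hk (run_D k hk)
  refine arc_cases hs p_zero p_vx p_vy ⟨p_vx', p_w, p_k⟩ ⟨p_two, p_c, p_b⟩
    ⟨p_three, p_t, p_h⟩ ⟨p_j', p_j, ?_⟩ (fun k hk => ⟨?_, run_A k hk, ?_⟩)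
    (fun k hk => ⟨?_, (h_BC k hk).2.2, (h_AB k hk).2.2⟩)
    (fun k hk => ⟨?_, (run_CD k hk).1, ?_⟩) (fun k hk => ⟨?_, (run_CD k hk).2, ?_⟩) hx
  · exact of_eq (h_AB (s - 2) (by omega)).2.1 (by omega)
  · by_cases hk' : k + 1 = s
    · exact of_eq p_A' (by omega)
    · exact of_eq (run_A' (s - 2 - k) (by omega) (run_B _ (by omega))) (by omega)
  · by_cases hk' : k + 1 = s
    · exact of_eq p_A (by omega)
    · exact (h_BC k (by omega)).2.1
  · exact of_eq (run_B (s - 2 - k) (by omega)) (by omega)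
  · exact of_eq (h_AB (s - 2 - k) (by omega)).1 (by omega)
  · exact of_eq (h_BC (s - 2 - k) (by omega)).1 (by omega)
  · exact of_eq (run_D (s - 2 - k) (by omega)) (by omega)
  · by_cases hk' : k + 2 = s
    · exact of_eq p_D (by omega)
    · exact of_eq (h_AB (s - 3 - k) (by omega)).2.1 (by omega)

theorem largeRot_neg_corner (l : CornerLabel) :
    largeRot hs (-(corner s l : ZMod (12 * s + 6))) = -(corner s l.next : ZMod (12 * s + 6)) := by
  obtain ⟨⟨a1, a2, a3⟩, ⟨u1, u2, u3⟩, -⟩ := succArc_exceptional hs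
  have hrot : ∀ {x y z w : ℕ}, x + y = 12 * s + 6 → z + w = 12 * s + 6 → y < 12 * s + 6 →
      succArc s y = w →
      largeRot hs (-(x : ZMod (12 * s + 6))) = -(z : ZMod (12 * s + 6)) := by
    intro x y z w hx hz hy h
    rw [neg_natCast_eq hx, neg_natCast_eq hz, largeRot_natCast hs hy, h]
  cases l <;> simp only [corner, CornerLabel.next]
  · exact hrot (by omega) (by omega) (by omega) a1
  · exact hrot (by omega) (by omega) (by omega) a3
  · exact hrot (by omega) (by omega) (by omega) a2
  · exact hrot (by omega) (by omega) (by omega) u3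
  · exact hrot (by omega) (by omega) (by omega) u1
  · exact hrot (by omega) (by omega) (by omega) u2
  · exact hrot (by omega) (by omega) (by omega) (succArc_fixed (x := 12 * s + 5) (by omega))
  · exact hrot (by omega) (by omega) (by omega) (succArc_fixed (x := 12 * s + 4) (by omega))

theorem isAdmissible_largeRot : IsAdmissible s (largeRot hs) where
  cube x := by
    obtain ⟨k, hk, rfl⟩ := exists_natCast x
    have h := isRegular hs hk
    rw [largeRot_natCast hs hk, largeRot_natCast hs h.lt,
      largeRot_natCast hs (isRegular hs h.lt).lt, h.cube]
  fixed x hx := by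
    obtain ⟨k, hk, rfl⟩ := exists_natCast x
    have h := isRegular hs hk
    rw [largeRot_natCast hs hk, natCast_eq_iff_of_lt h.lt hk] at hx
    rcases h.fixed hx with rfl | rfl | rfl
    · exact .inl Nat.cast_zero
    · rw [neg_one_eq]
      exact .inr (.inl (neg_natCast_eq (by simp only [corner]; omega)).symm)
    · rw [neg_two_eq]
      exact .inr (.inr (neg_natCast_eq (by simp only [corner]; omega)).symm)
  zero := by
    rw [← Nat.cast_zero, largeRot_natCast hs (by omega), succArc_fixed (.inl rfl)]
  vortex := largeRot_neg_corner hs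
  kirchhoff x hx := by
    obtain ⟨k, hk, rfl⟩ := exists_natCast x
    have h := isRegular hs hk
    rw [largeRot_natCast hs hk, largeRot_natCast hs h.lt, ← Nat.cast_add, ← Nat.cast_add]
    rcases h.kirchhoff with ⟨l, hl⟩ | ⟨m, hm⟩
    · exact absurd (neg_natCast_eq ((add_comm _ _).trans hl)).symm (hx l)
    · rw [hm, Nat.cast_mul, ZMod.natCast_self, zero_mul]
  cycle a b := by
    obtain ⟨k, hk, rfl⟩ := exists_natCast a
    obtain ⟨l, hl, rfl⟩ := exists_natCast b
    exact (sameCycle_largeRot hs hk).symm.trans (sameCycle_largeRot hs hl)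

end LargeRot

/-- The rotation of the current graph for `s = 1`: the successors of the arcs `0, 1, …, 17`. -/
def smallTable : ZMod (12 * 1 + 6) → ZMod (12 * 1 + 6) :=
  (![0, 10, 8, 9, 1, 2, 3, 15, 5, 6, 4, 12, 13, 11, 7, 14, 16, 17] : Fin 18 → Fin 18)

theorem smallTable_cube : ∀ x, smallTable (smallTable (smallTable x)) = x := by decide

/-- The rotation of the current graph for `s = 1`. -/
def smallRot : Perm (ZMod (12 * 1 + 6)) where
  toFun := smallTable
  invFun x := smallTable (smallTable x)
  left_inv := smallTable_cube
  right_inv := smallTable_cube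

theorem isAdmissible_smallRot : IsAdmissible 1 smallRot where
  cube := smallTable_cube
  fixed := by decide
  zero := by decide
  vortex l := by cases l <;> decide
  kirchhoff := by
    have : ∀ x : ZMod (12 * 1 + 6), (x + smallRot x + smallRot (smallRot x) = 0) ∨
        ∃ l ∈ [CornerLabel.a, .b, .c, .u, .v, .w, .x, .y],
          x = -(corner 1 l : ZMod (12 * 1 + 6)) := by
      decide
    intro x hx
    rcases this x with h | ⟨l, -, h⟩
    · exact h
    · exact absurd h (hx l)
  cycle := by
    obtain ⟨f, hf⟩ : ∃ f : Perm (ZMod (12 * 1 + 6)),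
        f = smallRot * (swap 0 (half 1) * Equiv.neg _) := ⟨_, rfl⟩
    have h : ∀ a, ∃ k : Fin 18, (f ^ (k : ℕ)) 0 = a := by
      rw [hf]
      decide
    have h' : ∀ a, f.SameCycle 0 a := fun a => by
      obtain ⟨k, rfl⟩ := h a
      exact Perm.sameCycle_pow_right.2 (.refl _ _)
    rw [← hf]
    exact fun a b => (h' a).symm.trans (h' b)

end OrderThree

/-! ### Edge flips and handles at the vertex `0` -/

namespace RotationSystem

/-- If `r`, `q`, `t` are consecutive in the rotation at `o`, the edge `oq` of a triangular embedding
can be flipped to `rt`. -/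
theorem exists_edgeFlip_of_rot {V : Type*} [DecidableEq V] [Finite V] {M : RotationSystem V}
    (hM : M.IsTriangular) {o q r t : V} (hro : M.graph.Adj r o) (h₁ : M.rot o r = q)
    (h₂ : M.rot o q = t) (hrt : r ≠ t) (hn : ¬ M.graph.Adj r t) :
    ∃ N, M.EdgeFlip N o q r t ∧ N.IsTriangular ∧ N.rot o r = t ∧
      (∀ x, x ≠ r → x ≠ q → N.rot o x = M.rot o x) ∧
      N.rot q = M.rot q * swap ((M.rot q).symm o) o ∧
      ∀ y, y ≠ o → y ≠ q → y ≠ r → y ≠ t → N.rot y = M.rot y := by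
  have hoq : M.graph.Adj o q := h₁ ▸ M.adj_rot hro.symm
  have t₂ := hM.isTriangle hoq.symm h₂
  obtain ⟨N, hN⟩ := exists_edgeFlip (hM.isTriangle hro h₁).rotate t₂ hrt hn
  refine ⟨N, hN, hN.isTriangular hM, ?_, fun x hr hq => ?_, ?_, hN.2.2.2.2.2.2.2.2.2⟩
  · rw [hN.2.2.2.2.2.1, Perm.mul_apply, swap_apply_left, h₂]
  · rw [hN.2.2.2.2.2.1, Perm.mul_apply, swap_apply_of_ne_of_ne hr hq]
  · rw [hN.2.2.2.2.2.2.1, (symm_apply_eq _).2 t₂.2.2.2.symm]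

end RotationSystem

/-- The nine letters, listed. -/
instance : Fintype Letter :=
  ⟨{.a, .b, .c, .u, .v, .w, .x, .y₀, .y₁}, fun L => by cases L <;> decide⟩

namespace OrderThree

variable {s : ℕ} {r : Perm (ZMod (12 * s + 6))} (hs : 1 ≤ s) (h : IsAdmissible s r)

local notation "Z" => ZMod (12 * s + 6)

theorem derived_rot_zero_lett {L : Letter} (hL : L.Near 0) :
    (derived hs h).rot (num 0) (lett _ L) = num (-(corner s (L.spoke 0).next : Z)) := by
  have := derived_rot_num_lett hs h (i := 0) (L := L) (by rwa [ZMod.val_zero])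
  rwa [ZMod.val_zero, zero_sub] at this

theorem derived_rot_zero_corner {L : Letter} (hL : L.Near 0) :
    (derived hs h).rot (num 0) (num (corner s (L.spoke 0) : Z)) = lett _ L := by
  have := derived_rot_num_corner hs h (i := 0) (L := L) (by rwa [ZMod.val_zero])
  rwa [ZMod.val_zero, zero_add] at this

/-- The pairs of letters that the edge flips make adjacent. -/
def flippedPairs : List (Letter × Letter) :=
  [(.u, .y₀), (.y₀, .u), (.v, .c), (.c, .v), (.a, .w), (.w, .a), (.b, .x), (.x, .b)]

/-- The labels of the corners that follow `δ`, `γ`, `-γ` and `ε` in the log. -/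
def flippedCorners : List CornerLabel := [.y, .c, .w, .x]

/-- What the edge flips make of the derived embedding. Near `0` the rotation has become
`(… u y₀ -δ v c … b x -ε a w …)`, where `-δ` and `-ε` are the corners labelled `v` and `a`; at the
other numbers at most `0` has been removed. -/
structure IsFlipped (hs : 1 ≤ s) (h : IsAdmissible s r)
    (M : RotationSystem (DerivedVertex (12 * s + 6))) : Prop where
  isTriangular : M.IsTriangular
  rot_u : M.rot (num 0) (lett _ .u) = lett _ .y₀
  rot_y : M.rot (num 0) (lett _ .y₀) = num (corner s .v : Z)
  rot_D : M.rot (num 0) (num (corner s .v : Z)) = lett _ .v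
  rot_v : M.rot (num 0) (lett _ .v) = lett _ .c
  rot_b : M.rot (num 0) (lett _ .b) = lett _ .x
  rot_x : M.rot (num 0) (lett _ .x) = num (corner s .a : Z)
  rot_E : M.rot (num 0) (num (corner s .a : Z)) = lett _ .a
  rot_a : M.rot (num 0) (lett _ .a) = lett _ .w
  rot_num : ∀ i : Z, i ≠ 0 → M.rot (num i) = (derived hs h).rot (num i) ∨
    M.rot (num i) = (derived hs h).rot (num i) *
      swap (((derived hs h).rot (num i)).symm (num 0)) (num 0)
  adj_num : ∀ i j : Z, M.graph.Adj (num i) (num j) ↔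
    i ≠ j ∧ (i = 0 → ∀ l ∈ flippedCorners, j ≠ (corner s l : Z)) ∧
      (j = 0 → ∀ l ∈ flippedCorners, i ≠ (corner s l : Z))
  adj_num_lett : ∀ (i : Z) L, M.graph.Adj (num i) (lett _ L) ↔ L.Near i.val
  adj_lett : ∀ L L', M.graph.Adj (lett _ L) (lett _ L') ↔ (L, L') ∈ flippedPairs

theorem neg_corner_eq {l l' : CornerLabel} (h : corner s l + corner s l' = 12 * s + 6) :
    -(corner s l : Z) = (corner s l' : Z) := neg_natCast_eq h

set_option maxHeartbeats 800000 in
/-- The four edges are flipped one after the other. Each of them is followed by a letter in the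
rotation at `0` and preceded by one, and these two letters become adjacent. -/
theorem exists_fourFlips : ∃ M₁, FourFlips (corner s .c : Z) (corner s .y : Z) (corner s .x : Z)
    (derived hs h) M₁ ∧ IsFlipped hs h M₁ := by
  have eγ : -(corner s .c : Z) = (corner s .w : Z) :=
    neg_corner_eq (by simp only [corner]; omega)
  have hD := derived_isTriangular hs h
  have hzero : ∀ {L : Letter} {l : CornerLabel}, L.Near 0 →
      corner s (L.spoke 0).next + corner s l = 12 * s + 6 →
      (derived hs h).rot (num 0) (lett _ L) = num (corner s l : Z) := fun hL hl => by
    rw [derived_rot_zero_lett hs h hL, neg_corner_eq hl]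
  have r1 := hzero (L := .u) (l := .y) trivial rfl
  have r2 := derived_rot_zero_corner hs h (L := .y₀) rfl
  have r3 := hzero (L := .y₀) (l := .v) rfl (by
    simp only [corner, Letter.spoke, CornerLabel.next]; omega)
  have r4 := derived_rot_zero_corner hs h (L := .v) trivial
  have r5 := hzero (L := .v) (l := .c) trivial (by
    simp only [corner, Letter.spoke, CornerLabel.next, Function.iterate_zero, id, mul_zero]; omega)
  have r6 := derived_rot_zero_corner hs h (L := .c) trivial
  have r7 := hzero (L := .b) (l := .x) trivial rfl
  have r8 := derived_rot_zero_corner hs h (L := .x) trivial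
  have r9 := hzero (L := .x) (l := .a) trivial (by
    simp only [corner, Letter.spoke, CornerLabel.next]; omega)
  have r10 := derived_rot_zero_corner hs h (L := .a) trivial
  have r11 := hzero (L := .a) (l := .w) trivial (by
    simp only [corner, Letter.spoke, CornerLabel.next, Function.iterate_zero, id]; omega)
  have r12 := derived_rot_zero_corner hs h (L := .w) trivial
  simp only [Letter.spoke, Function.iterate_zero, id, mul_zero] at r2 r4 r6 r8 r10 r12
  have hc : ∀ l l' : CornerLabel, (corner s l : Z) = corner s l' ↔ l = l' := fun _ _ =>
    natCast_corner_inj hs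
  have hc0 : ∀ l : CornerLabel, (corner s l : Z) ≠ 0 := corner_ne_zero
  have hnear : ∀ L : Letter, L ≠ .y₁ → (derived hs h).graph.Adj (lett _ L) (num 0) := by
    intro L hL
    refine ((derived_adj_lett hs h).2 ?_).symm
    rw [ZMod.val_zero]
    cases L <;> trivial
  have hll : ∀ L L', ¬ (derived hs h).graph.Adj (lett _ L) (lett _ L') := fun _ _ => id
  obtain ⟨F₁, f₁, T₁, z₁, k₁, q₁, o₁⟩ := RotationSystem.exists_edgeFlip_of_rot hD
    (hnear .u (by decide)) r1 r2 (by simp) (hll _ _)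
  have e₁ := fun x y => f₁.adj_iff (x := x) (y := y)
  obtain ⟨F₂, f₂, T₂, z₂, k₂, q₂, o₂⟩ := RotationSystem.exists_edgeFlip_of_rot T₁
    (r := lett _ .v) (o := num 0) (q := num (corner s .c : Z)) (t := lett _ .c)
    (by rw [e₁]; simp [hnear]) (by rw [k₁, r5] <;> simp) (by rw [k₁, r6] <;> simp [hc])
    (by simp) (by rw [e₁]; simp [hll])
  have e₂ := fun x y => f₂.adj_iff (x := x) (y := y)
  obtain ⟨F₃, f₃, T₃, z₃, k₃, q₃, o₃⟩ := RotationSystem.exists_edgeFlip_of_rot T₂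
    (r := lett _ .a) (o := num 0) (q := num (corner s .w : Z)) (t := lett _ .w)
    (by rw [e₂, e₁]; simp [hnear]) (by rw [k₂, k₁, r11] <;> simp)
    (by rw [k₂, k₁, r12] <;> simp [hc]) (by simp) (by rw [e₂, e₁]; simp [hll])
  have e₃ := fun x y => f₃.adj_iff (x := x) (y := y)
  obtain ⟨M₁, f₄, T₄, z₄, k₄, q₄, o₄⟩ := RotationSystem.exists_edgeFlip_of_rot T₃
    (r := lett _ .b) (o := num 0) (q := num (corner s .x : Z)) (t := lett _ .x)
    (by rw [e₃, e₂, e₁]; simp [hnear]) (by rw [k₃, k₂, k₁, r7] <;> simp)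
    (by rw [k₃, k₂, k₁, r8] <;> simp [hc]) (by simp) (by rw [e₃, e₂, e₁]; simp [hll])
  have e₄ := fun x y => f₄.adj_iff (x := x) (y := y)
  refine ⟨M₁, ⟨F₁, F₂, F₃, f₁, f₂, by rwa [eγ], f₄⟩, T₄, ?_, ?_, ?_, ?_, z₄, ?_, ?_, ?_, ?_,
    ?_, ?_, ?_⟩
  · rw [k₄, k₃, k₂, z₁] <;> simp
  · rw [k₄, k₃, k₂, k₁, r3] <;> simp
  · rw [k₄, k₃, k₂, k₁, r4] <;> simp [hc]
  · rw [k₄, k₃, z₂] <;> simp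
  · rw [k₄, k₃, k₂, k₁, r9] <;> simp
  · rw [k₄, k₃, k₂, k₁, r10] <;> simp [hc]
  · rw [k₄, z₃] <;> simp
  · intro i hi
    by_cases h1 : i = (corner s .y : Z)
    · right
      subst h1
      rw [o₄, o₃, o₂, q₁] <;> simp [hc, hc0]
    by_cases h2 : i = (corner s .c : Z)
    · right
      subst h2
      rw [o₄, o₃, q₂, o₁] <;> simp [hc, hc0]
    by_cases h3 : i = (corner s .w : Z)
    · right
      subst h3
      rw [o₄, q₃, o₂, o₁] <;> simp [hc, hc0]
    by_cases h4 : i = (corner s .x : Z)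
    · right
      subst h4
      rw [q₄, o₃, o₂, o₁] <;> simp [hc, hc0]
    · left
      rw [o₄, o₃, o₂, o₁] <;> simp [hi, h1, h2, h3, h4]
  · intro i j
    rw [e₄, e₃, e₂, e₁, derived_adj_num]
    by_cases hi : i = 0 <;> by_cases hj : j = 0 <;>
      simp [hi, hj, flippedCorners, and_assoc]
  · intro i L
    rw [e₄, e₃, e₂, e₁, derived_adj_lett]
    simp
  · intro L L'
    rw [e₄, e₃, e₂, e₁]
    cases L <;> cases L' <;> simp [hll, flippedPairs]

/-- The vertices that the names of the spots refer to. -/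
def spotVertex (s : ℕ) : Surgery.Spot → DerivedVertex (12 * s + 6)
  | .o => num 0
  | .a => lett _ .a
  | .b => lett _ .b
  | .c => lett _ .c
  | .u => lett _ .u
  | .v => lett _ .v
  | .w => lett _ .w
  | .x => lett _ .x
  | .y => lett _ .y₀
  | .D => num (corner s .v : ZMod (12 * s + 6))
  | .E => num (corner s .a : ZMod (12 * s + 6))

theorem spotVertex_injective (hs : 1 ≤ s) : (spotVertex s).Injective := by
  have hc : ∀ l l' : CornerLabel, (corner s l : Z) = corner s l' ↔ l = l' := fun _ _ =>
    natCast_corner_inj hs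
  have hc0 : ∀ l : CornerLabel, (corner s l : Z) ≠ 0 := corner_ne_zero
  intro i j hij
  cases i <;> cases j <;>
    simp only [spotVertex, Sum.inl.injEq, Sum.inr.injEq, reduceCtorEq, hc] at hij ⊢
  exacts [(hc0 _ hij.symm).elim, (hc0 _ hij.symm).elim, (hc0 _ hij).elim, (hc0 _ hij).elim]

theorem spotVertex_eq_lett {i : Surgery.Spot} (hi : i.IsLetter) :
    ∃ L, L ≠ .y₁ ∧ spotVertex s i = lett _ L := by
  obtain ⟨h1, h2, h3⟩ := hi
  cases i <;> simp [spotVertex] at *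

theorem exists_spot {L : Letter} (hL : L ≠ .y₁) :
    ∃ i : Surgery.Spot, i.IsLetter ∧ spotVertex s i = lett _ L := by
  cases L
  exacts [⟨.a, by decide, rfl⟩, ⟨.b, by decide, rfl⟩, ⟨.c, by decide, rfl⟩, ⟨.u, by decide, rfl⟩,
    ⟨.v, by decide, rfl⟩, ⟨.w, by decide, rfl⟩, ⟨.x, by decide, rfl⟩, ⟨.y, by decide, rfl⟩,
    absurd rfl hL]

variable {hs h} {M₁ : RotationSystem (DerivedVertex (12 * s + 6))}

theorem IsFlipped.adj_spotVertex_iff (hM : IsFlipped hs h M₁) {i j : Surgery.Spot}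
    (hi : i.IsLetter) (hj : j.IsLetter) :
    M₁.graph.Adj (spotVertex s i) (spotVertex s j) ↔ (i, j) ∈ Surgery.initialPairs := by
  obtain ⟨hi1, hi2, hi3⟩ := hi
  obtain ⟨hj1, hj2, hj3⟩ := hj
  cases i <;> first | contradiction | skip
  all_goals cases j <;> first | contradiction | skip
  all_goals
    refine (hM.adj_lett _ _).trans ?_
    decide

/-- The triangles from which the surgery starts are present after the edge flips. -/
theorem IsFlipped.realizes_initial (hM : IsFlipped hs h M₁) :
    Surgery.Realizes (spotVertex s) M₁ Surgery.initial M₁ := by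
  have hnear : ∀ L : Letter, L ≠ .y₁ → M₁.graph.Adj (lett _ L) (num 0) := by
    intro L hL
    refine ((hM.adj_num_lett _ _).2 ?_).symm
    rw [ZMod.val_zero]
    cases L <;> trivial
  have htri : ∀ t ∈ [(Surgery.Spot.u, Surgery.Spot.o, Surgery.Spot.y), (.y, .o, .D), (.D, .o, .v),
      (.v, .o, .c), (.b, .o, .x), (.x, .o, .E), (.E, .o, .a), (.a, .o, .w)],
      M₁.IsTriangle (spotVertex s t.1) (spotVertex s t.2.1) (spotVertex s t.2.2) := by
    have hT : ∀ {x y}, M₁.graph.Adj x (num 0) → M₁.rot (num 0) x = y →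
        M₁.IsTriangle x (num 0) y := fun hx hy => hM.isTriangular.isTriangle hx hy
    simp only [List.mem_cons, List.not_mem_nil, or_false, forall_eq_or_imp, forall_eq]
    have hy := hT (hnear .y₀ (by decide)) hM.rot_y
    have hx := hT (hnear .x (by decide)) hM.rot_x
    exact ⟨hT (hnear .u (by decide)) hM.rot_u, hy, hT hy.rotate.1.symm hM.rot_D,
      hT (hnear .v (by decide)) hM.rot_v, hT (hnear .b (by decide)) hM.rot_b, hx,
      hT hx.rotate.1.symm hM.rot_E, hT (hnear .a (by decide)) hM.rot_a⟩
  have hcorner : ∀ x y z, (x, y, z) ∈ Surgery.initial.corners →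
      M₁.graph.Adj (spotVertex s x) (spotVertex s y) ∧
      M₁.rot (spotVertex s y) (spotVertex s x) = spotVertex s z := by
    intro x y z hm
    rw [Surgery.initial, List.mem_flatMap] at hm
    obtain ⟨t, ht, hm⟩ := hm
    have := htri t ht
    simp only [List.mem_cons, List.not_mem_nil, or_false, Prod.mk.injEq] at hm
    rcases hm with ⟨rfl, rfl, rfl⟩ | ⟨rfl, rfl, rfl⟩ | ⟨rfl, rfl, rfl⟩
    · exact ⟨this.1, this.2.1⟩
    · exact ⟨this.rotate.1, this.rotate.2.1⟩
    · exact ⟨this.rotate.rotate.1, this.rotate.rotate.2.1⟩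
  exact ⟨fun x y z hm => (hcorner x y z hm).1, fun x y z hm => (hcorner x y z hm).2,
    fun _ _ _ => rfl, fun _ _ => rfl, rfl, rfl, fun _ _ => by simp [Surgery.initial]⟩

theorem IsFlipped.exists_fourHandles (hM : IsFlipped hs h M₁) :
    ∃ M₂, FourHandles (derived hs h) M₁ M₂ := by
  have hφ := spotVertex_injective (s := s) hs
  obtain ⟨M₂, hk, hR⟩ := hM.realizes_initial.run hφ
    (fun i j hi hj hij => (hM.adj_spotVertex_iff hi hj).1 hij) Surgery.run_script
    (RotationSystem.HandleSteps.refl M₁)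
  rw [Surgery.handles_script, zero_add] at hk
  refine ⟨M₂, hk, hR.isTriangular hM.isTriangular Surgery.final_triangles Surgery.final_corners,
    ?_, fun i hi => ?_⟩
  · ext X Y
    rw [hR.adj_iff, SimpleGraph.sup_adj]
    constructor
    · rintro (hXY | ⟨i, j, hij, rfl, rfl⟩)
      · exact .inl hXY
      · right
        obtain ⟨hi, hj, hne⟩ := (Surgery.mem_final_added_iff i j).1 (.inl hij)
        obtain ⟨L, hL, eL⟩ := spotVertex_eq_lett (s := s) hi
        obtain ⟨L', hL', eL'⟩ := spotVertex_eq_lett (s := s) hj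
        refine ⟨L, L', eL, eL', fun hLL => hne (hφ ?_), hL, hL'⟩
        rw [eL, eL', hLL]
    · rintro (hXY | ⟨L, L', rfl, rfl, hne, hL, hL'⟩)
      · exact .inl hXY
      · obtain ⟨i, hi, ei⟩ := exists_spot (s := s) hL
        obtain ⟨j, hj, ej⟩ := exists_spot (s := s) hL'
        have hij : i ≠ j := by
          rintro rfl
          exact hne (Sum.inr_injective (ei.symm.trans ej))
        rw [← ei, ← ej]
        rcases (Surgery.mem_final_added_iff i j).2 ⟨hi, hj, hij⟩ with hm | hm
        · exact .inr ⟨i, j, hm, rfl, rfl⟩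
        · exact .inl ((hM.adj_spotVertex_iff hi hj).2 hm)
  · have : M₂.rot (num i) = M₁.rot (num i) := by
      by_cases h1 : i = (corner s .v : Z)
      · rw [h1]; exact hR.rot_D
      by_cases h2 : i = (corner s .a : Z)
      · rw [h2]; exact hR.rot_E
      refine hR.rot_eq' _ fun j _ _ => ?_
      cases j <;> simp [spotVertex, hi, h1, h2]
    rw [this]
    exact hM.rot_num i hi

end OrderThree

/-! ### The last two handles and the contraction -/

theorem Letter.near_or {L : Letter} (hL : L ≠ .y₁) (m : ℕ) :
    L.Near m ∨ L = .y₀ ∧ Letter.y₁.Near m := by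
  cases L <;> simp [Letter.Near] at *
  omega

namespace OrderThree

variable {s : ℕ} {r : Perm (ZMod (12 * s + 6))} {hs : 1 ≤ s} {h : IsAdmissible s r}

local notation "Z" => ZMod (12 * s + 6)

/-- In `M` every two numbers are adjacent, except that `0` is not adjacent to the corners labelled
by `ls`; every two letters besides `y₁` are adjacent, and letters and numbers are adjacent as in the
derived embedding. -/
structure IsCompleteExcept (M : RotationSystem (DerivedVertex (12 * s + 6)))
    (ls : List CornerLabel) : Prop where
  adj_num : ∀ i j : Z, M.graph.Adj (num i) (num j) ↔
    i ≠ j ∧ (i = 0 → ∀ l ∈ ls, j ≠ (corner s l : Z)) ∧ (j = 0 → ∀ l ∈ ls, i ≠ (corner s l : Z))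
  adj_num_lett : ∀ (i : Z) L, M.graph.Adj (num i) (lett _ L) ↔ L.Near i.val
  adj_lett : ∀ L L', M.graph.Adj (lett _ L) (lett _ L') ↔ L ≠ L' ∧ L ≠ .y₁ ∧ L' ≠ .y₁

variable {M₁ M₂ M₃ : RotationSystem (DerivedVertex (12 * s + 6))}

theorem IsFlipped.isCompleteExcept (hM : IsFlipped hs h M₁)
    (hG : M₂.graph = M₁.graph ⊔ lettersComplete (12 * s + 6)) :
    IsCompleteExcept M₂ flippedCorners where
  adj_num i j := by simp [hG, hM.adj_num, lettersComplete]
  adj_num_lett i L := by simp [hG, hM.adj_num_lett, lettersComplete]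
  adj_lett L L' := by
    simp only [hG, SimpleGraph.sup_adj, hM.adj_lett, lettersComplete, Sum.inr.injEq,
      exists_eq_left', ↓existsAndEq, true_and]
    cases L <;> cases L' <;> decide

/-- The four handles leave the successors in the rotation at `i ≠ 0` as they are in the derived
embedding, except around `0`. -/
theorem rot_num_of_fourHandles {D : RotationSystem (DerivedVertex (12 * s + 6))}
    (hM : FourHandles D M₁ M₂) {i : Z} (hi : i ≠ 0) {x y : DerivedVertex (12 * s + 6)}
    (hxy : D.rot (num i) x = y) (hx : x ≠ num 0) (hy : y ≠ num 0) : M₂.rot (num i) x = y := by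
  rcases hM.2.2.2 i hi with e | e
  · rw [e, hxy]
  · rw [e, Perm.mul_apply, swap_apply_of_ne_of_ne _ hx, hxy]
    rintro rfl
    exact hy (by rw [← hxy, apply_symm_apply])

/-- The fifth handle. The triangle `[y₁, ε, -ε]` is not affected. -/
theorem exists_fifthHandle (hM : FourHandles (derived hs h) M₁ M₂)
    (hC : IsCompleteExcept M₂ flippedCorners)
    {z : DerivedVertex (12 * s + 6)}
    (hzT : (derived hs h).IsTriangle z (num (corner s .w : Z)) (num (corner s .y : Z)))
    (hz0 : M₂.graph.Adj (num 0) z) (hzc : M₂.graph.Adj (num (corner s .c : Z)) z)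
    (hzw : M₂.graph.Adj (num (corner s .w : Z)) z) (hzx : z ≠ num (corner s .x : Z))
    (hza : z ≠ num (corner s .a : Z)) :
    ∃ M₃, FifthHandle (corner s .c : Z) (corner s .y : Z) z M₂ M₃ ∧
      M₃.arcPerm.cycleCount + 2 = M₂.arcPerm.cycleCount ∧
      Nat.card M₃.graph.edgeSet = Nat.card M₂.graph.edgeSet + 3 ∧ IsCompleteExcept M₃ [.x] ∧
      M₃.IsTriangle (lett _ .y₁) (num (corner s .x : Z)) (num (corner s .a : Z)) := by
  have hc : ∀ l l' : CornerLabel, (corner s l : Z) = corner s l' ↔ l = l' := fun _ _ =>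
    natCast_corner_inj hs
  have hc0 : ∀ l : CornerLabel, (corner s l : Z) ≠ 0 := corner_ne_zero
  have hnadj : ∀ l ∈ flippedCorners, ¬ M₂.graph.Adj (num 0) (num (corner s l : Z)) :=
    fun l hl hadj => ((hC.adj_num _ _).1 hadj).2.1 rfl l hl rfl
  have hT := hM.2.1.isTriangle hzw.symm (rot_num_of_fourHandles hM (hc0 _) hzT.2.1
    hz0.ne' (by simp [hc0]))
  have hx1 : ((corner s .x : Z)).val = 1 := by
    rw [ZMod.val_natCast, Nat.mod_eq_of_lt (corner_lt _), corner]
  have hnear : Letter.y₁.Near ((corner s .x : Z)).val := by rw [hx1]; rfl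
  have hadj : M₂.graph.Adj (lett _ .y₁) (num (corner s .x : Z)) :=
    ((hC.adj_num_lett _ _).2 hnear).symm
  have hrot : (derived hs h).rot (num (corner s .x : Z)) (lett _ .y₁) =
      num (corner s .a : Z) := by
    rw [derived_rot_num_lett hs h hnear, hx1, ← neg_corner_eq (l := .x) (l' := .a)]
    · congr 1
    · simp only [corner]
      ring
  have hT' := hM.2.1.isTriangle hadj (rot_num_of_fourHandles hM (hc0 _) hrot (by simp)
    (by simp [hc0]))
  -- Of the four corners that `0` misses, the three new edges leave only `ε`.
  have hfree : ∀ k : Z, ((∀ l ∈ flippedCorners, k ≠ (corner s l : Z)) ∨ k = (corner s .y : Z) ∨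
      k = (corner s .c : Z) ∨ k = (corner s .w : Z)) ↔
      ∀ l ∈ [CornerLabel.x], k ≠ (corner s l : Z) := by
    intro k
    by_cases hk : k = (corner s .x : Z)
    · simp [hk, flippedCorners, hc]
    · simp only [flippedCorners, List.mem_cons, List.not_mem_nil, or_false, forall_eq_or_imp,
        forall_eq, ne_eq, hk, not_false_eq_true, and_true, iff_true]
      tauto
  have eγ : -(corner s .c : Z) = (corner s .w : Z) :=
    neg_corner_eq (by simp only [corner]; omega)
  obtain ⟨H₁, H₂, H₃, M₃, k₁, k₂, k₃, k₄, k₅, hcount, hcard, hA, hrot₃⟩ :=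
    RotationSystem.exists_handle_and_three_edges hM.2.1 hT hz0 hzc (by simp [(hc0 _).symm])
      (by simp [(hc0 _).symm]) (by simp [(hc0 _).symm]) (by simp [hc]) (by simp [hc])
      (hnadj _ (by decide)) (hnadj _ (by decide)) (hnadj _ (by decide))
  refine ⟨M₃, ⟨H₁, H₂, H₃, k₁, ?_, k₃, k₄, ?_⟩, hcount, hcard, ⟨?_, ?_, ?_⟩, ?_⟩
  · rw [eγ]
    convert k₂ using 1
  · rwa [eγ]
  · intro i j
    rw [hA, hC.adj_num]
    by_cases hi : i = 0 <;> by_cases hj : j = 0 <;>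
      simp only [hi, hj, Sum.inl.injEq, not_true_eq_false, ne_eq, false_and, not_false_eq_true,
        true_and, false_or, forall_const, IsEmpty.forall_iff, and_true, (hc0 _).symm, or_false]
    · simpa only [Ne.symm hj, not_false_eq_true, true_and] using hfree j
    · exact hfree i
  · intro i L
    rw [hA, hC.adj_num_lett]
    simp
  · intro L L'
    rw [hA, hC.adj_lett]
    simp
  · have hz1 : z ≠ lett _ .y₁ := by
      rintro rfl
      simpa [Letter.Near] using (hC.adj_num_lett _ _).1 hz0
    obtain ⟨-, t₁, t₂, t₃⟩ := hT'
    refine ⟨(hA _ _).2 (.inl hadj), ?_, ?_, ?_⟩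
    · rw [hrot₃ _ hzx.symm, t₁] <;> simp [hc, hc0]
    · rw [hrot₃ _ hza.symm, t₂] <;> simp [hc, hc0]
    · rw [hrot₃ _ hz1.symm, t₃] <;> simp

/-- The final handle joins a face at the corner `(y₀, 0)` to the triangle `[y₁, ε, -ε]`. -/
theorem exists_finalHandle (hC : IsCompleteExcept M₃ [.x])
    (hT : M₃.IsTriangle (lett _ .y₁) (num (corner s .x : Z)) (num (corner s .a : Z))) :
    ∃ M₄, FinalHandle (corner s .x : Z) M₃ M₄ ∧
      M₄.arcPerm.cycleCount + 2 = M₃.arcPerm.cycleCount ∧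
      Nat.card M₄.graph.edgeSet = Nat.card M₃.graph.edgeSet + 2 ∧
      (∀ i j : Z, M₄.graph.Adj (num i) (num j) ↔ i ≠ j) ∧
      (∀ (i : Z) L, M₄.graph.Adj (num i) (lett _ L) ↔ L.Near i.val) ∧
      ∀ L L', M₄.graph.Adj (lett _ L) (lett _ L') ↔ L ≠ L' ∧
        ((L ≠ .y₁ ∧ L' ≠ .y₁) ∨ (L, L') = (.y₀, .y₁) ∨ (L, L') = (.y₁, .y₀)) := by
  have hc0 : ∀ l : CornerLabel, (corner s l : Z) ≠ 0 := corner_ne_zero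
  have h0 : M₃.graph.Adj (num 0) (lett _ .y₀) :=
    (hC.adj_num_lett _ _).2 (by rw [ZMod.val_zero]; rfl)
  obtain ⟨H, M₄, k₁, k₂, hcount, hcard, hA⟩ := RotationSystem.exists_edge_on_handle_and_edge hT
    h0.symm (by simp) (by simp [(hc0 _).symm]) (by simp [(hc0 _).symm]) (by simp) (by simp)
    (by simp [hC.adj_lett]) (by simp [hC.adj_num])
  refine ⟨M₄, ⟨h0, hT.1.symm, H, k₁, k₂⟩, hcount, hcard, fun i j => ?_, fun i L => ?_,
    fun L L' => ?_⟩
  · rw [hA, hC.adj_num]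
    by_cases hi : i = 0 <;> by_cases hj : j = 0 <;> simp [hi, hj, (hc0 _).symm]
    all_goals tauto
  · rw [hA, hC.adj_num_lett]
    simp
  · rw [hA, hC.adj_lett]
    cases L <;> cases L' <;> simp

/-- The numbers adjacent to `y₀` are even, those adjacent to `y₁` are odd, and no other letter is
adjacent to `y₁`; so the contraction of `y₀y₁` yields a complete graph. -/
theorem exists_contraction {M₄ : RotationSystem (DerivedVertex (12 * s + 6))}
    (hnum : ∀ i j : Z, M₄.graph.Adj (num i) (num j) ↔ i ≠ j)
    (hnl : ∀ (i : Z) L, M₄.graph.Adj (num i) (lett _ L) ↔ L.Near i.val)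
    (hlett : ∀ L L', M₄.graph.Adj (lett _ L) (lett _ L') ↔ L ≠ L' ∧
      ((L ≠ .y₁ ∧ L' ≠ .y₁) ∨ (L, L') = (.y₀, .y₁) ∨ (L, L') = (.y₁, .y₀))) :
    ∃ K : RotationSystem {t : DerivedVertex (12 * s + 6) // t ≠ lett (12 * s + 6) .y₁},
      M₄.IsContraction (lett _ .y₀) (lett _ .y₁) K ∧ K.graph = ⊤ ∧
      Nat.card K.Face = Nat.card M₄.Face ∧
      Nat.card K.graph.edgeSet + 1 = Nat.card M₄.graph.edgeSet := by
  have hyy : M₄.graph.Adj (lett _ .y₀) (lett _ .y₁) := by simp [hlett]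
  have h0 : M₄.graph.Adj (lett _ .y₀) (num 0) := ((hnl _ _).2 (by rw [ZMod.val_zero]; rfl)).symm
  have h1 : M₄.graph.Adj (lett _ .y₁) (num (corner s .x : Z)) := by
    refine ((hnl _ _).2 ?_).symm
    rw [ZMod.val_natCast, Nat.mod_eq_of_lt (corner_lt _), corner]
    rfl
  have hp : M₄.rot (lett _ .y₀) (lett _ .y₁) ≠ lett _ .y₁ :=
    (M₄.isCycleOn _).apply_ne ⟨_, hyy, _, h0, by simp⟩ hyy
  have hq : M₄.rot (lett _ .y₁) (lett _ .y₀) ≠ lett _ .y₀ :=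
    (M₄.isCycleOn _).apply_ne ⟨_, hyy.symm, _, h1, by simp⟩ hyy.symm
  have hcom : ∀ t, ¬ (M₄.graph.Adj (lett _ .y₀) t ∧ M₄.graph.Adj (lett _ .y₁) t) := by
    rintro (i | L) ⟨g₁, g₂⟩
    · have e₁ : i.val % 2 = 0 := (hnl _ _).1 g₁.symm
      have e₂ : i.val % 2 = 1 := (hnl _ _).1 g₂.symm
      omega
    · rw [hlett] at g₁ g₂
      cases L <;> simp at g₁ g₂
  obtain ⟨K, hK⟩ := RotationSystem.exists_isContraction hyy hcom hp hq
  refine ⟨K, hK, ?_, hK.card_face hp hq, hK.card_edgeSet⟩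
  ext ⟨X, hX⟩ ⟨Y, hY⟩
  rw [hK.2.2.1, SimpleGraph.top_adj, and_iff_left_iff_imp]
  intro hne
  rcases X with i | L <;> rcases Y with j | L'
  · exact .inl ((hnum _ _).2 (by simpa using hne))
  · rcases Letter.near_or (L := L') (by simpa using hY) i.val with hL | ⟨rfl, hL⟩
    · exact .inl ((hnl _ _).2 hL)
    · exact .inr (.inr ⟨rfl, (hnl _ _).2 hL⟩)
  · rcases Letter.near_or (L := L) (by simpa using hX) j.val with hL | ⟨rfl, hL⟩
    · exact .inl ((hnl _ _).2 hL).symm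
    · exact .inr (.inl ⟨rfl, ((hnl _ _).2 hL).symm⟩)
  · refine .inl ((hlett _ _).2 ⟨by simpa using hne, .inl ⟨by simpa using hX, by simpa using hY⟩⟩)

end OrderThree

/-! ### Assembling the embedding of the complete graph -/

/-- The fraction is `12 * s ^ 2 + 21 * s + 110 / 12`. -/
theorem natCeil_genus (s : ℕ) :
    ⌈((12 * s + 14 - 3) * (12 * s + 14 - 4) / 12 : ℚ)⌉₊ = 12 * s ^ 2 + 21 * s + 10 := by
  rw [Nat.ceil_eq_iff (by omega)]
  push_cast [Nat.cast_sub (show 1 ≤ 12 * s ^ 2 + 21 * s + 10 by omega)]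
  constructor <;> nlinarith

/-- There are `12 * s + 6` numbers and nine letters. -/
theorem card_vertices_ne (s : ℕ) : Nat.card
    {t : DerivedVertex (12 * s + 6) // t ≠ lett (12 * s + 6) .y₁} = 12 * s + 14 := by
  have h1 : Nat.card Letter = 9 := by rw [Nat.card_eq_fintype_card]; rfl
  have h2 := Set.ncard_add_ncard_compl {lett (12 * s + 6) .y₁}
  rw [Set.ncard_singleton, Nat.card_sum, Nat.card_zmod, h1] at h2
  change Nat.card ({lett (12 * s + 6) .y₁}ᶜ : Set _) = _
  rw [Nat.card_coe_set_eq]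
  omega

namespace OrderThree

variable {s : ℕ} {r : Perm (ZMod (12 * s + 6))}

local notation "Z" => ZMod (12 * s + 6)

theorem IsCompleteExcept.adj_of_derived {M : RotationSystem (DerivedVertex (12 * s + 6))}
    (hM : IsCompleteExcept M flippedCorners) {hs : 1 ≤ s} {h : IsAdmissible s r} {i : Z}
    {z : DerivedVertex (12 * s + 6)} (hz : (derived hs h).graph.Adj (num i) z) (h0 : z ≠ num 0)
    (hc : ∀ l ∈ flippedCorners, z ≠ num (corner s l : Z)) : M.graph.Adj (num i) z := by
  rcases z with j | L
  · exact (hM.adj_num _ _).2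
      ⟨hz, fun _ l hl e => hc l hl (by rw [e]), fun e => (h0 (by rw [e])).elim⟩
  · exact (hM.adj_num_lett _ _).2 hz

/-- The whole construction. The derived embedding stays triangular up to `M₂`, so `3 |F| = 2 |E|`
there. The handle at `z` turns three faces into one, which three edges divide again; the edge on the
final handle merges two faces, and the next one divides a face. So in total one face and five edges
are gained, and the contraction takes one edge away. -/
theorem exists_embedding (hs : 1 ≤ s) (h : IsAdmissible s r) {z : DerivedVertex (12 * s + 6)}
    (hzT : (derived hs h).IsTriangle z (num (corner s .w : Z)) (num (corner s .y : Z)))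
    (hz0 : (derived hs h).graph.Adj (num 0) z)
    (hzγ : (derived hs h).graph.Adj (num (corner s .c : Z)) z)
    (hz : ∀ l ∈ .a :: flippedCorners, z ≠ num (corner s l : Z)) :
    ∃ (M₁ M₂ M₃ M₄ : RotationSystem (DerivedVertex (12 * s + 6)))
      (K : RotationSystem {t : DerivedVertex (12 * s + 6) // t ≠ lett (12 * s + 6) .y₁}),
      FourFlips (corner s .c : Z) (corner s .y : Z) (corner s .x : Z) (derived hs h) M₁ ∧
      FourHandles (derived hs h) M₁ M₂ ∧
      FifthHandle (corner s .c : Z) (corner s .y : Z) z M₂ M₃ ∧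
      FinalHandle (corner s .x : Z) M₃ M₄ ∧
      M₄.IsContraction (lett (12 * s + 6) .y₀) (lett (12 * s + 6) .y₁) K ∧ K.graph = ⊤ ∧
      3 * Nat.card K.Face + 5 = 2 * Nat.card K.graph.edgeSet := by
  obtain ⟨M₁, h₁, hM₁⟩ := exists_fourFlips hs h
  obtain ⟨M₂, h₂⟩ := hM₁.exists_fourHandles
  have hM₂ := hM₁.isCompleteExcept h₂.2.2.1
  have hadj : ∀ i : Z, (derived hs h).graph.Adj (num i) z → M₂.graph.Adj (num i) z := fun i hi =>
    hM₂.adj_of_derived hi hz0.ne' fun l hl => hz l (List.mem_cons_of_mem _ hl)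
  obtain ⟨M₃, h₃, c₃, e₃, hM₃, hT⟩ := exists_fifthHandle h₂ hM₂ hzT (hadj _ hz0) (hadj _ hzγ)
    (hadj _ hzT.1.symm) (hz _ (by decide)) (hz _ (by decide))
  obtain ⟨M₄, h₄, c₄, e₄, hnum, hnl, hlett⟩ := exists_finalHandle hM₃ hT
  obtain ⟨K, hK, htop, hF, hE⟩ := exists_contraction hnum hnl hlett
  refine ⟨M₁, M₂, M₃, M₄, K, h₁, h₂, h₃, h₄, hK, htop, ?_⟩
  have f₂ := h₂.2.1.three_mul_card_face
  have g₂ := M₂.cycleCount_arcPerm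
  have g₄ := M₄.cycleCount_arcPerm
  omega

theorem log_smallRot : ∃ a : (orderThreeGraph 1 smallRot).Arc,
    (orderThreeGraph 1 smallRot).log a 18 =
      [(9, none), (9, none), (6, none), (13, some .u), (2, some .y), (16, some .v),
       (8, some .c), (4, none), (7, none), (12, none), (3, none), (14, some .b),
       (1, some .x), (17, some .a), (10, some .w), (5, none), (11, none), (15, none)] :=
  -- The walk from the arc `half 1` meets the element of order 2 twice at its beginning.
  ⟨half 1, by decide⟩

theorem derived_isTriangle_smallRot : (derived le_rfl isAdmissible_smallRot).IsTriangle
    (lett (12 * 1 + 6) .b) (num (corner 1 .w : ZMod (12 * 1 + 6)))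
    (num (corner 1 .y : ZMod (12 * 1 + 6))) := by
  have hnear : Letter.b.Near ((corner 1 .w : ZMod (12 * 1 + 6))).val := trivial
  refine (derived_isTriangular le_rfl isAdmissible_smallRot).isTriangle
    ((derived_adj_lett _ _).2 hnear).symm ?_
  rw [derived_rot_num_lett _ _ hnear]
  decide

/-- The walk of the current graph has the step from `9` to `3 * s + 7`, which puts `δ` behind
`9 * s + 10` in the rotation at `-γ = 9 * s + 1`. -/
theorem derived_isTriangle_largeRot (hs : 2 ≤ s) :
    (derived (le_of_lt hs) (isAdmissible_largeRot hs)).IsTriangle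
      (num ((9 * s + 10 : ℕ) : Z)) (num (corner s .w : Z)) (num (corner s .y : Z)) := by
  have hn : ((12 * s + 6 : ℕ) : Z) = 0 := ZMod.natCast_self _
  have hne : ((9 * s + 10 : ℕ) : Z) ≠ (corner s .w : Z) := by
    rw [Ne, natCast_eq_iff_of_lt (by omega) (corner_lt _), corner]
    omega
  refine (derived_isTriangular _ _).isTriangle ((derived_adj_num _ _).2 hne) ?_
  have hadd : ((9 * s + 10 : ℕ) : Z) = (corner s .w : Z) + (9 : ℕ) := by
    simp only [corner]
    push_cast
    ring
  rw [derived_rot_num_num]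
  · rw [hadd, sub_add_cancel_left, neg_natCast_eq (b := 12 * s - 3) (by omega),
      largeRot_natCast hs (by omega)]
    have : succArc s (12 * s - 3) = 3 * s + 7 := by
      obtain rfl | hs := hs.eq_or_lt
      · rfl
      · have := succArc_D₃ (s := s) (k := s - 3) (by omega)
        rwa [show 6 * s + 15 + 6 * (s - 3) = 12 * s - 3 by omega,
          show 6 * s - 2 - 3 * (s - 3) = 3 * s + 7 by omega] at this
    rw [this, ← Nat.cast_add, corner, show 9 * s + 1 + (3 * s + 7) = 12 * s + 6 + 2 by ring,
      Nat.cast_add, hn, zero_add, corner]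
  · intro l
    rw [hadd, Ne, add_right_inj, natCast_eq_iff_of_lt (by omega) (corner_lt _)]
    cases l <;> simp only [corner] <;> omega

end OrderThree

theorem mainTheorem2 (s : ℕ) (hs : 1 ≤ s) (γ δ ε : ZMod (12 * s + 6))
    (hγ : γ = 3 * s + 5) (hδ : δ = 2) (hε : ε = 1) (z : DerivedVertex (12 * s + 6))
    (hz : z = if s = 1 then lett (12 * s + 6) .b else num (9 * s + 10)) :
    ∃ G : CurrentGraph (ZMod (12 * s + 6)) CornerLabel,
      G.IsStandard ∧ G.HasVortices γ δ ε ∧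
      (s = 1 → ∃ a, G.log a 18 =
        [(9, none), (9, none), (6, none), (13, some .u), (2, some .y), (16, some .v),
         (8, some .c), (4, none), (7, none), (12, none), (3, none), (14, some .b),
         (1, some .x), (17, some .a), (10, some .w), (5, none), (11, none), (15, none)]) ∧
      ∃ D : RotationSystem (DerivedVertex (12 * s + 6)),
        G.IsDerived D ∧ D.IsTriangular ∧ D.IsTriangle z (num (-γ)) (num δ) ∧
        ∃ (M₁ M₂ M₃ M₄ : RotationSystem (DerivedVertex (12 * s + 6)))
          (K : RotationSystem {t : DerivedVertex (12 * s + 6) // t ≠ lett (12 * s + 6) .y₁}),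
          FourFlips γ δ ε D M₁ ∧ FourHandles D M₁ M₂ ∧ FifthHandle γ δ z M₂ M₃ ∧
          FinalHandle ε M₃ M₄ ∧
          M₄.IsContraction (lett (12 * s + 6) .y₀) (lett (12 * s + 6) .y₁) K ∧
          Nat.card {t : DerivedVertex (12 * s + 6) // t ≠ lett (12 * s + 6) .y₁} = 12 * s + 14 ∧
          K.graph = ⊤ ∧ K.IsMinimumGenus ∧
          K.HasGenus ⌈((12 * s + 14 - 3) * (12 * s + 14 - 4) / 12 : ℚ)⌉₊ ∧
          IsLeast {g : ℕ | ∃ N : RotationSystem (Fin (12 * s + 14)), N.graph = ⊤ ∧ N.HasGenus g}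
            ⌈((12 * s + 14 - 3) * (12 * s + 14 - 4) / 12 : ℚ)⌉₊ := by
  have eγ : γ = (corner s .c : ZMod (12 * s + 6)) := by rw [hγ]; simp [corner]
  have eδ : δ = (corner s .y : ZMod (12 * s + 6)) := by rw [hδ]; simp [corner]
  have eε : ε = (corner s .x : ZMod (12 * s + 6)) := by rw [hε]; simp [corner]
  obtain ⟨r, h, hlog, hzT, hz0, hzγ, hzc⟩ : ∃ (r : Perm (ZMod (12 * s + 6)))
      (h : IsAdmissible s r), (s = 1 → ∃ a, (orderThreeGraph s r).log a 18 =
        [(9, none), (9, none), (6, none), (13, some .u), (2, some .y), (16, some .v),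
         (8, some .c), (4, none), (7, none), (12, none), (3, none), (14, some .b),
         (1, some .x), (17, some .a), (10, some .w), (5, none), (11, none), (15, none)]) ∧
      (OrderThree.derived hs h).IsTriangle z (num (corner s .w : ZMod _))
        (num (corner s .y : ZMod _)) ∧
      (OrderThree.derived hs h).graph.Adj (num 0) z ∧
      (OrderThree.derived hs h).graph.Adj (num (corner s .c : ZMod _)) z ∧
      ∀ l ∈ .a :: OrderThree.flippedCorners, z ≠ num (corner s l : ZMod _) := by
    obtain rfl | hs' := hs.eq_or_lt
    · obtain rfl := hz.trans (if_pos rfl)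
      exact ⟨OrderThree.smallRot, OrderThree.isAdmissible_smallRot,
        fun _ => OrderThree.log_smallRot, OrderThree.derived_isTriangle_smallRot,
        (OrderThree.derived_adj_lett _ _).2 trivial, (OrderThree.derived_adj_lett _ _).2 trivial,
        by simp⟩
    · have hz' : z = num ((9 * s + 10 : ℕ) : ZMod (12 * s + 6)) := by
        rw [hz, if_neg hs'.ne']
        push_cast
        rfl
      have hne : ∀ k, k < 12 * s + 6 → k ≠ 9 * s + 10 →
          ((9 * s + 10 : ℕ) : ZMod (12 * s + 6)) ≠ (k : ℕ) := fun k hk hk' => by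
        rw [Ne, natCast_eq_iff_of_lt (by omega) hk]
        exact hk'.symm
      rw [hz']
      refine ⟨OrderThree.largeRot hs', OrderThree.isAdmissible_largeRot hs',
        fun h1 => absurd h1 hs'.ne', OrderThree.derived_isTriangle_largeRot hs',
        (OrderThree.derived_adj_num _ _).2 ?_, (OrderThree.derived_adj_num _ _).2 ?_, ?_⟩
      · exact_mod_cast (hne 0 (by omega) (by omega)).symm
      · exact (hne _ (OrderThree.corner_lt _) (by simp only [corner]; omega)).symm
      · intro l hl e
        refine hne _ (OrderThree.corner_lt l) ?_ (Sum.inl_injective e)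
        simp only [OrderThree.flippedCorners, List.mem_cons, List.not_mem_nil, or_false] at hl
        rcases hl with rfl | rfl | rfl | rfl | rfl <;> simp only [corner] <;> omega
  obtain ⟨M₁, M₂, M₃, M₄, K, h₁, h₂, h₃, h₄, hK, htop, hF⟩ :=
    OrderThree.exists_embedding hs h hzT hz0 hzγ hzc
  have hV := card_vertices_ne s
  have hg := K.hasGenus_of_card_face hV htop hF
  have : Finite {t : DerivedVertex (12 * s + 6) // t ≠ lett (12 * s + 6) .y₁} :=
    Nat.finite_of_card_ne_zero (by omega)
  refine ⟨orderThreeGraph s r, OrderThree.isStandard hs h, OrderThree.hasVortices hs h hγ hδ hε,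
    hlog, OrderThree.derived hs h, OrderThree.isDerived hs h, OrderThree.derived_isTriangular hs h,
    ?_, M₁, M₂, M₃, M₄, K, ?_, h₂, ?_, ?_, hK, hV, htop,
    K.isMinimumGenus_of_hasGenus hV htop hg, ?_, ?_, ?_⟩
  · rw [eγ, eδ, OrderThree.corner_c_eq_neg, neg_neg]
    exact hzT
  · rwa [eγ, eδ, eε]
  · rwa [eγ, eδ]
  · rwa [eε]
  · rwa [natCeil_genus]
  · rw [natCeil_genus]
    exact K.exists_hasGenus_of_equiv (Finite.equivFinOfCardEq hV) htop hg
  · rintro g ⟨N, hN, hN'⟩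
    rw [natCeil_genus]
    exact N.le_of_hasGenus (Nat.card_fin _) hN hN'
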